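/- Let $V:[0,1]\to[0,\infty)$ be Lipschitz and non-increasing, and let $\rho_0\in L^\infty(\mathbb R)$ satisfy $0\le\rho_0\le1$ a.e. and $\mathrm{TV}(\rho_0)<\infty$ (essential total variation). Let $c>0$, and for all $\varepsilon,h>0$ let $$\gamma_k^{\varepsilon,h}=\gamma_0^{\varepsilon,h}\,(1-\gamma_0^{\varepsilon,h})^k\quad(k\ge0),\qquad 0<\gamma_0^{\varepsilon,h}<1,\qquad \frac{1-\gamma_0^{\varepsilon,h}}{\gamma_0^{\varepsilon,h}}\le c\,\frac{\varepsilon}{h}.$$ Fix $\lambda>0$ such that $\lambda\,(\|V\|_{L^\infty}+\|V'\|_{L^\infty})\le1$ (norms on $[0,1]$), and put $\tau=\lambda h$. For $j\in\mathbb Z$, $n\ge0$ define $$\rho_j^0=\frac1h\int_{(j-\frac12)h}^{(j+\frac12)h}\rho_0(x)\,dx,\qquad W_j^n=\sum_{k=0}^\infty\gamma_k^{\varepsilon,h}\rho_{j+k}^n,\qquad \rho_j^{n+1}=\rho_j^n+\lambda\big(\rho_{j-1}^nV(W_j^n)-\rho_j^nV(W_{j+1}^n)\big),$$ and let $\rho_{\varepsilon,h}$,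 $W_{\varepsilon,h}$ be the functions on $[0,\infty)\times\mathbb R$ equal to $\rho_j^n$, respectively $W_j^n$, on $[n\tau,(n+1)\tau)\times[(j-\frac12)h,(j+\frac12)h)$. An entropy solution of $$\partial_t\rho+\partial_x\big(V(\rho)\rho\big)=0,\qquad \rho(0,\cdot)=\rho_0, \tag{1}$$ is a measurable function $\rho:[0,\infty)\times\mathbb R\to[0,1]$ with $t\mapsto\rho(t,\cdot)$ continuous from $[0,\infty)$ into $L^1_{\mathrm{loc}}(\mathbb R)$, $\rho(0,\cdot)=\rho_0$ a.e., and $$\int_0^\infty\!\!\int_{\mathbb R}\Big(|\rho-\kappa|\,\partial_t\varphi+\mathrm{sgn}(\rho-\kappa)\big(\rho V(\rho)-\kappa V(\kappa)\big)\partial_x\varphi\Big)dx\,dt+\int_{\mathbb R}|\rho_0-\kappa|\,\varphi(0,x)\,dx\ge0$$ for all $\kappa\in[0,1]$ and all nonnegative $\varphi\in C^1_c(\mathbb R^2)$. Then (1) has an entropy solution $\rho$, unique up to equality a.e. in $x$ for every $t\ge 0$, which depends only on $V$ and $\rho_0$, and, as $\varepsilon,h\searrow0$ (along any path), both $W_{\varepsilon,h}$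 and $\rho_{\varepsilon,h}$ converge to $\rho$ in $L^1_{\mathrm{loc}}([0,\infty)\times\mathbb R)$. Moreover, there is a constant $K>0$ depending only on $\lambda$, $\|V\|_{L^\infty}$, $\|V'\|_{L^\infty}$ and $c$ such that, for all $\varepsilon,h,t>0$, $$\|W_{\varepsilon,h}(t,\cdot)-\rho(t,\cdot)\|_{L^1(\mathbb R)}\le K\big(\varepsilon+h+\sqrt{\varepsilon t}+\sqrt{ht}\big)\mathrm{TV}(\rho_0),$$ $$\|\rho_{\varepsilon,h}(t,\cdot)-\rho(t,\cdot)\|_{L^1(\mathbb R)}\le K\big(\varepsilon+h+\sqrt{\varepsilon t}+\sqrt{ht}\big)\mathrm{TV}(\rho_0).$$ -/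

import Mathlib

open MeasureTheory Set Filter
open scoped Topology ENNReal

noncomputable section

namespace NonlocalGodunov

/-- Total variation of (the a.e.-class of) a function on the real line: the essential variation,
i.e. the least pointwise variation among all representatives. -/
def essVariation (f : ℝ → ℝ) : ℝ≥0∞ :=
  ⨅ (g : ℝ → ℝ) (_ : g =ᵐ[volume] f), eVariationOn g univ

/-- Initial data: `ρ₀ ∈ L^∞(ℝ)`, `0 ≤ ρ₀ ≤ 1`, `TV(ρ₀) < ∞`. -/
structure IsInitialDatum (ρ₀ : ℝ → ℝ) : Prop where
  aestronglyMeasurable : AEStronglyMeasurable ρ₀ volume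
  mem_Icc : ∀ᵐ x, ρ₀ x ∈ Icc (0 : ℝ) 1
  tv_lt_top : essVariation ρ₀ < ∞

/-- Velocity functions: nonnegative, Lipschitz and nonincreasing on `[0,1]`.
The values of `V` outside `[0,1]` are irrelevant. -/
structure IsVelocity (V : ℝ → ℝ) : Prop where
  lipschitz : ∃ L, LipschitzOnWith L V (Icc 0 1)
  antitone : AntitoneOn V (Icc 0 1)
  nonneg : ∀ ξ ∈ Icc (0 : ℝ) 1, 0 ≤ V ξ

/-- The `L^∞(0,1)` norm. -/
def supNorm (f : ℝ → ℝ) : ℝ :=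
  (eLpNorm f ∞ (volume.restrict (Icc (0 : ℝ) 1))).toReal

/-- The CFL condition `λ (‖V‖_∞ + ‖V'‖_∞) ≤ 1`. -/
def CFL (lam : ℝ) (V : ℝ → ℝ) : Prop :=
  lam * (supNorm V + supNorm (deriv V)) ≤ 1

/-- The leading weights `γ₀^{ε,h}` of a family of geometric quadrature weights with constant `c`. -/
def IsGeometricFamily (c : ℝ) (γ₀ : ℝ → ℝ → ℝ) : Prop :=
  ∀ ε h : ℝ, 0 < ε → 0 < h →
    0 < γ₀ ε h ∧ γ₀ ε h < 1 ∧ (1 - γ₀ ε h) / γ₀ ε h ≤ c * (ε / h)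

/-- The geometric quadrature weights `γ_k = g (1 - g)^k`. -/
def geomWeight (g : ℝ) (k : ℕ) : ℝ := g * (1 - g) ^ k

/-- The discrete nonlocal impact `W_j = ∑_{k ≥ 0} γ_k r_{j+k}`. -/
def impact (γ : ℕ → ℝ) (r : ℤ → ℝ) (j : ℤ) : ℝ := ∑' k : ℕ, γ k * r (j + k)

/-- Cell averages of the initial datum over `[(j-1/2)h, (j+1/2)h]`. -/
def cellAverage (h : ℝ) (ρ₀ : ℝ → ℝ) (j : ℤ) : ℝ :=
  1 / h * ∫ x in (((j : ℝ) - 1 / 2) * h)..(((j : ℝ) + 1 / 2) * h), ρ₀ x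

/-- The numerical density `ρ_j^n` of the Godunov-type scheme. -/
def density (V : ℝ → ℝ) (ρ₀ : ℝ → ℝ) (lam h : ℝ) (γ : ℕ → ℝ) : ℕ → ℤ → ℝ
  | 0 => cellAverage h ρ₀
  | n + 1 => fun j =>
      let r := density V ρ₀ lam h γ n
      r j + lam * (r (j - 1) * V (impact γ r j) - r j * V (impact γ r (j + 1)))

/-- The numerical nonlocal impact `W_j^n`. -/
def numImpact (V : ℝ → ℝ) (ρ₀ : ℝ → ℝ) (lam h : ℝ) (γ : ℕ → ℝ) (n : ℕ) : ℤ → ℝ :=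
  impact γ (density V ρ₀ lam h γ n)

/-- Piecewise constant reconstruction (for `t ≥ 0`): the value is `u n j` on the cell
`[nτ, (n+1)τ) × [(j-1/2)h, (j+1/2)h)`, see `reconstruct_eq`. -/
def reconstruct (τ h : ℝ) (u : ℕ → ℤ → ℝ) (t x : ℝ) : ℝ :=
  u ⌊t / τ⌋₊ ⌊x / h + 1 / 2⌋

theorem reconstruct_eq {τ h : ℝ} (hτ : 0 < τ) (hh : 0 < h) (u : ℕ → ℤ → ℝ) (n : ℕ) (j : ℤ)
    {t x : ℝ} (ht : t ∈ Ico (n * τ) ((n + 1) * τ))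
    (hx : x ∈ Ico (((j : ℝ) - 1 / 2) * h) (((j : ℝ) + 1 / 2) * h)) :
    reconstruct τ h u t x = u n j := by
  have h1 : ⌊t / τ⌋₊ = n := by
    have h0 : 0 ≤ t / τ := div_nonneg (le_trans (by positivity) ht.1) hτ.le
    rw [Nat.floor_eq_iff h0, le_div_iff₀ hτ, div_lt_iff₀ hτ]
    exact ht
  have h2 : ⌊x / h + 1 / 2⌋ = j := by
    rw [Int.floor_eq_iff]
    have a := (le_div_iff₀ hh).2 hx.1
    have b := (div_lt_iff₀ hh).2 hx.2
    constructor <;> linarith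
  rw [reconstruct, h1, h2]

/-- `ρ_{ε,h}`, with time step `τ = λ h` and weights `γ_k = γ₀^{ε,h} (1 - γ₀^{ε,h})^k`. -/
def approxDensity (V : ℝ → ℝ) (ρ₀ : ℝ → ℝ) (lam : ℝ) (γ₀ : ℝ → ℝ → ℝ) (ε h : ℝ) : ℝ → ℝ → ℝ :=
  reconstruct (lam * h) h (density V ρ₀ lam h (geomWeight (γ₀ ε h)))

/-- `W_{ε,h}`, with time step `τ = λ h` and weights `γ_k = γ₀^{ε,h} (1 - γ₀^{ε,h})^k`. -/
def approxImpact (V : ℝ → ℝ) (ρ₀ : ℝ → ℝ) (lam : ℝ) (γ₀ : ℝ → ℝ → ℝ) (ε h : ℝ) : ℝ → ℝ → ℝ :=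
  reconstruct (lam * h) h (numImpact V ρ₀ lam h (geomWeight (γ₀ ε h)))

/-- Kružkov's entropy flux `sgn(ξ - c) (ξ V(ξ) - c V(c))`. -/
def kruzkovFlux (V : ℝ → ℝ) (c ξ : ℝ) : ℝ := Real.sign (ξ - c) * (ξ * V ξ - c * V c)

/-- Entropy solutions of `∂ₜρ + ∂ₓ(V(ρ)ρ) = 0`, `ρ(0,·) = ρ₀`, in the class of measurable
functions with values in `[0,1]` that are continuous in time with values in `L¹_loc(ℝ)`
(so that `ρ(t,·)` is meaningful for every `t ≥ 0`).
As `V` lives on `[0,1]`, so do the Kružkov constants `c`; the inequalities for `c < 0` and `c > 1`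
would add nothing to those for `c = 0` and `c = 1`: the integrands then differ only by constants
times `∂ₜφ` and `∂ₓφ`, whose contributions cancel. -/
structure IsEntropySolution (V : ℝ → ℝ) (ρ₀ : ℝ → ℝ) (ρ : ℝ → ℝ → ℝ) : Prop where
  aestronglyMeasurable :
    AEStronglyMeasurable (fun z : ℝ × ℝ => ρ z.1 z.2) (volume.restrict (Ioi 0 ×ˢ univ))
  slice_aestronglyMeasurable : ∀ t, 0 ≤ t → AEStronglyMeasurable (ρ t) volume
  mem_Icc : ∀ t, 0 ≤ t → ∀ᵐ x, ρ t x ∈ Icc (0 : ℝ) 1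
  continuous_L1loc : ∀ t, 0 ≤ t → ∀ R : ℝ,
    Tendsto (fun s => ∫⁻ x in Icc (-R) R, ‖ρ s x - ρ t x‖ₑ) (𝓝[Ici 0] t) (𝓝 0)
  initial : ρ 0 =ᵐ[volume] ρ₀
  entropy : ∀ c ∈ Icc (0 : ℝ) 1, ∀ φ : ℝ × ℝ → ℝ,
    ContDiff ℝ 1 φ → HasCompactSupport φ → (∀ z, 0 ≤ φ z) →
    0 ≤ (∫ z in Ioi (0 : ℝ) ×ˢ (univ : Set ℝ),
          (|ρ z.1 z.2 - c| * deriv (fun s => φ (s, z.2)) z.1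
            + kruzkovFlux V c (ρ z.1 z.2) * deriv (fun y => φ (z.1, y)) z.2))
        + ∫ x, |ρ₀ x - c| * φ (0, x)

/-- Strong convergence `u_{ε,h} → ρ` in `L¹_loc([0,∞) × ℝ)` as `ε, h ↘ 0` along any path. -/
def ConvergesL1loc (u : ℝ → ℝ → ℝ → ℝ → ℝ) (ρ : ℝ → ℝ → ℝ) : Prop :=
  ∀ S : Set (ℝ × ℝ), IsCompact S → S ⊆ Ici 0 ×ˢ univ →
    Tendsto (fun p : ℝ × ℝ => ∫⁻ z in S, ‖u p.1 p.2 z.1 z.2 - ρ z.1 z.2‖ₑ)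
      (𝓝[>] 0 ×ˢ 𝓝[>] 0) (𝓝 0)

/-- The error bound `‖u(t,·) - ρ(t,·)‖_{L¹(ℝ)} ≤ K (ε + h + √(εt) + √(ht)) TV(ρ₀)`
for all `ε, h, t > 0`. -/
def ErrorBound (K : ℝ) (ρ₀ : ℝ → ℝ) (u : ℝ → ℝ → ℝ → ℝ → ℝ) (ρ : ℝ → ℝ → ℝ) : Prop :=
  ∀ ε h t : ℝ, 0 < ε → 0 < h → 0 < t →
    ∫⁻ x, ‖u ε h t x - ρ t x‖ₑ ≤
      ENNReal.ofReal (K * (ε + h + √(ε * t) + √(h * t))) * essVariation ρ₀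

end NonlocalGodunov

end

open MeasureTheory Set Filter
open scoped Topology ENNReal

noncomputable section

namespace NonlocalGodunov

/-! ### Velocities and entropy fluxes -/

/-! Because the weights are geometric, averaging is a two-term recursion, W_j = g r_j + (1-g)
W_{j+1} (`impact_step`), and the density can be eliminated from the scheme: W evolves by an upwind
step with speed V(W_j) plus a geometric average of the jumps W_k (V(W_k) - V(W_{k+1}))
(`SchemeState.impact_step_eq'`). Monotonicity of V and the CFL condition then yield, uniformly in ε
and h, values in [0,1], a non-increasing total variation of W (`SchemeState.tvd_step`) and discrete
Kružkov inequalities for W (`SchemeState.entropy_step`). Their numerical flux differs from the exact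
entropy flux in L¹ by at most a multiple of h (1 + 2/g) TV, which is O(h + ε) because h (1-g)/g ≤ c
ε. No variation bound for the density is needed: r_j - W_j = ((1-g)/g) (W_j - W_{j+1}), so the two
reconstructions are within c ε TV of each other.

The error estimate is a Kuznetsov-type argument. All that matters about the scheme is collected in
`IsApproximation`, and only the space variable is doubled: `doubledDist` is the L¹ distance of
v(t,·) and u_n, mollified at scale r and weighted so that it is finite. The derivatives of the
mollifier cancel between the two evolutions, up to the flux error. No mollification in time is
needed, since `coupled_le` handles directly a quantity that depends on a continuous time t and a
discrete time n. The estimate consists of an O(r) cost of mollifying, a term of order (h + ε) t / r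
from the flux error, and a remainder of order h + ε from the initial layer and one time step. The
choice r = √((h + ε) t) balances the first two.

The same comparison (`setLIntegral_sub_le`) serves three purposes. Against an entropy solution it
gives the rate. Against two entropy solutions with the same datum it gives uniqueness, as both are
limits of the same numerical solutions. Against a second, finer numerical solution, which satisfies
the entropy inequalities up to a defect E, it shows that numerical solutions form a Cauchy sequence;
their limit is the entropy solution, and no compactness theorem is used.

The comparison works with entropy inequalities between two times (`IsSliceEntropic`), tested in x
only. `isSliceEntropic_of_entropy` and `IsSliceEntropic.entropy` translate between these and the
space-time formulation in the definition of entropy solutions. -/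

/-- A velocity defined on the whole line, with explicit bounds. -/
structure IsGlobalVelocity (V : ℝ → ℝ) (M L : ℝ) : Prop where
  antitone : Antitone V
  nonneg : ∀ x, 0 ≤ V x
  le : ∀ x, V x ≤ M
  lip : ∀ x y, |V x - V y| ≤ L * |x - y|

/-- The extension of a velocity from `[0,1]` to the real line by constants. -/
def clampVelocity (V : ℝ → ℝ) (ξ : ℝ) : ℝ := V (max 0 (min 1 ξ))

theorem clamp_mem (ξ : ℝ) : max 0 (min 1 ξ) ∈ Icc (0 : ℝ) 1 :=
  ⟨le_max_left _ _, max_le zero_le_one (min_le_left _ _)⟩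

theorem clamp_eq {ξ : ℝ} (h : ξ ∈ Icc (0 : ℝ) 1) : max 0 (min 1 ξ) = ξ := by
  rw [min_eq_right h.2, max_eq_right h.1]

theorem clampVelocity_eq (V : ℝ → ℝ) {ξ : ℝ} (h : ξ ∈ Icc (0 : ℝ) 1) :
    clampVelocity V ξ = V ξ := by
  rw [clampVelocity, clamp_eq h]

theorem abs_clamp_sub_clamp_le (x y : ℝ) :
    |max 0 (min 1 x) - max 0 (min 1 y)| ≤ |x - y| := by
  calc |max 0 (min 1 x) - max 0 (min 1 y)|
      = |max (min 1 x) 0 - max (min 1 y) 0| := by rw [max_comm 0, max_comm 0]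
    _ ≤ |min 1 x - min 1 y| := abs_max_sub_max_le_abs _ _ _
    _ ≤ max |(1 : ℝ) - 1| |x - y| := abs_min_sub_min_le_max _ _ _ _
    _ = |x - y| := by simp

/-- Intervals have positive measure. This produces points arbitrarily close to the endpoint 0, where
V is largest, at which an essential bound holds pointwise. -/
theorem exists_mem_Ioo_of_ae {p : ℝ → Prop} (hp : ∀ᵐ x ∂(volume.restrict (Icc (0 : ℝ) 1)), p x)
    {δ : ℝ} (h0 : 0 < δ) (h1 : δ ≤ 1) : ∃ x ∈ Ioo 0 δ, p x := by
  by_contra! hcon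
  have h2 : ∀ᵐ x ∂(volume.restrict (Ioo (0 : ℝ) δ)), p x :=
    ae_restrict_of_ae_restrict_of_subset
      (Ioo_subset_Icc_self.trans (Icc_subset_Icc_right h1)) hp
  have h3 : ∀ᵐ x ∂(volume.restrict (Ioo (0 : ℝ) δ)), x ∈ Ioo (0 : ℝ) δ :=
    ae_restrict_mem measurableSet_Ioo
  have h4 : ∀ᵐ _x ∂(volume.restrict (Ioo (0 : ℝ) δ)), False := by
    filter_upwards [h2, h3] with x hx hx' using hcon x hx' hx
  rw [ae_iff] at h4
  simp at h4
  linarith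

theorem ae_abs_le_supNorm {f : ℝ → ℝ} {C : ℝ}
    (hf : ∀ᵐ x ∂(volume.restrict (Icc (0 : ℝ) 1)), ‖f x‖ ≤ C) :
    ∀ᵐ x ∂(volume.restrict (Icc (0 : ℝ) 1)), |f x| ≤ supNorm f := by
  have hfin : eLpNorm f ∞ (volume.restrict (Icc (0 : ℝ) 1)) ≠ ∞ := by
    rw [eLpNorm_exponent_top]
    exact (eLpNormEssSup_lt_top_of_ae_bound hf).ne
  have := enorm_ae_le_eLpNormEssSup f (volume.restrict (Icc (0 : ℝ) 1))
  filter_upwards [this] with x hx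
  rw [supNorm, ← Real.norm_eq_abs, ← toReal_enorm]
  exact ENNReal.toReal_mono hfin (by rwa [eLpNorm_exponent_top])

/-- The CFL condition is stated with essential norms, whereas the scheme needs pointwise bounds.
Continuity upgrades the essential supremum of V to a true bound, and absolute continuity upgrades
that of V' to a Lipschitz constant. -/
theorem IsVelocity.isGlobalVelocity {V : ℝ → ℝ} (hV : IsVelocity V) :
    IsGlobalVelocity (clampVelocity V) (supNorm V) (supNorm (deriv V)) := by
  obtain ⟨K, hK⟩ := hV.lipschitz
  have h01 : (0 : ℝ) ∈ Icc (0 : ℝ) 1 := ⟨le_rfl, zero_le_one⟩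
  have hle0 : ∀ x ∈ Icc (0 : ℝ) 1, V x ≤ V 0 := fun x hx => hV.antitone h01 hx hx.1
  have hbdV : ∀ᵐ x ∂(volume.restrict (Icc (0 : ℝ) 1)), ‖V x‖ ≤ V 0 := by
    filter_upwards [ae_restrict_mem measurableSet_Icc] with x hx
    rw [Real.norm_eq_abs, abs_of_nonneg (hV.nonneg x hx)]
    exact hle0 x hx
  have hV0 : V 0 ≤ supNorm V := by
    by_contra! hlt
    set d := V 0 - supNorm V with hd
    have hdpos : 0 < d := by linarith
    -- The point is so close to 0 that V drops by less than d on the way to it; K + 1 replaces K to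
    -- avoid division by zero.
    obtain ⟨x, hx, hxp⟩ := exists_mem_Ioo_of_ae (ae_abs_le_supNorm hbdV)
      (δ := min 1 (d / (K + 1))) (by positivity) (min_le_left _ _)
    have hx1 : x ∈ Icc (0 : ℝ) 1 := ⟨hx.1.le, hx.2.le.trans (min_le_left _ _)⟩
    have h1 := hK.dist_le_mul 0 h01 x hx1
    rw [Real.dist_eq, Real.dist_eq, zero_sub, abs_neg, abs_of_pos hx.1] at h1
    have h2 : x < d / (K + 1) := hx.2.trans_le (min_le_right _ _)
    rw [lt_div_iff₀ (by positivity)] at h2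
    have h3 := le_abs_self (V 0 - V x)
    have h4 := le_abs_self (V x)
    nlinarith [hx.1]
  have hbdd : ∀ᵐ x ∂(volume.restrict (Icc (0 : ℝ) 1)), ‖deriv V x‖ ≤ K := by
    rw [← Measure.restrict_congr_set (Ioo_ae_eq_Icc (α := ℝ) (μ := volume))]
    filter_upwards [ae_restrict_mem measurableSet_Ioo] with x hx
    exact norm_deriv_le_of_lipschitzOn (Icc_mem_nhds hx.1 hx.2) hK
  -- Integrating V' replaces the unspecified Lipschitz constant K by the essential bound of V'.
  have hlip : ∀ x ∈ Icc (0 : ℝ) 1, ∀ y ∈ Icc (0 : ℝ) 1,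
      |V x - V y| ≤ supNorm (deriv V) * |x - y| := by
    intro x hx y hy
    have hsub : uIcc y x ⊆ Icc 0 1 := uIcc_subset_Icc hy hx
    have hac : AbsolutelyContinuousOnInterval V y x :=
      (hK.mono hsub).absolutelyContinuousOnInterval
    rw [← hac.integral_deriv_eq_sub, ← Real.norm_eq_abs]
    apply intervalIntegral.norm_integral_le_of_norm_le_const_ae
    have := ae_abs_le_supNorm hbdd
    rw [ae_restrict_iff' measurableSet_Icc] at this
    filter_upwards [this] with z hz hz'
    exact hz (hsub (uIoc_subset_uIcc hz'))
  have hL : 0 ≤ supNorm (deriv V) := ENNReal.toReal_nonneg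
  refine ⟨fun x y hxy => ?_, fun x => hV.nonneg _ (clamp_mem x),
    fun x => (hle0 _ (clamp_mem x)).trans hV0, fun x y => ?_⟩
  · exact hV.antitone (clamp_mem x) (clamp_mem y) (by gcongr)
  · exact (hlip _ (clamp_mem x) _ (clamp_mem y)).trans
      (mul_le_mul_of_nonneg_left (abs_clamp_sub_clamp_le x y) hL)

/-- The structural properties of Kružkov's entropy flux that the doubling argument uses. -/
structure IsKruzkovFlux (q : ℝ → ℝ → ℝ) (F : ℝ) : Prop where
  nonneg : 0 ≤ F
  continuous : Continuous (fun p : ℝ × ℝ => q p.1 p.2)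
  lip : ∀ κ ∈ Icc (0 : ℝ) 1, ∀ a ∈ Icc (0 : ℝ) 1, ∀ b ∈ Icc (0 : ℝ) 1,
    |q κ a - q κ b| ≤ F * |a - b|
  symm : ∀ a b, q a b = q b a
  self : ∀ a, q a a = 0

theorem IsKruzkovFlux.abs_le {q : ℝ → ℝ → ℝ} {F : ℝ} (hq : IsKruzkovFlux q F) {κ a : ℝ}
    (hκ : κ ∈ Icc (0 : ℝ) 1) (ha : a ∈ Icc (0 : ℝ) 1) : |q κ a| ≤ F * |κ - a| := by
  have := hq.lip κ hκ κ hκ a ha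
  rwa [hq.self, zero_sub, abs_neg] at this

theorem IsKruzkovFlux.abs_le_const {q : ℝ → ℝ → ℝ} {F : ℝ} (hq : IsKruzkovFlux q F) {κ a : ℝ}
    (hκ : κ ∈ Icc (0 : ℝ) 1) (ha : a ∈ Icc (0 : ℝ) 1) : |q κ a| ≤ F := by
  refine (hq.abs_le hκ ha).trans (mul_le_of_le_one_right hq.nonneg ?_)
  rw [_root_.abs_le]; constructor <;> linarith [hκ.1, hκ.2, ha.1, ha.2]

namespace IsGlobalVelocity

variable {V : ℝ → ℝ} {M L : ℝ}

theorem continuous (hV : IsGlobalVelocity V M L) : Continuous V :=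
  (LipschitzWith.of_dist_le_mul (K := L.toNNReal) (fun x y => by
    rw [Real.dist_eq, Real.dist_eq]
    exact (hV.lip x y).trans
      (mul_le_mul_of_nonneg_right (Real.le_coe_toNNReal L) (abs_nonneg _)))).continuous

theorem bound_nonneg (hV : IsGlobalVelocity V M L) : 0 ≤ M := (hV.nonneg 0).trans (hV.le 0)

theorem lip_nonneg (hV : IsGlobalVelocity V M L) : 0 ≤ L := by
  simpa using (abs_nonneg _).trans (hV.lip 1 0)

/-- Write w V(w) - κ V(κ) = V(κ) (w - κ) + w (V(w) - V(κ)); as V decreases, the two summands have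
opposite signs. This form contains no sign function, hence is visibly continuous, and it is the one
the scheme reproduces. -/
theorem kruzkovFlux_eq (hV : IsGlobalVelocity V M L) (κ w : ℝ) :
    kruzkovFlux V κ w = V κ * |w - κ| - w * |V w - V κ| := by
  rw [kruzkovFlux]
  rcases lt_trichotomy w κ with h | h | h
  · rw [Real.sign_of_neg (by linarith), abs_of_neg (by linarith : w - κ < 0),
      abs_of_nonneg (by linarith [hV.antitone h.le])]
    ring
  · simp [h]
  · rw [Real.sign_of_pos (by linarith), abs_of_pos (by linarith : 0 < w - κ),
      abs_of_nonpos (by linarith [hV.antitone h.le])]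
    ring

theorem abs_sub_le (hV : IsGlobalVelocity V M L) (x y : ℝ) : |V x - V y| ≤ M := by
  rw [abs_le]
  constructor <;> linarith [hV.nonneg x, hV.le x, hV.nonneg y, hV.le y]

theorem abs_mul_sub_mul_le (hV : IsGlobalVelocity V M L) (κ : ℝ) {a b : ℝ}
    (hb : b ∈ Icc (0 : ℝ) 1) :
    |a * (|V a - V κ|) - b * (|V b - V κ|)| ≤ (M + L) * |a - b| := by
  have h1 : a * (|V a - V κ|) - b * (|V b - V κ|)
      = (a - b) * |V a - V κ| + b * (|V a - V κ| - |V b - V κ|) := by ring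
  have h2 : |(|V a - V κ| - |V b - V κ|)| ≤ L * |a - b| :=
    (abs_abs_sub_abs_le_abs_sub _ _).trans (by
      rw [show V a - V κ - (V b - V κ) = V a - V b by ring]; exact hV.lip a b)
  rw [h1]
  refine (abs_add_le _ _).trans ?_
  rw [abs_mul, abs_mul, abs_abs, abs_of_nonneg hb.1, add_mul]
  refine add_le_add ?_ ?_
  · rw [mul_comm]
    exact mul_le_mul_of_nonneg_right (hV.abs_sub_le a κ) (abs_nonneg _)
  · exact (mul_le_of_le_one_left (abs_nonneg _) hb.2).trans h2

theorem isKruzkovFlux (hV : IsGlobalVelocity V M L) :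
    IsKruzkovFlux (kruzkovFlux V) (2 * M + L) where
  nonneg := by linarith [hV.bound_nonneg, hV.lip_nonneg]
  continuous := by
    simp_rw [hV.kruzkovFlux_eq]
    have := hV.continuous
    fun_prop
  lip := by
    intro κ hκ a ha b hb
    rw [hV.kruzkovFlux_eq, hV.kruzkovFlux_eq]
    have h1 := hV.abs_mul_sub_mul_le κ (a := a) hb
    have h2 : |V κ * (|a - κ|) - V κ * (|b - κ|)| ≤ M * |a - b| := by
      rw [← mul_sub, abs_mul, abs_of_nonneg (hV.nonneg κ)]
      refine mul_le_mul (hV.le κ) ?_ (abs_nonneg _) hV.bound_nonneg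
      refine (abs_abs_sub_abs_le_abs_sub _ _).trans (by rw [sub_sub_sub_cancel_right])
    calc _ = |(V κ * (|a - κ|) - V κ * (|b - κ|))
            - (a * (|V a - V κ|) - b * (|V b - V κ|))| := by congr 1; ring
      _ ≤ _ := (abs_sub _ _).trans (by linarith)
  symm := by
    intro a b
    rw [kruzkovFlux, kruzkovFlux, ← neg_sub b a, Real.sign_neg]
    ring
  self := by intro a; simp [kruzkovFlux]

end IsGlobalVelocity

/-! ### Total variation, translations and piecewise constant functions -/

theorem setLIntegral_Ioc_add_right (f : ℝ → ℝ≥0∞) (a b c : ℝ) :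
    ∫⁻ x in Ioc (a + c) (b + c), f x = ∫⁻ x in Ioc a b, f (x + c) := by
  have h := (measurePreserving_add_right (volume : Measure ℝ) c).setLIntegral_comp_preimage_emb
    (measurableEmbedding_addRight c) f (Ioc (a + c) (b + c))
  rw [← h]
  congr 2
  ext x; simp

theorem lintegral_eq_tsum_translates (f : ℝ → ℝ≥0∞) {s : ℝ} (hs : 0 < s) (a : ℝ) :
    ∫⁻ x, f x = ∑' j : ℤ, ∫⁻ x in Ioc a (a + s), f (x + j * s) := by
  rw [← setLIntegral_univ, ← iUnion_Ioc_add_zsmul hs a,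
    lintegral_iUnion (fun _ => measurableSet_Ioc) (pairwise_disjoint_Ioc_add_zsmul a s)]
  refine tsum_congr fun j => ?_
  rw [← setLIntegral_Ioc_add_right f a (a + s) (j * s)]
  simp only [zsmul_eq_mul, Int.cast_add, Int.cast_one]
  congr 3
  ring

theorem tsum_edist_le_eVariationOn {α : Type*} [LinearOrder α] (f : α → ℝ) {p : ℤ → α}
    (hp : Monotone p) :
    ∑' j : ℤ, edist (f (p (j + 1))) (f (p j)) ≤ eVariationOn f univ := by
  rw [ENNReal.tsum_eq_iSup_sum]
  refine iSup_le fun S => ?_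
  obtain ⟨N, hN⟩ : ∃ N : ℕ, ∀ j ∈ S, -(N : ℤ) ≤ j ∧ j < N := by
    refine ⟨∑ j ∈ S, j.natAbs + 1, fun j hj => ?_⟩
    have := Finset.single_le_sum (f := fun j : ℤ => j.natAbs) (fun _ _ => Nat.zero_le _) hj
    omega
  have hsub : S ⊆ (Finset.range (2 * N)).image (fun i : ℕ => (i : ℤ) - N) := by
    intro j hj
    rw [Finset.mem_image]
    refine ⟨(j + N).toNat, ?_, ?_⟩
    · have := hN j hj; rw [Finset.mem_range]; omega
    · have := hN j hj; omega
  refine (Finset.sum_le_sum_of_subset hsub).trans ?_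
  rw [Finset.sum_image (fun a _ b _ h => by simpa using h)]
  have hm : Monotone (fun i : ℕ => p ((i : ℤ) - N)) := fun a b hab => hp (by omega)
  refine le_trans (le_of_eq ?_) (eVariationOn.sum_le (f := f) (s := univ) (n := 2 * N) hm
    (fun _ => mem_univ _))
  refine Finset.sum_congr rfl fun i _ => ?_
  push_cast
  rw [show (i : ℤ) - N + 1 = i + 1 - N by ring]

theorem edist_le_sum_Ico_int (W : ℤ → ℝ) {a b : ℤ} (hab : a ≤ b) :
    edist (W b) (W a) ≤ ∑ k ∈ Finset.Ico a b, edist (W (k + 1)) (W k) := by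
  induction b, hab using Int.leInduction with
  | base => simp
  | succ b hab ih =>
    rw [← Finset.insert_Ico_right_eq_Ico_add_one hab, Finset.sum_insert (by simp)]
    exact (edist_triangle _ (W b) _).trans (add_le_add le_rfl ih)

theorem eVariationOn_int_le (W : ℤ → ℝ) :
    eVariationOn W univ ≤ ∑' j : ℤ, edist (W (j + 1)) (W j) := by
  refine iSup_le fun ⟨n, u, hu, _⟩ => ?_
  refine le_trans ?_ (ENNReal.sum_le_tsum (Finset.Ico (u 0) (u n)))
  simp only
  induction n with
  | zero => simp
  | succ n ih =>
    rw [Finset.sum_range_succ]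
    have h1 : u 0 ≤ u n := hu (Nat.zero_le n)
    have h2 : u n ≤ u (n + 1) := hu (Nat.le_succ n)
    rw [← Finset.Ico_union_Ico_eq_Ico h1 h2,
      Finset.sum_union (Finset.Ico_disjoint_Ico_consecutive _ _ _)]
    exact add_le_add ih (edist_le_sum_Ico_int W h2)

/-- The index of the cell that contains `x`. -/
def cellIndex (h x : ℝ) : ℤ := ⌊x / h + 1 / 2⌋

theorem cellIndex_mono {h : ℝ} (hh : 0 < h) : Monotone (cellIndex h) := fun x y hxy =>
  Int.floor_mono (by gcongr)

theorem measurable_cellIndex (h : ℝ) : Measurable (cellIndex h) :=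
  Int.measurable_floor.comp (by fun_prop)

theorem cellIndex_add {h : ℝ} (hh : 0 < h) (x : ℝ) : cellIndex h (x + h) = cellIndex h x + 1 := by
  rw [cellIndex, cellIndex, ← Int.floor_add_one]
  congr 1
  field_simp
  ring

theorem cellIndex_eq_iff {h : ℝ} (hh : 0 < h) {x : ℝ} {j : ℤ} :
    cellIndex h x = j ↔ x ∈ Ico (((j : ℝ) - 1 / 2) * h) (((j : ℝ) + 1 / 2) * h) := by
  rw [cellIndex, Int.floor_eq_iff, mem_Ico, ← le_div_iff₀ hh, ← div_lt_iff₀ hh]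
  constructor <;> rintro ⟨h1, h2⟩ <;> constructor <;> linarith

theorem lintegral_cellIndex {h : ℝ} (hh : 0 < h) (f : ℤ → ℝ≥0∞) :
    ∫⁻ x, f (cellIndex h x) = ENNReal.ofReal h * ∑' j, f j := by
  rw [← lintegral_map (measurable_of_countable f) (measurable_cellIndex h), lintegral_countable',
    ← ENNReal.tsum_mul_left]
  refine tsum_congr fun j => ?_
  rw [Measure.map_apply (measurable_cellIndex h) (measurableSet_singleton j), mul_comm]
  have : cellIndex h ⁻¹' {j} = Ico (((j : ℝ) - 1 / 2) * h) (((j : ℝ) + 1 / 2) * h) := by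
    ext x
    rw [mem_preimage, mem_singleton_iff, cellIndex_eq_iff hh]
  rw [this, Real.volume_Ico]
  congr 2
  ring

/-- Cut the line into intervals of length a. For fixed x in one of them, the increments along the
points x + j a add up to at most the variation of f. -/
theorem lintegral_translate_sub_le_of_pos {f : ℝ → ℝ} (hf : Measurable f) {a : ℝ} (ha : 0 < a) :
    ∫⁻ x, ‖f (x + a) - f x‖ₑ ≤ ENNReal.ofReal a * eVariationOn f univ := by
  rw [lintegral_eq_tsum_translates _ ha 0, ← lintegral_tsum (fun j => by fun_prop)]
  calc _ ≤ ∫⁻ _x in Ioc 0 (0 + a), eVariationOn f univ := by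
        refine lintegral_mono fun x => ?_
        have hp : Monotone (fun j : ℤ => x + j * a) := fun i j hij => by
          have : (i : ℝ) ≤ j := by exact_mod_cast hij
          simp only
          gcongr
        refine le_trans (le_of_eq (tsum_congr fun j => ?_)) (tsum_edist_le_eVariationOn f hp)
        rw [edist_eq_enorm_sub]
        push_cast
        rw [add_mul, one_mul, add_assoc]
    _ = _ := by simp [mul_comm]

theorem lintegral_translate_sub_le {f : ℝ → ℝ} (hf : Measurable f) (a : ℝ) :
    ∫⁻ x, ‖f (x + a) - f x‖ₑ ≤ ENNReal.ofReal |a| * eVariationOn f univ := by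
  rcases lt_trichotomy a 0 with h | h | h
  · rw [abs_of_neg h, ← lintegral_add_right_eq_self _ (-a)]
    refine le_trans (le_of_eq (lintegral_congr fun x => ?_))
      (lintegral_translate_sub_le_of_pos hf (neg_pos.2 h))
    rw [neg_add_cancel_right, ← enorm_neg, neg_sub]
  · simp [h]
  · rw [abs_of_pos h]
    exact lintegral_translate_sub_le_of_pos hf h

theorem eVariationOn_comp_cellIndex_le {h : ℝ} (hh : 0 < h) (W : ℤ → ℝ) :
    eVariationOn (fun x => W (cellIndex h x)) univ ≤ ∑' j : ℤ, edist (W (j + 1)) (W j) :=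
  (eVariationOn.comp_le_of_monotoneOn W (cellIndex h) ((cellIndex_mono hh).monotoneOn univ)
    (mapsTo_univ _ _)).trans (eVariationOn_int_le W)

/-- Jordan decomposition. The representatives competing in `essVariation` are not assumed
measurable. -/
theorem measurable_of_eVariationOn_ne_top {f : ℝ → ℝ} (hf : eVariationOn f univ ≠ ∞) :
    Measurable f := by
  obtain ⟨p, q, hp, hq, rfl⟩ :=
    (BoundedVariationOn.locallyBoundedVariationOn hf).exists_monotoneOn_sub_monotoneOn
  exact (monotoneOn_univ.1 hp).measurable.sub (monotoneOn_univ.1 hq).measurable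

theorem cellAverage_congr {f g : ℝ → ℝ} (hfg : f =ᵐ[volume] g) (h : ℝ) :
    cellAverage h f = cellAverage h g := by
  funext j
  rw [cellAverage, cellAverage]
  congr 1
  exact intervalIntegral.integral_congr_ae (hfg.mono fun x hx _ => hx)

theorem cellAverage_eq_translate (f : ℝ → ℝ) (h : ℝ) (j : ℤ) :
    cellAverage h f j = 1 / h * ∫ x in (-(h / 2))..(-(h / 2) + h), f (x + j * h) := by
  rw [cellAverage, intervalIntegral.integral_comp_add_right (fun x => f x)]
  congr 2 <;> ring

/-- The difference of neighbouring averages is the average over a single cell of f(x + (j+1) h) -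
f(x + j h). Summing over j under the integral leaves, for each x, increments of f along a monotone
sequence. -/
theorem tsum_edist_cellAverage_le {f : ℝ → ℝ} (hf : Measurable f) (hfi : LocallyIntegrable f)
    {h : ℝ} (hh : 0 < h) :
    ∑' j : ℤ, edist (cellAverage h f (j + 1)) (cellAverage h f j) ≤ eVariationOn f univ := by
  have hI : ∀ c a b : ℝ, IntervalIntegrable (fun x => f (x + c)) volume a b := fun c a b => by
    have : IntervalIntegrable f volume (a + c) (b + c) :=
      (hfi.integrableOn_isCompact isCompact_uIcc).intervalIntegrable
    simpa using this.comp_add_right c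
  have key : ∀ j : ℤ, edist (cellAverage h f (j + 1)) (cellAverage h f j) ≤
      ENNReal.ofReal (1 / h) * ∫⁻ x in Ioc (-(h / 2)) (-(h / 2) + h),
        edist (f (x + (j + 1 : ℤ) * h)) (f (x + j * h)) := by
    intro j
    rw [cellAverage_eq_translate, cellAverage_eq_translate, edist_eq_enorm_sub, ← mul_sub,
      ← intervalIntegral.integral_sub (hI _ _ _) (hI _ _ _), enorm_mul,
      Real.enorm_of_nonneg (by positivity), intervalIntegral.integral_of_le (by linarith)]
    gcongr
    exact (enorm_integral_le_lintegral_enorm _).trans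
      (le_of_eq (lintegral_congr fun x => (edist_eq_enorm_sub _ _).symm))
  calc _ ≤ ∑' j : ℤ, ENNReal.ofReal (1 / h) * ∫⁻ x in Ioc (-(h / 2)) (-(h / 2) + h),
        edist (f (x + (j + 1 : ℤ) * h)) (f (x + j * h)) := ENNReal.tsum_le_tsum key
    _ = ENNReal.ofReal (1 / h) * ∫⁻ x in Ioc (-(h / 2)) (-(h / 2) + h),
        ∑' j : ℤ, edist (f (x + (j + 1 : ℤ) * h)) (f (x + j * h)) := by
      rw [ENNReal.tsum_mul_left, lintegral_tsum (fun j => by fun_prop)]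
    _ ≤ ENNReal.ofReal (1 / h) * ∫⁻ _x in Ioc (-(h / 2)) (-(h / 2) + h), eVariationOn f univ := by
      gcongr with x
      have hp : Monotone (fun j : ℤ => x + j * h) := fun i j hij => by
        have : (i : ℝ) ≤ j := by exact_mod_cast hij
        simp only
        gcongr
      exact tsum_edist_le_eVariationOn f hp
    _ = eVariationOn f univ := by
      simp only [lintegral_const, MeasurableSet.univ, Measure.restrict_apply, univ_inter,
        Real.volume_Ioc, add_sub_cancel_left]
      rw [mul_left_comm, ← ENNReal.ofReal_mul (by positivity), one_div, inv_mul_cancel₀ hh.ne']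
      simp

/-- The cell of x lies in [x - h, x + h], so the error is controlled by translates by |s| ≤ h. The
enlarged interval has length 2h instead of h, whence the factor 2. -/
theorem lintegral_cellAverage_sub_le {f : ℝ → ℝ} (hf : Measurable f) (hfi : LocallyIntegrable f)
    {h : ℝ} (hh : 0 < h) :
    ∫⁻ x, ‖cellAverage h f (cellIndex h x) - f x‖ₑ ≤
      ENNReal.ofReal (2 * h) * eVariationOn f univ := by
  have key : ∀ x, ‖cellAverage h f (cellIndex h x) - f x‖ₑ ≤
      ENNReal.ofReal (1 / h) * ∫⁻ s in Ioc (-h) h, ‖f (x + s) - f x‖ₑ := by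
    intro x
    set j := cellIndex h x with hj
    have hx := (cellIndex_eq_iff hh).1 hj.symm
    have hab : ((j : ℝ) - 1 / 2) * h ≤ ((j : ℝ) + 1 / 2) * h := by nlinarith
    have h1 : cellAverage h f j - f x
        = 1 / h * ∫ z in (((j : ℝ) - 1 / 2) * h)..(((j : ℝ) + 1 / 2) * h), (f z - f x) := by
      rw [intervalIntegral.integral_sub
        (hfi.integrableOn_isCompact isCompact_uIcc).intervalIntegrable (by simp),
        intervalIntegral.integral_const, mul_sub, cellAverage, smul_eq_mul]
      field_simp
      ring
    rw [h1, enorm_mul, Real.enorm_of_nonneg (by positivity), intervalIntegral.integral_of_le hab]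
    gcongr
    refine (enorm_integral_le_lintegral_enorm _).trans ?_
    have h2 := setLIntegral_Ioc_add_right (fun z => ‖f z - f x‖ₑ) (-h) h x
    simp only [add_comm _ x] at h2 ⊢
    rw [← h2]
    refine lintegral_mono_set (Ioc_subset_Ioc ?_ ?_)
    · nlinarith [hx.2]
    · nlinarith [hx.1]
  calc _ ≤ ∫⁻ x, ENNReal.ofReal (1 / h) * ∫⁻ s in Ioc (-h) h, ‖f (x + s) - f x‖ₑ :=
        lintegral_mono key
    _ = ENNReal.ofReal (1 / h) * ∫⁻ s in Ioc (-h) h, ∫⁻ x, ‖f (x + s) - f x‖ₑ := by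
      rw [lintegral_const_mul' _ _ ENNReal.ofReal_ne_top, lintegral_lintegral_swap]
      exact Measurable.aemeasurable (by fun_prop)
    _ ≤ ENNReal.ofReal (1 / h) * ∫⁻ _s in Ioc (-h) h,
          ENNReal.ofReal h * eVariationOn f univ := by
      gcongr 1
      refine setLIntegral_mono' measurableSet_Ioc fun s hs => ?_
      refine (lintegral_translate_sub_le hf s).trans ?_
      gcongr
      exact abs_le.2 ⟨hs.1.le, hs.2⟩
    _ = _ := by
      simp only [lintegral_const, MeasurableSet.univ, Measure.restrict_apply, univ_inter,
        Real.volume_Ioc]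
      rw [mul_comm (ENNReal.ofReal h), mul_assoc, ← ENNReal.ofReal_mul hh.le, mul_left_comm,
        ← ENNReal.ofReal_mul (by positivity), mul_comm]
      congr 2
      field_simp
      ring

/-! ### Geometric averages -/

section Impact

variable {g : ℝ}

theorem summable_geomWeight (hg : g ∈ Ioo (0 : ℝ) 1) : Summable (geomWeight g) :=
  (summable_geometric_of_lt_one (by linarith [hg.2]) (by linarith [hg.1])).mul_left g

theorem tsum_geomWeight (hg : g ∈ Ioo (0 : ℝ) 1) : ∑' k, geomWeight g k = 1 := by
  simp only [geomWeight]
  rw [tsum_mul_left, tsum_geometric_of_lt_one (by linarith [hg.2]) (by linarith [hg.1]),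
    sub_sub_cancel, mul_inv_cancel₀ hg.1.ne']

theorem geomWeight_nonneg (hg : g ∈ Ioo (0 : ℝ) 1) (k : ℕ) : 0 ≤ geomWeight g k :=
  mul_nonneg hg.1.le (pow_nonneg (by linarith [hg.2]) _)

theorem summable_impact (hg : g ∈ Ioo (0 : ℝ) 1) {f : ℤ → ℝ} {C : ℝ} (hf : ∀ j, |f j| ≤ C)
    (j : ℤ) : Summable (fun k : ℕ => geomWeight g k * f (j + k)) := by
  refine Summable.of_norm_bounded ((summable_geomWeight hg).mul_right C) fun k => ?_
  rw [norm_mul, Real.norm_eq_abs, Real.norm_eq_abs, abs_of_nonneg (geomWeight_nonneg hg k)]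
  exact mul_le_mul_of_nonneg_left (hf _) (geomWeight_nonneg hg k)

/-- The special feature of geometric weights on which the whole analysis of the scheme rests. -/
theorem impact_step (hg : g ∈ Ioo (0 : ℝ) 1) {f : ℤ → ℝ} {C : ℝ} (hf : ∀ j, |f j| ≤ C) (j : ℤ) :
    impact (geomWeight g) f j = g * f j + (1 - g) * impact (geomWeight g) f (j + 1) := by
  rw [impact, (summable_impact hg hf j).tsum_eq_zero_add, impact, ← tsum_mul_left]
  congr 1
  · simp [geomWeight]
  · refine tsum_congr fun k => ?_
    rw [geomWeight, geomWeight, pow_succ]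
    push_cast
    rw [show j + ((k : ℤ) + 1) = j + 1 + k by ring]
    ring

theorem impact_nonneg (hg : g ∈ Ioo (0 : ℝ) 1) {f : ℤ → ℝ} (hf : ∀ j, 0 ≤ f j) (j : ℤ) :
    0 ≤ impact (geomWeight g) f j :=
  tsum_nonneg fun k => mul_nonneg (geomWeight_nonneg hg k) (hf _)

theorem abs_impact_le (hg : g ∈ Ioo (0 : ℝ) 1) {f : ℤ → ℝ} {C : ℝ} (hf : ∀ j, |f j| ≤ C)
    (j : ℤ) : |impact (geomWeight g) f j| ≤ C := by
  have h1 := norm_tsum_le_tsum_norm (summable_impact hg hf j).norm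
  have h2 : ∑' k : ℕ, ‖geomWeight g k * f (j + k)‖ ≤ ∑' k : ℕ, geomWeight g k * C := by
    refine Summable.tsum_le_tsum (fun k => ?_) (summable_impact hg hf j).norm
      ((summable_geomWeight hg).mul_right C)
    rw [norm_mul, Real.norm_eq_abs, Real.norm_eq_abs, abs_of_nonneg (geomWeight_nonneg hg k)]
    exact mul_le_mul_of_nonneg_left (hf _) (geomWeight_nonneg hg k)
  rw [tsum_mul_right, tsum_geomWeight hg, one_mul] at h2
  exact h1.trans h2

/-- Bounded subsolutions of the recursion `x_j = g f_j + (1-g) x_{j+1}` lie below its solution. -/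
theorem le_impact_of_le (hg : g ∈ Ioo (0 : ℝ) 1) {f x : ℤ → ℝ} {C C' : ℝ} (hf : ∀ j, |f j| ≤ C)
    (hx : ∀ j, |x j| ≤ C') (h : ∀ j, x j ≤ g * f j + (1 - g) * x (j + 1)) (j : ℤ) :
    x j ≤ impact (geomWeight g) f j := by
  have h1 : 0 ≤ 1 - g := by linarith [hg.2]
  have key : ∀ (n : ℕ) (j : ℤ), x j - impact (geomWeight g) f j ≤ (1 - g) ^ n * (C' + C) := by
    intro n
    induction n with
    | zero =>
      intro j
      have := abs_impact_le hg hf j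
      have := hx j
      rw [abs_le] at *
      simp only [pow_zero, one_mul]
      linarith
    | succ n ih =>
      intro j
      have := mul_le_mul_of_nonneg_left (ih (j + 1)) h1
      rw [pow_succ', mul_assoc]
      linarith [h j, impact_step hg hf j]
  have hlim : Tendsto (fun n : ℕ => (1 - g) ^ n * (C' + C)) atTop (𝓝 (0 * (C' + C))) :=
    (tendsto_pow_atTop_nhds_zero_of_lt_one h1 (by linarith [hg.1])).mul_const _
  have := ge_of_tendsto' hlim (fun n => key n j)
  linarith

theorem abs_le_impact_of_le (hg : g ∈ Ioo (0 : ℝ) 1) {f x : ℤ → ℝ} {C C' : ℝ}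
    (hf : ∀ j, |f j| ≤ C) (hx : ∀ j, |x j| ≤ C')
    (h : ∀ j, |x j| ≤ g * f j + (1 - g) * |x (j + 1)|) (j : ℤ) :
    |x j| ≤ impact (geomWeight g) f j :=
  le_impact_of_le hg (x := fun j => |x j|) hf (fun j => by rw [abs_abs]; exact hx j) h j

/-- The difference of two bounded solutions satisfies the homogeneous recursion, a contraction.
Closed formulas for averages are verified in this way, by checking one recursion step instead of
rearranging series. -/
theorem eq_impact_of_eq (hg : g ∈ Ioo (0 : ℝ) 1) {f x : ℤ → ℝ} {C C' : ℝ} (hf : ∀ j, |f j| ≤ C)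
    (hx : ∀ j, |x j| ≤ C') (h : ∀ j, x j = g * f j + (1 - g) * x (j + 1)) (j : ℤ) :
    impact (geomWeight g) f j = x j := by
  have hb : ∀ j, |x j - impact (geomWeight g) f j| ≤ C' + C := fun j =>
    (abs_sub _ _).trans (add_le_add (hx j) (abs_impact_le hg hf j))
  have := abs_le_impact_of_le hg (f := fun _ => 0) (C := 0) (by simp) hb (fun j => by
    rw [h j, impact_step hg hf j, mul_zero, zero_add, ← abs_of_pos (by linarith [hg.2] : 0 < 1 - g),
      ← abs_mul, abs_of_pos (by linarith [hg.2] : 0 < 1 - g)]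
    exact le_of_eq (by congr 1; ring)) j
  have h0 : impact (geomWeight g) (fun _ => (0 : ℝ)) j = 0 := by simp [impact]
  rw [h0] at this
  linarith [abs_nonpos_iff.1 this]

/-- Fubini and translation invariance: averaging with weights of total mass one preserves sums.
Hence pointwise bounds by averages of local oscillations turn into ℓ¹ bounds without loss. -/
theorem hasSum_impact (hg : g ∈ Ioo (0 : ℝ) 1) {f : ℤ → ℝ} (hf0 : ∀ j, 0 ≤ f j)
    (hf : Summable f) : HasSum (impact (geomWeight g) f) (∑' j, f j) := by
  have hbd : ∀ j, |f j| ≤ ∑' j, f j := fun j => by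
    rw [abs_of_nonneg (hf0 j)]
    exact hf.le_tsum j (fun i _ => hf0 i)
  have hF : Summable (fun p : ℤ × ℕ => geomWeight g p.2 * f (p.1 + p.2)) := by
    have h1 : Summable (fun p : ℕ × ℤ => geomWeight g p.1 * f p.2) :=
      (summable_geomWeight hg).mul_of_nonneg hf (geomWeight_nonneg hg) hf0
    let e : ℤ × ℕ ≃ ℕ × ℤ :=
      { toFun := fun p => (p.2, p.1 + p.2)
        invFun := fun p => (p.2 - p.1, p.1)
        left_inv := fun p => by simp
        right_inv := fun p => by simp }
    exact (e.summable_iff (f := fun p : ℕ × ℤ => geomWeight g p.1 * f p.2)).2 h1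
  have hs : Summable (impact (geomWeight g) f) := hF.prod
  refine (hs.hasSum_iff).2 ?_
  have h2 : ∑' j, impact (geomWeight g) f j
      = ∑' k : ℕ, ∑' j : ℤ, geomWeight g k * f (j + k) :=
    Summable.tsum_comm (f := fun (k : ℕ) (j : ℤ) => geomWeight g k * f (j + k))
      ((Equiv.prodComm ℕ ℤ).summable_iff (f := fun p : ℤ × ℕ => geomWeight g p.2 * f (p.1 + p.2))|>.2 hF)
  rw [h2]
  have h3 : ∀ k : ℕ, ∑' j : ℤ, geomWeight g k * f (j + k) = geomWeight g k * ∑' j, f j := by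
    intro k
    rw [tsum_mul_left]
    congr 1
    exact (Equiv.addRight (k : ℤ)).tsum_eq f
  rw [tsum_congr h3, tsum_mul_right, tsum_geomWeight hg, one_mul]

end Impact

/-- The sum of the absolute increments of a sequence. -/
def seqVariation (W : ℤ → ℝ) : ℝ := ∑' j, |W (j + 1) - W j|

theorem hasSum_shift {f : ℤ → ℝ} {S : ℝ} (hf : HasSum f S) (k : ℤ) :
    HasSum (fun j => f (j + k)) S :=
  (Equiv.addRight k).hasSum_iff (f := f) |>.2 hf

theorem hasSum_shift_sub {f : ℤ → ℝ} {S : ℝ} (hf : HasSum f S) (k : ℤ) :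
    HasSum (fun j => f (j - k)) S := by
  simpa [sub_eq_add_neg] using hasSum_shift hf (-k)

/-! ### One step of the scheme -/

/-- One time step of the scheme, for the density. -/
def schemeStep (V : ℝ → ℝ) (lam g : ℝ) (r : ℤ → ℝ) (j : ℤ) : ℝ :=
  r j + lam * (r (j - 1) * V (impact (geomWeight g) r j)
    - r j * V (impact (geomWeight g) r (j + 1)))

/-- A discrete density with values in `[0,1]`, its nonlocal impact, and the CFL condition. -/
structure SchemeState (V : ℝ → ℝ) (M L lam g : ℝ) (r W : ℤ → ℝ) : Prop where
  vel : IsGlobalVelocity V M L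
  g_mem : g ∈ Ioo (0 : ℝ) 1
  lam_pos : 0 < lam
  cfl : lam * (M + L) ≤ 1
  r_mem : ∀ j, r j ∈ Icc (0 : ℝ) 1
  W_eq : W = impact (geomWeight g) r

namespace SchemeState

variable {V : ℝ → ℝ} {M L lam g : ℝ} {r W : ℤ → ℝ}

theorem r_abs (s : SchemeState V M L lam g r W) (j : ℤ) : |r j| ≤ 1 := by
  rw [abs_of_nonneg (s.r_mem j).1]
  exact (s.r_mem j).2

theorem W_step (s : SchemeState V M L lam g r W) (j : ℤ) :
    W j = g * r j + (1 - g) * W (j + 1) := by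
  rw [s.W_eq]
  exact impact_step s.g_mem s.r_abs j

theorem W_mem (s : SchemeState V M L lam g r W) (j : ℤ) : W j ∈ Icc (0 : ℝ) 1 := by
  rw [s.W_eq]
  exact ⟨impact_nonneg s.g_mem (fun j => (s.r_mem j).1) j,
    (le_abs_self _).trans (abs_impact_le s.g_mem s.r_abs j)⟩

theorem lam_V_le (s : SchemeState V M L lam g r W) (x : ℝ) : lam * V x + lam * L ≤ 1 := by
  have := mul_le_mul_of_nonneg_left (s.vel.le x) s.lam_pos.le
  linarith [s.cfl]

/-- The lower bound only needs λ V ≤ 1. For the upper bound r_{j-1} is replaced by 1; the remaining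
inflow excess V(W_j) - V(W_{j+1}) is at most L (1 - r_j), so the CFL condition absorbs it into the
free capacity 1 - r_j. -/
theorem step_mem (s : SchemeState V M L lam g r W) (j : ℤ) :
    schemeStep V lam g r j ∈ Icc (0 : ℝ) 1 := by
  rw [schemeStep, ← s.W_eq]
  have h1 := s.lam_V_le (W (j + 1))
  have hL := mul_nonneg s.lam_pos.le s.vel.lip_nonneg
  have hrj := s.r_mem j
  have hrj' := s.r_mem (j - 1)
  have hV1 := mul_nonneg s.lam_pos.le (s.vel.nonneg (W j))
  constructor
  · have h2 : 0 ≤ r j * (1 - lam * V (W (j + 1))) := mul_nonneg hrj.1 (by linarith)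
    have h3 := mul_nonneg hrj'.1 hV1
    linarith
  · have h2 : r (j - 1) * (lam * V (W j)) ≤ lam * V (W j) := mul_le_of_le_one_left hV1 hrj'.2
    -- Only W_j ≤ W_{j+1} matters, and then W_{j+1} - W_j = g (W_{j+1} - r_j) ≤ 1 - r_j.
    have h3 : V (W j) - V (W (j + 1)) ≤ L * (1 - r j) := by
      rcases le_total (W j) (W (j + 1)) with h | h
      · have h4 := (le_abs_self _).trans (s.vel.lip (W j) (W (j + 1)))
        refine h4.trans (mul_le_mul_of_nonneg_left ?_ s.vel.lip_nonneg)
        rw [abs_of_nonpos (by linarith)]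
        have h5 := s.W_step j
        have h6 := s.W_mem (j + 1)
        have h7 : -(W j - W (j + 1)) = g * (W (j + 1) - r j) := by rw [h5]; ring
        have h8 : 0 ≤ W (j + 1) - r j := by
          by_contra! hneg
          have := mul_neg_of_pos_of_neg s.g_mem.1 hneg
          linarith
        have := mul_le_of_le_one_left h8 s.g_mem.2.le
        linarith [h6.2]
      · have := s.vel.antitone h
        have := mul_nonneg s.vel.lip_nonneg (by linarith [hrj.2] : 0 ≤ 1 - r j)
        linarith
    have h4 := mul_le_mul_of_nonneg_left h3 s.lam_pos.le
    have h5 : (1 - r j) * (lam * V (W (j + 1)) + lam * L) ≤ 1 - r j :=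
      mul_le_of_le_one_right (by linarith [hrj.2]) h1
    linarith

theorem next (s : SchemeState V M L lam g r W) :
    SchemeState V M L lam g (schemeStep V lam g r)
      (impact (geomWeight g) (schemeStep V lam g r)) :=
  ⟨s.vel, s.g_mem, s.lam_pos, s.cfl, s.step_mem, rfl⟩

/-- The averaged flux. -/
def avgFlux (V : ℝ → ℝ) (g : ℝ) (r W : ℤ → ℝ) : ℤ → ℝ :=
  impact (geomWeight g) (fun k => r (k - 1) * V (W k))

/-- The averaged Kružkov correction. -/
def avgKruzkov (V : ℝ → ℝ) (g : ℝ) (r W : ℤ → ℝ) (κ : ℝ) : ℤ → ℝ :=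
  impact (geomWeight g) (fun k => r (k - 1) * |V (W k) - V κ|)

theorem flux_bound (s : SchemeState V M L lam g r W) (k : ℤ) : |r (k - 1) * V (W k)| ≤ M := by
  rw [abs_mul, abs_of_nonneg (s.vel.nonneg _)]
  exact (mul_le_of_le_one_left (s.vel.nonneg _) (s.r_abs _)).trans (s.vel.le _)

theorem kruzkov_bound (s : SchemeState V M L lam g r W) (κ : ℝ) (k : ℤ) :
    |r (k - 1) * (|V (W k) - V κ|)| ≤ M := by
  rw [abs_mul, abs_abs]
  exact (mul_le_of_le_one_left (abs_nonneg _) (s.r_abs _)).trans (s.vel.abs_sub_le _ _)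

theorem avgFlux_step (s : SchemeState V M L lam g r W) (j : ℤ) :
    avgFlux V g r W j = g * (r (j - 1) * V (W j)) + (1 - g) * avgFlux V g r W (j + 1) :=
  impact_step s.g_mem s.flux_bound j

theorem avgKruzkov_step (s : SchemeState V M L lam g r W) (κ : ℝ) (j : ℤ) :
    avgKruzkov V g r W κ j
      = g * (r (j - 1) * |V (W j) - V κ|) + (1 - g) * avgKruzkov V g r W κ (j + 1) :=
  impact_step s.g_mem (s.kruzkov_bound κ) j

theorem abs_avgFlux_le (s : SchemeState V M L lam g r W) (j : ℤ) : |avgFlux V g r W j| ≤ M :=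
  abs_impact_le s.g_mem s.flux_bound j

theorem abs_avgKruzkov_le (s : SchemeState V M L lam g r W) (κ : ℝ) (j : ℤ) :
    |avgKruzkov V g r W κ j| ≤ M :=
  abs_impact_le s.g_mem (s.kruzkov_bound κ) j

theorem W_abs (s : SchemeState V M L lam g r W) (j : ℤ) : |W j| ≤ 1 := by
  rw [abs_of_nonneg (s.W_mem j).1]
  exact (s.W_mem j).2

theorem g_mul_r (s : SchemeState V M L lam g r W) (j : ℤ) :
    g * r (j - 1) = W (j - 1) - (1 - g) * W j := by
  have := s.W_step (j - 1)
  rw [sub_add_cancel] at this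
  linarith

/-- The increments of the impact weighted by the impact. -/
def weightedJump (V : ℝ → ℝ) (W : ℤ → ℝ) (k : ℤ) : ℝ := W k * (V (W k) - V (W (k + 1)))

theorem abs_weightedJump_le (s : SchemeState V M L lam g r W) (k : ℤ) :
    |weightedJump V W k| ≤ L * |W (k + 1) - W k| := by
  rw [weightedJump, abs_mul, abs_sub_comm (W (k + 1))]
  exact (mul_le_of_le_one_left (abs_nonneg _) (s.W_abs k)).trans (s.vel.lip _ _)

theorem abs_weightedJump_le_const (s : SchemeState V M L lam g r W) (k : ℤ) :
    |weightedJump V W k| ≤ M := by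
  rw [weightedJump, abs_mul]
  exact (mul_le_of_le_one_left (abs_nonneg _) (s.W_abs k)).trans (s.vel.abs_sub_le _ _)

/-- A summation by parts: the gap between the local flux W_j V(W_j) and the averaged flux is
expressed through increments of V(W), which the variation of W controls. -/
theorem impact_weightedJump (s : SchemeState V M L lam g r W) (j : ℤ) :
    impact (geomWeight g) (weightedJump V W) j
      = g * (W j * V (W j) - avgFlux V g r W (j + 1)) := by
  have hb : ∀ j, |g * (W j * V (W j) - avgFlux V g r W (j + 1))| ≤ 1 * (M + M) := by
    intro j
    rw [abs_mul, abs_of_pos s.g_mem.1]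
    refine mul_le_mul s.g_mem.2.le ?_ (abs_nonneg _) zero_le_one
    refine (abs_sub _ _).trans (add_le_add ?_ (s.abs_avgFlux_le _))
    rw [abs_mul, abs_of_nonneg (s.vel.nonneg _)]
    exact (mul_le_of_le_one_left (s.vel.nonneg _) (s.W_abs j)).trans (s.vel.le _)
  refine eq_impact_of_eq s.g_mem s.abs_weightedJump_le_const hb (fun j => ?_) j
  have h1 := s.avgFlux_step (j + 1)
  have h2 := s.g_mul_r (j + 1)
  rw [add_sub_cancel_right] at h1 h2
  rw [weightedJump]
  linear_combination -g * h1 - g * V (W (j + 1)) * h2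

/-- Averaging commutes with the conservative difference, so W changes by λ times a difference of
averaged fluxes. One recursion step for the flux and g r_{j-1} = W_{j-1} - (1-g) W_j then remove the
density outside the averaged flux. -/
theorem impact_step_eq (s : SchemeState V M L lam g r W) (j : ℤ) :
    impact (geomWeight g) (schemeStep V lam g r) j
      = W j + lam * ((W (j - 1) - (1 - g) * W j) * V (W j) - g * avgFlux V g r W (j + 1)) := by
  have h0 : impact (geomWeight g) (schemeStep V lam g r) j
      = W j + lam * (avgFlux V g r W j - avgFlux V g r W (j + 1)) := by
    have hb : ∀ j, |W j + lam * (avgFlux V g r W j - avgFlux V g r W (j + 1))|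
        ≤ 1 + lam * (M + M) := by
      intro j
      refine (abs_add_le _ _).trans (add_le_add (s.W_abs j) ?_)
      rw [abs_mul, abs_of_pos s.lam_pos]
      refine mul_le_mul_of_nonneg_left ?_ s.lam_pos.le
      exact (abs_sub _ _).trans (add_le_add (s.abs_avgFlux_le _) (s.abs_avgFlux_le _))
    refine eq_impact_of_eq s.g_mem s.next.r_abs hb (fun j => ?_) j
    have h1 := s.avgFlux_step j
    have h2 := s.avgFlux_step (j + 1)
    have h3 := s.W_step j
    rw [add_sub_cancel_right] at h2
    rw [schemeStep, ← s.W_eq]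
    linear_combination h3 + lam * h1 - lam * h2
  rw [h0, ← s.g_mul_r]
  linear_combination lam * s.avgFlux_step j

theorem impact_step_eq' (s : SchemeState V M L lam g r W) (j : ℤ) :
    impact (geomWeight g) (schemeStep V lam g r) j
      = W j - lam * V (W j) * (W j - W (j - 1))
        + lam * impact (geomWeight g) (weightedJump V W) j := by
  rw [s.impact_step_eq, s.impact_weightedJump]
  ring

/-- The average of k ↦ r_{k-1} at j+1 is W_j, so the left side is the modulus of an average of
r_{k-1} (V(W_k) - V(κ)). -/
theorem abs_avgFlux_sub_le (s : SchemeState V M L lam g r W) (κ : ℝ) (j : ℤ) :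
    |avgFlux V g r W (j + 1) - V κ * W j| ≤ avgKruzkov V g r W κ (j + 1) := by
  have hb : ∀ j, |avgFlux V g r W j - V κ * W (j - 1)| ≤ M + M := by
    intro j
    refine (abs_sub _ _).trans (add_le_add (s.abs_avgFlux_le _) ?_)
    rw [abs_mul, abs_of_nonneg (s.vel.nonneg _)]
    exact (mul_le_of_le_one_right (s.vel.nonneg _) (s.W_abs _)).trans (s.vel.le _)
  have h1 : 0 ≤ 1 - g := by linarith [s.g_mem.2]
  have := abs_le_impact_of_le s.g_mem (s.kruzkov_bound κ) hb (fun j => by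
    have h2 := s.avgFlux_step j
    have h3 := s.W_step (j - 1)
    rw [sub_add_cancel] at h3
    rw [add_sub_cancel_right]
    have h4 : avgFlux V g r W j - V κ * W (j - 1)
        = g * (r (j - 1) * (V (W j) - V κ))
          + (1 - g) * (avgFlux V g r W (j + 1) - V κ * W j) := by
      linear_combination h2 - V κ * h3
    rw [h4]
    refine (abs_add_le _ _).trans (le_of_eq ?_)
    rw [abs_mul, abs_mul, abs_mul, abs_of_nonneg h1, abs_of_pos s.g_mem.1,
      abs_of_nonneg (s.r_mem _).1]) (j + 1)
  rwa [add_sub_cancel_right] at this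

end SchemeState

/-! ### Entropy inequality, total variation and time increments of the scheme -/

/-- The entropy inequality reduced to real numbers: w and a stand for W_j and W_{j-1}, G for the
averaged flux at j+1 and Z for its Kružkov correction. No monotonicity of the nonlocal scheme is
invoked; after fixing the sign of w - κ, each sign of the outer absolute value is a linear
inequality. -/
theorem kruzkov_step_le {w a κ vw vκ g lam L G Z : ℝ} (hw : w ∈ Icc (0 : ℝ) 1)
    (ha : a ∈ Icc (0 : ℝ) 1) (hg : g ∈ Ioo (0 : ℝ) 1) (hlam : 0 < lam)
    (hG : |G - vκ * w| ≤ Z) (hvκ0 : 0 ≤ vκ)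
    (hle : w ≤ κ → vκ ≤ vw) (hge : κ ≤ w → vw ≤ vκ) (hlip : |vw - vκ| ≤ L * |w - κ|)
    (hcfl : lam * vκ + lam * L ≤ 1) :
    |w + lam * ((a - (1 - g) * w) * vw - g * G) - κ| ≤
      |w - κ| - lam * vκ * (|w - κ| - |a - κ|)
        + lam * (g * Z - (a - (1 - g) * w) * |vw - vκ|) := by
  obtain ⟨hG1, hG2⟩ := abs_le.1 hG
  set p := a - (1 - g) * w with hpdef
  have hp1 : p ≤ 1 := by
    have : 0 ≤ (1 - g) * w := mul_nonneg (by linarith [hg.2]) hw.1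
    linarith [ha.2]
  have hlg : 0 ≤ lam * g := mul_nonneg hlam.le hg.1.le
  have hlv : 0 ≤ lam * vκ := mul_nonneg hlam.le hvκ0
  have hG1' := mul_le_mul_of_nonneg_left hG1 hlg
  have hG2' := mul_le_mul_of_nonneg_left hG2 hlg
  -- The CFL condition enters here only. It is needed when the updated value lies on the other side
  -- of κ from w.
  have hpd : ∀ d e : ℝ, 0 ≤ d → d ≤ L * e → 0 ≤ e →
      0 ≤ e * (2 - 2 * (lam * vκ)) - 2 * (lam * (p * d)) := by
    intro d e hd hde he
    have h1 : p * d ≤ L * e := (mul_le_of_le_one_left hd hp1).trans hde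
    have h2 := mul_le_mul_of_nonneg_left h1 hlam.le
    have h3 : e * (lam * vκ + lam * L) ≤ e := mul_le_of_le_one_right he hcfl
    linarith
  rcases le_total κ w with h | h
  · have hd := hge h
    rw [abs_of_nonneg (sub_nonneg.2 h), abs_of_nonpos (sub_nonpos.2 hd)] at *
    rw [abs_le]
    have h1 := hpd (-(vw - vκ)) (w - κ) (by linarith) hlip (by linarith)
    have h2 : 0 ≤ lam * vκ * (|a - κ| - (a - κ)) := mul_nonneg hlv (by linarith [le_abs_self (a - κ)])
    have h3 : 0 ≤ lam * vκ * (|a - κ| + (a - κ)) := mul_nonneg hlv (by linarith [neg_abs_le (a - κ)])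
    have h4 : lam * vκ * p = lam * vκ * (a - (1 - g) * w) := by rw [hpdef]
    constructor <;> linarith
  · have hd := hle h
    rw [abs_of_nonpos (sub_nonpos.2 h), abs_of_nonneg (sub_nonneg.2 hd)] at *
    rw [abs_le]
    have h1 := hpd (vw - vκ) (-(w - κ)) (by linarith) hlip (by linarith)
    have h2 : 0 ≤ lam * vκ * (|a - κ| - (a - κ)) := mul_nonneg hlv (by linarith [le_abs_self (a - κ)])
    have h3 : 0 ≤ lam * vκ * (|a - κ| + (a - κ)) := mul_nonneg hlv (by linarith [neg_abs_le (a - κ)])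
    have h4 : lam * vκ * p = lam * vκ * (a - (1 - g) * w) := by rw [hpdef]
    constructor <;> linarith

namespace SchemeState

variable {V : ℝ → ℝ} {M L lam g : ℝ} {r W : ℤ → ℝ}

/-- The numerical entropy flux through the left interface of cell `j`. -/
def numFlux (V : ℝ → ℝ) (g : ℝ) (r W : ℤ → ℝ) (κ : ℝ) (j : ℤ) : ℝ :=
  V κ * |W (j - 1) - κ| - avgKruzkov V g r W κ j

theorem entropy_step (s : SchemeState V M L lam g r W) (κ : ℝ) (j : ℤ) :
    |impact (geomWeight g) (schemeStep V lam g r) j - κ| ≤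
      |W j - κ| - lam * (numFlux V g r W κ (j + 1) - numFlux V g r W κ j) := by
  have h := kruzkov_step_le (κ := κ) (vw := V (W j)) (vκ := V κ) (s.W_mem j) (s.W_mem (j - 1))
    s.g_mem s.lam_pos (s.abs_avgFlux_sub_le κ j)
    (s.vel.nonneg κ) (fun h => s.vel.antitone h) (fun h => s.vel.antitone h) (s.vel.lip _ _)
    (s.lam_V_le κ)
  rw [s.impact_step_eq]
  refine h.trans (le_of_eq ?_)
  rw [numFlux, numFlux, add_sub_cancel_right, s.avgKruzkov_step κ j, ← s.g_mul_r]
  ring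

theorem abs_numFlux_le (s : SchemeState V M L lam g r W) {κ : ℝ} (hκ : κ ∈ Icc (0 : ℝ) 1)
    (j : ℤ) : |numFlux V g r W κ j| ≤ 2 * M := by
  rw [numFlux, two_mul]
  refine (abs_sub _ _).trans (add_le_add ?_ (s.abs_avgKruzkov_le κ j))
  rw [abs_mul, abs_abs, abs_of_nonneg (s.vel.nonneg κ)]
  refine (mul_le_of_le_one_right (s.vel.nonneg _) ?_).trans (s.vel.le _)
  rw [abs_le]
  have := s.W_mem (j - 1)
  constructor <;> linarith [hκ.1, hκ.2, this.1, this.2]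

/-- The local oscillation that controls the flux error. -/
def localOsc (M L : ℝ) (W : ℤ → ℝ) (k : ℤ) : ℝ :=
  M * |W k - W (k - 1)| + (M + L) * |W (k + 1) - W k|

theorem localOsc_nonneg (s : SchemeState V M L lam g r W) (k : ℤ) : 0 ≤ localOsc M L W k :=
  add_nonneg (mul_nonneg s.vel.bound_nonneg (abs_nonneg _))
    (mul_nonneg (add_nonneg s.vel.bound_nonneg s.vel.lip_nonneg) (abs_nonneg _))

theorem abs_W_sub_le (s : SchemeState V M L lam g r W) (i j : ℤ) : |W i - W j| ≤ 1 := by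
  have h1 := s.W_mem i
  have h2 := s.W_mem j
  rw [abs_le]
  constructor <;> linarith [h1.1, h1.2, h2.1, h2.2]

theorem abs_localOsc_div_le (s : SchemeState V M L lam g r W) (k : ℤ) :
    |localOsc M L W k / g| ≤ (M + (M + L)) / g := by
  rw [abs_of_nonneg (div_nonneg (s.localOsc_nonneg k) s.g_mem.1.le)]
  refine div_le_div_of_nonneg_right (add_le_add ?_ ?_) s.g_mem.1.le
  · exact mul_le_of_le_one_right s.vel.bound_nonneg (s.abs_W_sub_le _ _)
  · exact mul_le_of_le_one_right (add_nonneg s.vel.bound_nonneg s.vel.lip_nonneg)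
      (s.abs_W_sub_le _ _)

/-- The error satisfies the averaging recursion with a source of size `localOsc` that lacks the
factor g, hence the division by g. After multiplication by h this becomes the length h / g = h + h
(1-g)/g, which is O(h + ε). -/
theorem abs_avgKruzkov_sub_le (s : SchemeState V M L lam g r W) (κ : ℝ) (j : ℤ) :
    |avgKruzkov V g r W κ j - W j * (|V (W j) - V κ|)| ≤
      impact (geomWeight g) (fun k => localOsc M L W k / g) j := by
  have h1 : 0 ≤ 1 - g := by linarith [s.g_mem.2]
  have hML : 0 ≤ M + L := add_nonneg s.vel.bound_nonneg s.vel.lip_nonneg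
  have hb : ∀ j, |avgKruzkov V g r W κ j - W j * (|V (W j) - V κ|)| ≤ M + M := fun j => by
    refine (abs_sub _ _).trans (add_le_add (s.abs_avgKruzkov_le κ j) ?_)
    rw [abs_mul, abs_abs]
    exact (mul_le_of_le_one_left (abs_nonneg _) (s.W_abs _)).trans (s.vel.abs_sub_le _ _)
  refine abs_le_impact_of_le s.g_mem s.abs_localOsc_div_le hb (fun j => ?_) j
  have h2 := s.avgKruzkov_step κ j
  have h3 := s.g_mul_r j
  have h4 : avgKruzkov V g r W κ j - W j * |V (W j) - V κ|
      = ((W (j - 1) - W j) * |V (W j) - V κ|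
        + (1 - g) * (W (j + 1) * |V (W (j + 1)) - V κ| - W j * |V (W j) - V κ|))
        + (1 - g) * (avgKruzkov V g r W κ (j + 1) - W (j + 1) * |V (W (j + 1)) - V κ|) := by
    linear_combination h2 + |V (W j) - V κ| * h3
  rw [h4, mul_div_cancel₀ _ s.g_mem.1.ne']
  refine (abs_add_le _ _).trans (add_le_add ((abs_add_le _ _).trans (add_le_add ?_ ?_)) ?_)
  · rw [abs_mul, abs_abs, abs_sub_comm, mul_comm]
    exact mul_le_mul_of_nonneg_right (s.vel.abs_sub_le _ _) (abs_nonneg _)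
  · rw [abs_mul, abs_of_nonneg h1]
    exact (mul_le_of_le_one_left (abs_nonneg _) (by linarith [s.g_mem.1])).trans
      (s.vel.abs_mul_sub_mul_le κ (s.W_mem j))
  · rw [abs_mul, abs_of_nonneg h1]

/-- A bound for the distance of the numerical fluxes at the two interfaces of a cell from the
entropy flux of the cell value, uniform in the Kružkov constant. -/
def fluxError (M L g : ℝ) (W : ℤ → ℝ) (j : ℤ) : ℝ :=
  localOsc M L W j + impact (geomWeight g) (fun k => localOsc M L W k / g) j
    + impact (geomWeight g) (fun k => localOsc M L W k / g) (j + 1)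

theorem impact_localOsc_nonneg (s : SchemeState V M L lam g r W) (j : ℤ) :
    0 ≤ impact (geomWeight g) (fun k => localOsc M L W k / g) j :=
  impact_nonneg s.g_mem (fun k => div_nonneg (s.localOsc_nonneg k) s.g_mem.1.le) j

theorem fluxError_nonneg (s : SchemeState V M L lam g r W) (j : ℤ) : 0 ≤ fluxError M L g W j :=
  add_nonneg (add_nonneg (s.localOsc_nonneg j) (s.impact_localOsc_nonneg j))
    (s.impact_localOsc_nonneg _)

theorem abs_numFlux_sub_le (s : SchemeState V M L lam g r W) (κ : ℝ) (j : ℤ) :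
    |numFlux V g r W κ j - kruzkovFlux V κ (W j)| ≤ fluxError M L g W j := by
  rw [s.vel.kruzkovFlux_eq, numFlux, fluxError, localOsc]
  have h1 := s.abs_avgKruzkov_sub_le κ j
  have h2 : |V κ * (|W (j - 1) - κ| - |W j - κ|)| ≤ M * |W j - W (j - 1)| := by
    rw [abs_mul, abs_of_nonneg (s.vel.nonneg κ), abs_sub_comm (W j) (W (j - 1))]
    refine mul_le_mul (s.vel.le κ) ?_ (abs_nonneg _) s.vel.bound_nonneg
    exact (abs_abs_sub_abs_le_abs_sub _ _).trans (by rw [sub_sub_sub_cancel_right])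
  have h3 := s.impact_localOsc_nonneg (j + 1)
  have h4 : 0 ≤ (M + L) * |W (j + 1) - W j| :=
    mul_nonneg (add_nonneg s.vel.bound_nonneg s.vel.lip_nonneg) (abs_nonneg _)
  calc _ = |V κ * (|W (j - 1) - κ| - |W j - κ|)
          - (avgKruzkov V g r W κ j - W j * (|V (W j) - V κ|))| := by congr 1; ring
    _ ≤ _ := (abs_sub _ _).trans (by linarith)

theorem abs_numFlux_succ_sub_le (s : SchemeState V M L lam g r W) (κ : ℝ) (j : ℤ) :
    |numFlux V g r W κ (j + 1) - kruzkovFlux V κ (W j)| ≤ fluxError M L g W j := by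
  rw [s.vel.kruzkovFlux_eq, numFlux, fluxError, localOsc, add_sub_cancel_right]
  have h1 := s.abs_avgKruzkov_sub_le κ (j + 1)
  have h2 := s.vel.abs_mul_sub_mul_le κ (a := W (j + 1)) (s.W_mem j)
  have h3 := s.impact_localOsc_nonneg j
  have h4 : 0 ≤ M * |W j - W (j - 1)| := mul_nonneg s.vel.bound_nonneg (abs_nonneg _)
  calc _ = |-(avgKruzkov V g r W κ (j + 1) - W (j + 1) * (|V (W (j + 1)) - V κ|))
          - (W (j + 1) * (|V (W (j + 1)) - V κ|) - W j * (|V (W j) - V κ|))| := by congr 1; ring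
    _ ≤ _ := (abs_sub _ _).trans (by rw [abs_neg]; linarith)

theorem hasSum_localOsc (hs : Summable (fun j => |W (j + 1) - W j|)) :
    HasSum (localOsc M L W) ((2 * M + L) * seqVariation W) := by
  have h1 : HasSum (fun j => |W (j + 1) - W j|) (seqVariation W) := hs.hasSum
  have h2 := hasSum_shift_sub h1 1
  simp only [sub_add_cancel] at h2
  have := (h2.mul_left M).add (h1.mul_left (M + L))
  rwa [show M * seqVariation W + (M + L) * seqVariation W = (2 * M + L) * seqVariation W by ring]
    at this

theorem hasSum_fluxError (s : SchemeState V M L lam g r W)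
    (hs : Summable (fun j => |W (j + 1) - W j|)) :
    HasSum (fluxError M L g W) ((1 + 2 / g) * ((2 * M + L) * seqVariation W)) := by
  have h1 := hasSum_localOsc (M := M) (L := L) hs
  have h2 := h1.div_const g
  have h3 := hasSum_impact s.g_mem
    (fun k => div_nonneg (s.localOsc_nonneg k) s.g_mem.1.le) h2.summable
  rw [h2.tsum_eq] at h3
  have := (h1.add h3).add (hasSum_shift h3 1)
  rwa [show (1 + 2 / g) * ((2 * M + L) * seqVariation W)
    = (2 * M + L) * seqVariation W + (2 * M + L) * seqVariation W / g
      + (2 * M + L) * seqVariation W / g by ring]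

/-- The right side is independent of any Kružkov constant and sums to λ (M + L) times the variation,
which makes W Lipschitz in time with values in L¹. -/
theorem abs_W_sub_next_le (s : SchemeState V M L lam g r W) (j : ℤ) :
    |impact (geomWeight g) (schemeStep V lam g r) j - W j| ≤
      lam * (M * |W j - W (j - 1)|
        + impact (geomWeight g) (fun k => L * |W (k + 1) - W k|) j) := by
  have hb : ∀ k, |L * (|W (k + 1) - W k|)| ≤ L := fun k => by
    rw [abs_mul, abs_abs, abs_of_nonneg s.vel.lip_nonneg]
    exact mul_le_of_le_one_right s.vel.lip_nonneg (s.abs_W_sub_le _ _)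
  have h1 : |impact (geomWeight g) (weightedJump V W) j|
      ≤ impact (geomWeight g) (fun k => L * |W (k + 1) - W k|) j := by
    have h0 : 0 ≤ 1 - g := by linarith [s.g_mem.2]
    refine abs_le_impact_of_le s.g_mem hb
      (abs_impact_le s.g_mem s.abs_weightedJump_le_const) (fun j => ?_) j
    rw [impact_step s.g_mem s.abs_weightedJump_le_const j]
    refine (abs_add_le _ _).trans ?_
    rw [abs_mul, abs_mul, abs_of_nonneg h0, abs_of_pos s.g_mem.1]
    have := mul_le_mul_of_nonneg_left (s.abs_weightedJump_le j) s.g_mem.1.le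
    linarith
  rw [s.impact_step_eq']
  have h2 : V (W j) * |W j - W (j - 1)| ≤ M * |W j - W (j - 1)| :=
    mul_le_mul_of_nonneg_right (s.vel.le _) (abs_nonneg _)
  calc _ = |lam * (-(V (W j) * (W j - W (j - 1)))
          + impact (geomWeight g) (weightedJump V W) j)| := by congr 1; ring
    _ ≤ _ := by
      rw [abs_mul, abs_of_pos s.lam_pos]
      refine mul_le_mul_of_nonneg_left ((abs_add_le _ _).trans (add_le_add ?_ h1)) s.lam_pos.le
      rwa [abs_neg, abs_mul, abs_of_nonneg (s.vel.nonneg _)]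

theorem hasSum_time_bound (s : SchemeState V M L lam g r W)
    (hs : Summable (fun j => |W (j + 1) - W j|)) :
    HasSum (fun j => lam * (M * |W j - W (j - 1)|
        + impact (geomWeight g) (fun k => L * |W (k + 1) - W k|) j))
      (lam * ((M + L) * seqVariation W)) := by
  have h1 : HasSum (fun j => |W (j + 1) - W j|) (seqVariation W) := hs.hasSum
  have h2 := hasSum_shift_sub h1 1
  simp only [sub_add_cancel] at h2
  have h4 := h1.mul_left L
  have h3 := hasSum_impact s.g_mem
    (fun k => mul_nonneg s.vel.lip_nonneg (abs_nonneg (W (k + 1) - W k))) h4.summable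
  rw [h4.tsum_eq] at h3
  have := ((h2.mul_left M).add h3).mul_left lam
  rwa [← add_mul] at this

/-- The nonlocal source could create variation, but the local part of its increment has the sign of
W_{j+1} - W_j and enters with a minus sign. It therefore reduces the local increment by exactly the
amount that the averaged part can add elsewhere. -/
theorem tvd_step (s : SchemeState V M L lam g r W) (hs : Summable (fun j => |W (j + 1) - W j|)) :
    Summable (fun j => |impact (geomWeight g) (schemeStep V lam g r) (j + 1)
        - impact (geomWeight g) (schemeStep V lam g r) j|) ∧
      seqVariation (impact (geomWeight g) (schemeStep V lam g r)) ≤ seqVariation W := by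
  set b : ℤ → ℝ := weightedJump V W with hb
  set B : ℤ → ℝ := impact (geomWeight g) b with hB
  set A : ℤ → ℝ := impact (geomWeight g) (fun k => |b k|) with hA
  -- X is arranged so that the change of variation is bounded by X_j - X_{j+1}, which sums to zero.
  set X : ℤ → ℝ := fun j => lam * (V (W j) * |W j - W (j - 1)|) - lam * A j with hX
  have hbb : ∀ k, |(|b k|)| ≤ M := fun k => by rw [abs_abs]; exact s.abs_weightedJump_le_const k
  have h0 : 0 ≤ 1 - g := by linarith [s.g_mem.2]
  have hBA : ∀ j, |B j| ≤ A j := fun j => by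
    refine abs_le_impact_of_le s.g_mem hbb
      (abs_impact_le s.g_mem s.abs_weightedJump_le_const) (fun j => ?_) j
    rw [impact_step s.g_mem s.abs_weightedJump_le_const j]
    refine (abs_add_le _ _).trans ?_
    rw [abs_mul, abs_mul, abs_of_nonneg h0, abs_of_pos s.g_mem.1]
  have hbs : Summable (fun k => |b k|) :=
    Summable.of_nonneg_of_le (fun _ => abs_nonneg _) s.abs_weightedJump_le (hs.mul_left L)
  have hAs : Summable A := (hasSum_impact s.g_mem (fun _ => abs_nonneg _) hbs).summable
  have h1 : HasSum (fun j => |W (j + 1) - W j|) (seqVariation W) := hs.hasSum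
  have h2 := hasSum_shift_sub h1 1
  simp only [sub_add_cancel] at h2
  have hXs : Summable X := by
    refine Summable.sub (Summable.mul_left _ ?_) (hAs.mul_left _)
    refine Summable.of_nonneg_of_le (fun j => mul_nonneg (s.vel.nonneg _) (abs_nonneg _))
      (fun j => ?_) (h2.summable.mul_left M)
    exact mul_le_mul_of_nonneg_right (s.vel.le _) (abs_nonneg _)
  have key : ∀ j, |impact (geomWeight g) (schemeStep V lam g r) (j + 1)
        - impact (geomWeight g) (schemeStep V lam g r) j|
      ≤ |W (j + 1) - W j| + (X j - X (j + 1)) := by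
    intro j
    have e1 := impact_step s.g_mem s.abs_weightedJump_le_const j
    have e2 := impact_step s.g_mem hbb j
    rw [← hb, ← hB] at e1
    rw [← hA] at e2
    simp only [hX, add_sub_cancel_right]
    rw [s.impact_step_eq', s.impact_step_eq', ← hb, ← hB, add_sub_cancel_right]
    set D := W (j + 1) - W j with hD
    -- As V decreases, b_j and D have equal signs, and |b_j| ≤ L |D| with the CFL condition prevents
    -- a change of sign; so the modulus of the difference is the difference of the moduli.
    have hloc : |D * (1 - lam * V (W (j + 1))) - lam * g * b j|
        ≤ |D| * (1 - lam * V (W (j + 1))) - lam * g * |b j| := by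
      have hc := s.lam_V_le (W (j + 1))
      have hbl := s.abs_weightedJump_le j
      rw [← hb, ← hD] at hbl
      have hlg : 0 ≤ lam * g := mul_nonneg s.lam_pos.le s.g_mem.1.le
      have hlg1 : lam * g * |b j| ≤ lam * |b j| :=
        mul_le_mul_of_nonneg_right (mul_le_of_le_one_right s.lam_pos.le s.g_mem.2.le)
          (abs_nonneg _)
      have hl := mul_le_mul_of_nonneg_left hbl s.lam_pos.le
      have hDc : |D| * (lam * V (W (j + 1)) + lam * L) ≤ |D| :=
        mul_le_of_le_one_right (abs_nonneg _) hc
      rcases le_total (W j) (W (j + 1)) with h | h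
      · have hb0 : 0 ≤ b j := mul_nonneg (s.W_mem j).1 (by linarith [s.vel.antitone h])
        have hD0 : 0 ≤ D := by linarith
        rw [abs_of_nonneg hb0, abs_of_nonneg hD0] at *
        rw [abs_of_nonneg (by linarith)]
      · have hb0 : b j ≤ 0 := mul_nonpos_of_nonneg_of_nonpos (s.W_mem j).1
          (by linarith [s.vel.antitone h])
        have hD0 : D ≤ 0 := by linarith
        rw [abs_of_nonpos hb0, abs_of_nonpos hD0] at *
        rw [abs_of_nonpos (by linarith)]
        linarith
    have hB1 := hBA (j + 1)
    have hlv : 0 ≤ lam * V (W j) := mul_nonneg s.lam_pos.le (s.vel.nonneg _)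
    calc _ = |(D * (1 - lam * V (W (j + 1))) - lam * g * b j)
          + lam * V (W j) * (W j - W (j - 1)) + lam * g * B (j + 1)| := by
            congr 1
            rw [hD]
            linear_combination -lam * e1
      _ ≤ (|D| * (1 - lam * V (W (j + 1))) - lam * g * |b j|)
          + lam * V (W j) * |W j - W (j - 1)| + lam * g * A (j + 1) := by
            refine (abs_add_le _ _).trans (add_le_add ((abs_add_le _ _).trans
              (add_le_add hloc ?_)) ?_)
            · rw [abs_mul, abs_of_nonneg hlv]
            · rw [abs_mul, abs_of_nonneg (mul_nonneg s.lam_pos.le s.g_mem.1.le)]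
              exact mul_le_mul_of_nonneg_left hB1 (mul_nonneg s.lam_pos.le s.g_mem.1.le)
      _ = _ := by linear_combination lam * e2
  have hXsum : HasSum (fun j => X j - X (j + 1)) 0 := by
    have := hXs.hasSum.sub (hasSum_shift hXs.hasSum 1)
    rwa [sub_self] at this
  have htot := h1.add hXsum
  rw [add_zero] at htot
  have hsum := Summable.of_nonneg_of_le (fun _ => abs_nonneg _) key htot.summable
  exact ⟨hsum, hasSum_le key hsum.hasSum htot⟩

end SchemeState

/-! ### The numerical solution as a family of functions on the line -/

/-- A time-discrete approximation of `∂ₜu + ∂ₓf(u) = 0` on the line with time step `τ`: it satisfies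
entropy inequalities in finite difference form, whose numerical fluxes `Q` are close to the entropy
fluxes `q` in `L¹`, and has `L¹` moduli of continuity in space and in time. -/
structure IsApproximation (q : ℝ → ℝ → ℝ) (τ h D B S : ℝ) (u : ℕ → ℝ → ℝ)
    (Q : ℕ → ℝ → ℝ → ℝ) (m : ℕ → ℝ → ℝ) : Prop where
  τ_pos : 0 < τ
  h_pos : 0 < h
  B_nonneg : 0 ≤ B
  S_nonneg : 0 ≤ S
  measurable : ∀ n, Measurable (u n)
  mem : ∀ n x, u n x ∈ Icc (0 : ℝ) 1
  measurable_flux : ∀ n, Measurable (fun p : ℝ × ℝ => Q n p.1 p.2)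
  flux_bound : ∃ C, ∀ n, ∀ κ ∈ Icc (0 : ℝ) 1, ∀ x, |Q n κ x| ≤ C
  entropy : ∀ n κ x, |u (n + 1) x - κ| ≤ |u n x - κ| - τ / h * (Q n κ (x + h) - Q n κ x)
  close : ∀ n, ∀ κ ∈ Icc (0 : ℝ) 1, ∀ x, ∀ s ∈ Icc (0 : ℝ) h, |Q n κ (x + s) - q κ (u n x)| ≤ m n x
  integrable_error : ∀ n, Integrable (m n)
  integral_error_le : ∀ n, ∫ x, m n x ≤ D
  translate : ∀ n a, ∫⁻ x, ‖u n (x + a) - u n x‖ₑ ≤ ENNReal.ofReal (|a| * B)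
  time : ∀ n, ∫⁻ x, ‖u (n + 1) x - u n x‖ₑ ≤ ENNReal.ofReal (τ * S)

/-! ### Cell averages of the initial datum, and variation under averaging -/

section Datum

variable {ρ₀ : ℝ → ℝ}

theorem locallyIntegrable_of_mem_Icc {f : ℝ → ℝ} (hf : AEStronglyMeasurable f volume)
    (h01 : ∀ᵐ x, f x ∈ Icc (0 : ℝ) 1) : LocallyIntegrable f := by
  have h1 : LocallyIntegrable (fun _ : ℝ => (1 : ℝ)) := locallyIntegrable_const 1
  refine h1.mono hf ?_
  filter_upwards [h01] with x hx
  rw [Real.norm_eq_abs, abs_of_nonneg hx.1, norm_one]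
  exact hx.2

theorem IsInitialDatum.cellAverage_mem (h0 : IsInitialDatum ρ₀) {h : ℝ} (hh : 0 < h) (j : ℤ) :
    cellAverage h ρ₀ j ∈ Icc (0 : ℝ) 1 := by
  have hab : ((j : ℝ) - 1 / 2) * h ≤ ((j : ℝ) + 1 / 2) * h := by nlinarith
  have hI : IntervalIntegrable ρ₀ volume (((j : ℝ) - 1 / 2) * h) (((j : ℝ) + 1 / 2) * h) :=
    ((locallyIntegrable_of_mem_Icc h0.aestronglyMeasurable h0.mem_Icc).integrableOn_isCompact
      isCompact_uIcc).intervalIntegrable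
  rw [cellAverage]
  constructor
  · refine mul_nonneg (by positivity) (intervalIntegral.integral_nonneg_of_ae hab ?_)
    exact h0.mem_Icc.mono fun x hx => hx.1
  · have h1 : ∫ x in (((j : ℝ) - 1 / 2) * h)..(((j : ℝ) + 1 / 2) * h), ρ₀ x
        ≤ ∫ _x in (((j : ℝ) - 1 / 2) * h)..(((j : ℝ) + 1 / 2) * h), (1 : ℝ) :=
      intervalIntegral.integral_mono_ae hab hI (by simp) (h0.mem_Icc.mono fun x hx => hx.2)
    rw [intervalIntegral.integral_const, smul_eq_mul, mul_one] at h1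
    calc _ ≤ 1 / h * (((j : ℝ) + 1 / 2) * h - ((j : ℝ) - 1 / 2) * h) :=
          mul_le_mul_of_nonneg_left h1 (by positivity)
      _ = 1 := by field_simp; ring

/-- Only representatives of finite variation need testing, and these are automatically measurable.
-/
theorem le_essVariation {f : ℝ → ℝ} {a : ℝ≥0∞} (hf : ∀ g, g =ᵐ[volume] f →
    eVariationOn g univ ≠ ∞ → a ≤ eVariationOn g univ) : a ≤ essVariation f := by
  refine le_iInf₂ fun g hg => ?_
  by_cases h : eVariationOn g univ = ∞
  · rw [h]; exact le_top
  · exact hf g hg h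

theorem IsInitialDatum.locallyIntegrable_congr (h0 : IsInitialDatum ρ₀) {f : ℝ → ℝ}
    (hf : f =ᵐ[volume] ρ₀) : LocallyIntegrable f :=
  locallyIntegrable_of_mem_Icc (h0.aestronglyMeasurable.congr hf.symm)
    (by filter_upwards [hf, h0.mem_Icc] with x h1 h2; rwa [h1])

theorem IsInitialDatum.tsum_edist_cellAverage_le (h0 : IsInitialDatum ρ₀) {h : ℝ} (hh : 0 < h) :
    ∑' j : ℤ, edist (cellAverage h ρ₀ (j + 1)) (cellAverage h ρ₀ j) ≤ essVariation ρ₀ := by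
  refine le_essVariation fun g hg hgv => ?_
  rw [← cellAverage_congr hg h]
  exact NonlocalGodunov.tsum_edist_cellAverage_le (measurable_of_eVariationOn_ne_top hgv)
    (h0.locallyIntegrable_congr hg) hh

theorem IsInitialDatum.lintegral_cellAverage_sub_le (h0 : IsInitialDatum ρ₀) {h : ℝ}
    (hh : 0 < h) :
    ∫⁻ x, ‖cellAverage h ρ₀ (cellIndex h x) - ρ₀ x‖ₑ ≤
      ENNReal.ofReal (2 * h) * essVariation ρ₀ := by
  have hpos : ENNReal.ofReal (2 * h) ≠ 0 := by
    rw [ne_eq, ENNReal.ofReal_eq_zero]; linarith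
  -- Isolates the infimum, so that each representative can be treated separately.
  rw [mul_comm, ← ENNReal.div_le_iff hpos ENNReal.ofReal_ne_top]
  refine le_essVariation fun g hg hgv => ?_
  rw [ENNReal.div_le_iff hpos ENNReal.ofReal_ne_top, mul_comm, ← cellAverage_congr hg h]
  refine le_trans (le_of_eq (lintegral_congr_ae ?_)) (NonlocalGodunov.lintegral_cellAverage_sub_le
    (measurable_of_eVariationOn_ne_top hgv) (h0.locallyIntegrable_congr hg) hh)
  filter_upwards [hg] with x hx
  rw [hx]

theorem tsum_edist_eq {W : ℤ → ℝ} (hs : Summable (fun j => |W (j + 1) - W j|)) :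
    ∑' j : ℤ, edist (W (j + 1)) (W j) = ENNReal.ofReal (seqVariation W) := by
  rw [seqVariation, ENNReal.ofReal_tsum_of_nonneg (fun _ => abs_nonneg _) hs]
  refine tsum_congr fun j => ?_
  rw [edist_dist, Real.dist_eq]

theorem summable_of_tsum_edist_ne_top {W : ℤ → ℝ}
    (h : ∑' j : ℤ, edist (W (j + 1)) (W j) ≠ ∞) : Summable (fun j => |W (j + 1) - W j|) := by
  have := ENNReal.summable_toReal h
  refine this.congr fun j => ?_
  rw [edist_dist, ENNReal.toReal_ofReal dist_nonneg, Real.dist_eq]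

theorem IsInitialDatum.seqVariation_cellAverage (h0 : IsInitialDatum ρ₀) {h : ℝ} (hh : 0 < h) :
    Summable (fun j => |cellAverage h ρ₀ (j + 1) - cellAverage h ρ₀ j|) ∧
      seqVariation (cellAverage h ρ₀) ≤ (essVariation ρ₀).toReal := by
  have h1 := h0.tsum_edist_cellAverage_le hh
  have h2 := summable_of_tsum_edist_ne_top (h1.trans_lt h0.tv_lt_top).ne
  refine ⟨h2, ?_⟩
  rw [tsum_edist_eq h2] at h1
  exact (ENNReal.ofReal_le_iff_le_toReal h0.tv_lt_top.ne).1 h1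

theorem seqVariation_nonneg (W : ℤ → ℝ) : 0 ≤ seqVariation W := tsum_nonneg fun _ => abs_nonneg _

theorem seqVariation_impact_le {g : ℝ} (hg : g ∈ Ioo (0 : ℝ) 1) {r : ℤ → ℝ}
    (hr : ∀ j, r j ∈ Icc (0 : ℝ) 1) (hs : Summable (fun j => |r (j + 1) - r j|)) :
    Summable (fun j => |impact (geomWeight g) r (j + 1) - impact (geomWeight g) r j|) ∧
      seqVariation (impact (geomWeight g) r) ≤ seqVariation r := by
  have hra : ∀ j, |r j| ≤ 1 := fun j => by rw [abs_of_nonneg (hr j).1]; exact (hr j).2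
  have hd : ∀ j, |r (j + 1) - r j| ≤ 1 := fun j => by
    rw [abs_le]
    constructor <;> linarith [(hr j).1, (hr j).2, (hr (j + 1)).1, (hr (j + 1)).2]
  have h0 : 0 ≤ 1 - g := by linarith [hg.2]
  have key : ∀ j, |impact (geomWeight g) r (j + 1) - impact (geomWeight g) r j|
      ≤ impact (geomWeight g) (fun k => |r (k + 1) - r k|) j := by
    refine abs_le_impact_of_le hg (C := 1) (C' := 1 + 1) (fun j => by rw [abs_abs]; exact hd j)
      (fun j => (abs_sub _ _).trans (add_le_add (abs_impact_le hg hra _) (abs_impact_le hg hra _)))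
      (fun j => ?_)
    have e : impact (geomWeight g) r (j + 1) - impact (geomWeight g) r j
        = g * (r (j + 1) - r j)
          + (1 - g) * (impact (geomWeight g) r (j + 1 + 1) - impact (geomWeight g) r (j + 1)) := by
      linear_combination impact_step hg hra (j + 1) - impact_step hg hra j
    rw [e]
    refine (abs_add_le _ _).trans ?_
    rw [abs_mul, abs_mul, abs_of_nonneg h0, abs_of_pos hg.1]
  have hS := hasSum_impact hg (fun k => abs_nonneg (r (k + 1) - r k)) hs
  have hsum := Summable.of_nonneg_of_le (fun _ => abs_nonneg _) key hS.summable
  exact ⟨hsum, hasSum_le key hsum.hasSum hS⟩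

end Datum

/-! ### The scheme as an instance of `IsApproximation` -/

section Scheme

variable {V ρ₀ : ℝ → ℝ} {M L lam h g : ℝ}

theorem density_succ (n : ℕ) :
    density V ρ₀ lam h (geomWeight g) (n + 1)
      = schemeStep V lam g (density V ρ₀ lam h (geomWeight g) n) := rfl

theorem schemeState (hV : IsGlobalVelocity V M L) (h0 : IsInitialDatum ρ₀)
    (hg : g ∈ Ioo (0 : ℝ) 1) (hlam : 0 < lam) (hcfl : lam * (M + L) ≤ 1) (hh : 0 < h) (n : ℕ) :
    SchemeState V M L lam g (density V ρ₀ lam h (geomWeight g) n)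
      (numImpact V ρ₀ lam h (geomWeight g) n) := by
  induction n with
  | zero => exact ⟨hV, hg, hlam, hcfl, fun j => h0.cellAverage_mem hh j, rfl⟩
  | succ n ih => exact ih.next

/-- The impacts never leave [0,1], so the scheme does not see how V is extended. -/
theorem density_clampVelocity (hV : IsVelocity V) (h0 : IsInitialDatum ρ₀)
    (hg : g ∈ Ioo (0 : ℝ) 1) (hlam : 0 < lam) (hcfl : CFL lam V) (hh : 0 < h) (n : ℕ) :
    density V ρ₀ lam h (geomWeight g) n
      = density (clampVelocity V) ρ₀ lam h (geomWeight g) n := by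
  induction n with
  | zero => rfl
  | succ n ih =>
    have s := schemeState hV.isGlobalVelocity h0 hg hlam hcfl hh n
    rw [density_succ, density_succ, ih]
    funext j
    have h1 := s.W_mem
    simp only [numImpact] at h1
    rw [schemeStep, schemeStep, clampVelocity_eq V (h1 j), clampVelocity_eq V (h1 (j + 1))]

theorem seqVariation_numImpact (hV : IsGlobalVelocity V M L) (h0 : IsInitialDatum ρ₀)
    (hg : g ∈ Ioo (0 : ℝ) 1) (hlam : 0 < lam) (hcfl : lam * (M + L) ≤ 1) (hh : 0 < h) (n : ℕ) :
    Summable (fun j => |numImpact V ρ₀ lam h (geomWeight g) n (j + 1)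
        - numImpact V ρ₀ lam h (geomWeight g) n j|) ∧
      seqVariation (numImpact V ρ₀ lam h (geomWeight g) n) ≤ (essVariation ρ₀).toReal := by
  induction n with
  | zero =>
    have h1 := h0.seqVariation_cellAverage hh
    have h2 := seqVariation_impact_le hg (h0.cellAverage_mem hh) h1.1
    exact ⟨h2.1, h2.2.trans h1.2⟩
  | succ n ih =>
    have s := schemeState hV h0 hg hlam hcfl hh n
    have h2 := s.tvd_step ih.1
    exact ⟨h2.1, h2.2.trans ih.2⟩

theorem lintegral_cellIndex_ofReal (hh : 0 < h) {f : ℤ → ℝ} {S : ℝ} (hf0 : ∀ j, 0 ≤ f j)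
    (hf : HasSum f S) :
    ∫⁻ x, ENNReal.ofReal (f (cellIndex h x)) = ENNReal.ofReal (h * S) := by
  rw [lintegral_cellIndex hh (fun j => ENNReal.ofReal (f j)),
    ← ENNReal.ofReal_tsum_of_nonneg hf0 hf.summable, hf.tsum_eq, ENNReal.ofReal_mul hh.le]

/-- The numerical impact as a function on the line. -/
def impactFun (V ρ₀ : ℝ → ℝ) (lam h g : ℝ) (n : ℕ) (x : ℝ) : ℝ :=
  numImpact V ρ₀ lam h (geomWeight g) n (cellIndex h x)

/-- The numerical entropy flux as a function on the line. -/
def fluxFun (V ρ₀ : ℝ → ℝ) (lam h g : ℝ) (n : ℕ) (κ x : ℝ) : ℝ :=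
  SchemeState.numFlux V g (density V ρ₀ lam h (geomWeight g) n)
    (numImpact V ρ₀ lam h (geomWeight g) n) κ (cellIndex h x)

/-- The bound for the flux error as a function on the line. -/
def fluxErrorFun (V ρ₀ : ℝ → ℝ) (M L lam h g : ℝ) (n : ℕ) (x : ℝ) : ℝ :=
  SchemeState.fluxError M L g (numImpact V ρ₀ lam h (geomWeight g) n) (cellIndex h x)

theorem SchemeState.continuous_numFlux {r W : ℤ → ℝ} (s : SchemeState V M L lam g r W) (j : ℤ) :
    Continuous (fun κ => numFlux V g r W κ j) := by
  have hVc := s.vel.continuous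
  have h1 : Continuous (fun κ => avgKruzkov V g r W κ j) := by
    refine continuous_tsum (u := fun k => geomWeight g k * M) (fun k => by fun_prop)
      ((summable_geomWeight s.g_mem).mul_right M) (fun k κ => ?_)
    rw [norm_mul, Real.norm_eq_abs, Real.norm_eq_abs, abs_of_nonneg (geomWeight_nonneg s.g_mem k)]
    exact mul_le_mul_of_nonneg_left (s.kruzkov_bound κ _) (geomWeight_nonneg s.g_mem k)
  unfold numFlux
  fun_prop

/-- The flux error is proportional to h (1 + 2/g), one local term plus an average with total factor
1/g for each of the two interfaces. The constants in the two moduli of continuity do not depend on g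
or h. -/
theorem isApproximation (hV : IsGlobalVelocity V M L) (h0 : IsInitialDatum ρ₀)
    (hg : g ∈ Ioo (0 : ℝ) 1) (hlam : 0 < lam) (hcfl : lam * (M + L) ≤ 1) (hh : 0 < h) :
    IsApproximation (kruzkovFlux V) (lam * h) h
      (h * (1 + 2 / g) * ((2 * M + L) * (essVariation ρ₀).toReal)) (essVariation ρ₀).toReal
      ((M + L) * (essVariation ρ₀).toReal) (impactFun V ρ₀ lam h g) (fluxFun V ρ₀ lam h g)
      (fluxErrorFun V ρ₀ M L lam h g) := by
  have st := schemeState hV h0 hg hlam hcfl hh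
  have tv := seqVariation_numImpact hV h0 hg hlam hcfl hh
  have hM := hV.bound_nonneg
  have hL := hV.lip_nonneg
  have hg0 := hg.1
  have hE : ∀ n, ∫⁻ x, ENNReal.ofReal (fluxErrorFun V ρ₀ M L lam h g n x)
      = ENNReal.ofReal (h * ((1 + 2 / g) * ((2 * M + L)
        * seqVariation (numImpact V ρ₀ lam h (geomWeight g) n)))) := fun n =>
    lintegral_cellIndex_ofReal hh (st n).fluxError_nonneg ((st n).hasSum_fluxError (tv n).1)
  have hEm : ∀ n, Measurable (fluxErrorFun V ρ₀ M L lam h g n) := fun n =>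
    (measurable_of_countable _).comp (measurable_cellIndex h)
  have hE0 : ∀ n x, 0 ≤ fluxErrorFun V ρ₀ M L lam h g n x := fun n x => (st n).fluxError_nonneg _
  refine
    { τ_pos := by positivity
      h_pos := hh
      B_nonneg := ENNReal.toReal_nonneg
      S_nonneg := by positivity
      measurable := fun n => (measurable_of_countable _).comp (measurable_cellIndex h)
      mem := fun n x => (st n).W_mem _
      measurable_flux := fun n => ?_
      flux_bound := ⟨2 * M, fun n κ hκ x => (st n).abs_numFlux_le hκ _⟩
      entropy := fun n κ x => ?_
      close := fun n κ hκ x s hs => ?_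
      integrable_error := fun n => ?_
      integral_error_le := fun n => ?_
      translate := fun n a => ?_
      time := fun n => ?_ }
  -- Joint measurability: continuous in κ, and dependent on x only through a countable index.
  · have h1 : Measurable (fun p : ℝ × ℤ => SchemeState.numFlux V g
        (density V ρ₀ lam h (geomWeight g) n) (numImpact V ρ₀ lam h (geomWeight g) n) p.1 p.2) :=
      measurable_from_prod_countable_left fun j => ((st n).continuous_numFlux j).measurable
    exact h1.comp (measurable_fst.prodMk ((measurable_cellIndex h).comp measurable_snd))
  · have := (st n).entropy_step κ (cellIndex h x)
    rw [fluxFun, fluxFun, cellIndex_add hh, mul_div_cancel_right₀ _ hh.ne']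
    exact this
  -- A shift by at most h stays in the cell or reaches the next one, so only the two interfaces of
  -- the cell of x occur.
  · have hlow : cellIndex h x ≤ cellIndex h (x + s) := cellIndex_mono hh (by linarith [hs.1])
    have hup : cellIndex h (x + s) ≤ cellIndex h x + 1 := by
      rw [← cellIndex_add hh]
      exact cellIndex_mono hh (by linarith [hs.2])
    rw [fluxFun, impactFun, fluxErrorFun]
    rcases (by omega : cellIndex h (x + s) = cellIndex h x
        ∨ cellIndex h (x + s) = cellIndex h x + 1) with e | e
    · rw [e]; exact (st n).abs_numFlux_sub_le κ _
    · rw [e]; exact (st n).abs_numFlux_succ_sub_le κ _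
  · refine ⟨(hEm n).aestronglyMeasurable, ?_⟩
    rw [hasFiniteIntegral_iff_ofReal (Eventually.of_forall (hE0 n)), hE]
    exact ENNReal.ofReal_lt_top
  · rw [integral_eq_lintegral_of_nonneg_ae (Eventually.of_forall (hE0 n))
      (hEm n).aestronglyMeasurable, hE, ENNReal.toReal_ofReal
      (by have := seqVariation_nonneg (numImpact V ρ₀ lam h (geomWeight g) n); positivity), mul_assoc]
    have := (tv n).2
    gcongr
  · refine (lintegral_translate_sub_le
      ((measurable_of_countable _).comp (measurable_cellIndex h)) a).trans ?_
    rw [ENNReal.ofReal_mul (abs_nonneg a)]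
    gcongr
    refine (eVariationOn_comp_cellIndex_le hh _).trans ?_
    rw [tsum_edist_eq (tv n).1]
    exact ENNReal.ofReal_le_ofReal (tv n).2
  · have h1 := (st n).hasSum_time_bound (tv n).1
    have h2 := lintegral_cellIndex_ofReal hh
      (fun j => (abs_nonneg _).trans ((st n).abs_W_sub_next_le j)) h1
    calc _ ≤ _ := lintegral_mono fun x => ?_
      _ = _ := h2
      _ ≤ _ := ENNReal.ofReal_le_ofReal ?_
    · rw [Real.enorm_eq_ofReal_abs]
      exact ENNReal.ofReal_le_ofReal ((st n).abs_W_sub_next_le _)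
    · have := (tv n).2
      calc h * (lam * ((M + L) * seqVariation (numImpact V ρ₀ lam h (geomWeight g) n)))
          ≤ h * (lam * ((M + L) * (essVariation ρ₀).toReal)) := by gcongr
        _ = _ := by ring

/-- From the recursion, r_j - W_j = ((1-g)/g) (W_j - W_{j+1}). Only the variation of W is used,
never that of the density. -/
theorem lintegral_density_sub_impactFun_le (hV : IsGlobalVelocity V M L) (h0 : IsInitialDatum ρ₀)
    (hg : g ∈ Ioo (0 : ℝ) 1) (hlam : 0 < lam) (hcfl : lam * (M + L) ≤ 1) (hh : 0 < h) (n : ℕ) :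
    ∫⁻ x, ‖density V ρ₀ lam h (geomWeight g) n (cellIndex h x) - impactFun V ρ₀ lam h g n x‖ₑ
      ≤ ENNReal.ofReal (h * ((1 - g) / g)) * essVariation ρ₀ := by
  have s := schemeState hV h0 hg hlam hcfl hh n
  have tv := seqVariation_numImpact hV h0 hg hlam hcfl hh n
  have hg0 := hg.1
  have hg1 : 0 ≤ 1 - g := by linarith [hg.2]
  have h1 : HasSum (fun j => (1 - g) / g * |numImpact V ρ₀ lam h (geomWeight g) n (j + 1)
        - numImpact V ρ₀ lam h (geomWeight g) n j|)
      ((1 - g) / g * seqVariation (numImpact V ρ₀ lam h (geomWeight g) n)) :=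
    tv.1.hasSum.mul_left _
  have h2 := lintegral_cellIndex_ofReal hh (fun j => by positivity) h1
  calc _ ≤ _ := lintegral_mono fun x => ?_
    _ = _ := h2
    _ ≤ ENNReal.ofReal (h * ((1 - g) / g) * (essVariation ρ₀).toReal) :=
        ENNReal.ofReal_le_ofReal ?_
    _ = _ := ?_
  · rw [Real.enorm_eq_ofReal_abs, impactFun]
    refine ENNReal.ofReal_le_ofReal (le_of_eq ?_)
    have e := s.W_step (cellIndex h x)
    rw [abs_sub_comm (numImpact V ρ₀ lam h (geomWeight g) n (cellIndex h x + 1)),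
      ← abs_of_nonneg (by positivity : 0 ≤ (1 - g) / g), ← abs_mul]
    congr 1
    field_simp
    linear_combination -e
  · rw [← mul_assoc]
    have := tv.2
    gcongr
  · rw [ENNReal.ofReal_mul (by positivity), ENNReal.ofReal_toReal h0.tv_lt_top.ne]

end Scheme

/-! ### A comparison lemma for two coupled evolutions, one of which is discrete in time -/

/-- Within one time step the linear interpolation of A(t,n) and A(t,n+1) spreads the discrete jump
-τ Ju evenly over the step, so that it can cancel against the continuous contribution -∫ Jv. The
defect E is spent at most twice, before and after the jump. -/
theorem coupled_step_le {A Jv Ju : ℝ → ℕ → ℝ} {τ T E e₁ e₂ η S : ℝ} (hτ : 0 < τ)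
    (hE : 0 ≤ E) (he₂ : 0 ≤ e₂) (hη : 0 ≤ η)
    (hJv : ∀ n, IntervalIntegrable (fun s => Jv s n) volume 0 T)
    (hJu : ∀ n, IntervalIntegrable (fun s => Ju s n) volume 0 T)
    (ha : ∀ n a b, 0 ≤ a → a ≤ b → b ≤ T → A b n ≤ A a n - (∫ s in a..b, Jv s n) + E)
    (hb : ∀ n t, 0 ≤ t → t ≤ T → A t (n + 1) ≤ A t n - τ * Ju t n)
    (hc : ∀ n t, 0 ≤ t → t ≤ T → -(Jv t n + Ju t n) ≤ e₁ + η * A t n)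
    (hd : ∀ n t, 0 ≤ t → t ≤ T → |Jv t (n + 1) - Jv t n| ≤ e₂)
    (hS : ∀ s, 0 ≤ s → s ≤ T → A s ⌊s / τ⌋₊ ≤ S) (n : ℕ) {t : ℝ} (hnt : n * τ ≤ t)
    (htn : t ≤ (n + 1) * τ) (htT : t ≤ T) :
    (1 - (t - n * τ) / τ) * A t n + (t - n * τ) / τ * A t (n + 1)
      ≤ A (n * τ) n + (t - n * τ) * (e₁ + η * S + e₂) + 2 * E := by
  set a : ℝ := n * τ with hadef
  have ha0 : 0 ≤ a := by positivity
  have ht0 : 0 ≤ t := ha0.trans hnt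
  set α : ℝ := (t - a) / τ with hα
  have hατ : α * τ = t - a := div_mul_cancel₀ _ hτ.ne'
  have hα0 : 0 ≤ α := div_nonneg (by linarith) hτ.le
  have hα1 : α ≤ 1 := by rw [hα, div_le_one hτ]; linarith
  have sub : ∀ {f : ℝ → ℝ}, IntervalIntegrable f volume 0 T → ∀ b c, 0 ≤ b → b ≤ T → 0 ≤ c → c ≤ T →
      IntervalIntegrable f volume b c := fun hf b c hb0 hbT hc0 hcT =>
    hf.mono_set (by
      rw [uIcc_of_le (hb0.trans hbT)]
      exact uIcc_subset_Icc ⟨hb0, hbT⟩ ⟨hc0, hcT⟩)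
  have haT : a ≤ T := hnt.trans htT
  -- The jump may be performed at any intermediate time s: evolve at level n up to s, jump, then
  -- evolve at level n+1. Replacing Jv(·, n+1) by Jv(·, n) after the jump costs τ e₂.
  have chain : ∀ s ∈ Icc a t, A t (n + 1)
      ≤ A a n - (∫ z in a..t, Jv z n) - τ * Ju s n + τ * e₂ + 2 * E := by
    intro s hs
    have hs0 : 0 ≤ s := ha0.trans hs.1
    have hsT : s ≤ T := hs.2.trans htT
    have h1 := ha (n + 1) s t hs0 hs.2 htT
    have h2 := hb n s hs0 hsT
    have h3 := ha n a s ha0 hs.1 hsT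
    have h4 : (∫ z in s..t, Jv z n) - (∫ z in s..t, Jv z (n + 1)) ≤ τ * e₂ := by
      rw [← intervalIntegral.integral_sub (sub (hJv n) _ _ hs0 hsT ht0 htT)
        (sub (hJv (n + 1)) _ _ hs0 hsT ht0 htT)]
      calc _ ≤ ∫ _z in s..t, e₂ := intervalIntegral.integral_mono_on hs.2
            ((sub (hJv n) _ _ hs0 hsT ht0 htT).sub (sub (hJv (n + 1)) _ _ hs0 hsT ht0 htT))
            (by simp) (fun z hz => by
              have := hd n z (hs0.trans hz.1) (hz.2.trans htT)
              linarith [neg_abs_le (Jv z (n + 1) - Jv z n)])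
        _ = (t - s) * e₂ := by simp
        _ ≤ τ * e₂ := mul_le_mul_of_nonneg_right (by linarith [hs.1]) he₂
    have h5 := intervalIntegral.integral_add_adjacent_intervals
      (sub (hJv n) a s ha0 haT hs0 hsT) (sub (hJv n) s t hs0 hsT ht0 htT)
    linarith
  -- Averaging over s turns the single value Ju(s) into the integral of Ju over the same interval as
  -- that of Jv.
  have hint : (t - a) * A t (n + 1) ≤ (t - a) * (A a n - (∫ z in a..t, Jv z n) + τ * e₂ + 2 * E)
      - τ * ∫ z in a..t, Ju z n := by
    have hJut := sub (hJu n) a t ha0 haT ht0 htT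
    have h1 : ∫ _z in a..t, A t (n + 1) ≤ ∫ z in a..t,
        ((A a n - (∫ z in a..t, Jv z n) + τ * e₂ + 2 * E) - τ * Ju z n) :=
      intervalIntegral.integral_mono_on hnt (by simp) ((by simp : IntervalIntegrable _ _ _ _).sub
        (hJut.const_mul τ)) (fun s hs => by linarith [chain s hs])
    rw [intervalIntegral.integral_sub (by simp) (hJut.const_mul τ),
      intervalIntegral.integral_const_mul] at h1
    rwa [intervalIntegral.integral_const, intervalIntegral.integral_const, smul_eq_mul,
      smul_eq_mul] at h1
  have hsum : -((∫ z in a..t, Jv z n) + ∫ z in a..t, Ju z n) ≤ (t - a) * (e₁ + η * S) := by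
    have hJvt := sub (hJv n) a t ha0 haT ht0 htT
    have hJut := sub (hJu n) a t ha0 haT ht0 htT
    rw [← intervalIntegral.integral_add hJvt hJut, ← intervalIntegral.integral_neg]
    calc _ ≤ ∫ _z in a..t, (e₁ + η * S) := by
          refine intervalIntegral.integral_mono_on_of_le_Ioo hnt (hJvt.add hJut).neg (by simp)
            (fun s hs => ?_)
          have hs0 : 0 ≤ s := ha0.trans hs.1.le
          have hsT : s ≤ T := hs.2.le.trans htT
          have hfl : ⌊s / τ⌋₊ = n := by
            rw [Nat.floor_eq_iff (by positivity), le_div_iff₀ hτ, div_lt_iff₀ hτ]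
            exact ⟨hs.1.le, hs.2.trans_le htn⟩
          have h1 := hS s hs0 hsT
          rw [hfl] at h1
          have h2 := mul_le_mul_of_nonneg_left h1 hη
          linarith [hc n s hs0 hsT]
      _ = _ := by rw [intervalIntegral.integral_const, smul_eq_mul]
  have h1 : α * A t (n + 1) ≤ α * (A a n - (∫ z in a..t, Jv z n) + τ * e₂ + 2 * E)
      - ∫ z in a..t, Ju z n := by
    rw [← hατ] at hint
    have : τ * (α * A t (n + 1)) ≤ τ * (α * (A a n - (∫ z in a..t, Jv z n) + τ * e₂ + 2 * E)
      - ∫ z in a..t, Ju z n) := by linarith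
    exact le_of_mul_le_mul_left this hτ
  have h2 := mul_le_mul_of_nonneg_left (ha n a t ha0 hnt htT) (by linarith : 0 ≤ 1 - α)
  have h3 : α * (τ * e₂) = (t - a) * e₂ := by rw [← hατ]; ring
  have h4 : (1 - α) * E ≤ (1 - α) * (2 * E) := mul_le_mul_of_nonneg_left (by linarith) (by linarith)
  linarith

/-- In place of Grönwall's lemma, the term η A is estimated by η times the supremum S along the
diagonal n = ⌊t/τ⌋ and absorbed on the left, which needs η T ≤ 1. The crude bound C serves only to
make S finite. -/
theorem coupled_le {A Jv Ju : ℝ → ℕ → ℝ} {τ T E e₁ e₂ e₃ η C : ℝ} (hτ : 0 < τ) (hT : 0 ≤ T)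
    (hE : 0 ≤ E) (he₁ : 0 ≤ e₁) (he₂ : 0 ≤ e₂) (hη : 0 ≤ η) (hηT : η * T ≤ 1)
    (hJv : ∀ n, IntervalIntegrable (fun s => Jv s n) volume 0 T)
    (hJu : ∀ n, IntervalIntegrable (fun s => Ju s n) volume 0 T)
    (ha : ∀ n a b, 0 ≤ a → a ≤ b → b ≤ T → A b n ≤ A a n - (∫ s in a..b, Jv s n) + E)
    (hb : ∀ n t, 0 ≤ t → t ≤ T → A t (n + 1) ≤ A t n - τ * Ju t n)
    (hc : ∀ n t, 0 ≤ t → t ≤ T → -(Jv t n + Ju t n) ≤ e₁ + η * A t n)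
    (hd : ∀ n t, 0 ≤ t → t ≤ T → |Jv t (n + 1) - Jv t n| ≤ e₂)
    (he : ∀ n t, 0 ≤ t → t ≤ T → A t n ≤ A t (n + 1) + e₃) (he₃ : 0 ≤ e₃)
    (hA : ∀ n t, 0 ≤ t → t ≤ T → 0 ≤ A t n) (hAC : ∀ n t, 0 ≤ t → t ≤ T → A t n ≤ C)
    {t : ℝ} (ht0 : 0 ≤ t) (htT : t ≤ T) :
    A t ⌊t / τ⌋₊ * (1 - η * T) ≤ A 0 0 + T * (e₁ + e₂) + 2 * (T / τ + 1) * E + e₃ := by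
  set I : Set ℝ := (fun s => A s ⌊s / τ⌋₊) '' Icc 0 T with hI
  have hbdd : BddAbove I := ⟨C, by
    rintro _ ⟨s, hs, rfl⟩
    exact hAC _ s hs.1 hs.2⟩
  have hne : I.Nonempty := ⟨_, 0, ⟨le_rfl, hT⟩, rfl⟩
  set S := sSup I with hSdef
  have hS : ∀ s, 0 ≤ s → s ≤ T → A s ⌊s / τ⌋₊ ≤ S := fun s h0 h1 =>
    le_csSup hbdd ⟨s, ⟨h0, h1⟩, rfl⟩
  have hS0 : 0 ≤ S := (hA _ 0 le_rfl hT).trans (hS 0 le_rfl hT)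
  have hstep := fun (n : ℕ) (t : ℝ) => coupled_step_le (t := t) hτ hE he₂ hη hJv hJu ha hb hc hd hS n
  set G := e₁ + η * S + e₂ with hG
  have hG0 : 0 ≤ G := by positivity
  -- At grid times the interpolation is A(·, n+1) alone, so the steps chain.
  have hgrid : ∀ n : ℕ, n * τ ≤ T → A (n * τ) n ≤ A 0 0 + n * τ * G + 2 * n * E := by
    intro n
    induction n with
    | zero => intro _; simp
    | succ n ih =>
      intro hn
      push_cast at hn ⊢
      have h1 := ih (by linarith)
      have h2 := hstep n ((n + 1) * τ) (by linarith) le_rfl hn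
      rw [show ((n : ℝ) + 1) * τ - n * τ = τ by ring, div_self hτ.ne'] at h2
      linarith
  have hpt : ∀ s, 0 ≤ s → s ≤ T → A s ⌊s / τ⌋₊ ≤ A 0 0 + T * G + 2 * (T / τ + 1) * E + e₃ := by
    intro s hs0 hsT
    set n := ⌊s / τ⌋₊ with hn
    have hn1 : (n : ℝ) ≤ s / τ := Nat.floor_le (by positivity)
    have hn2 : s / τ < n + 1 := Nat.lt_floor_add_one _
    have hn1' : n * τ ≤ s := (le_div_iff₀ hτ).1 hn1
    have hn2' : s ≤ (n + 1) * τ := ((div_lt_iff₀ hτ).1 hn2).le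
    have h1 := hstep n s hn1' hn2' hsT
    have h2 := hgrid n (hn1'.trans hsT)
    have h3 := he n s hs0 hsT
    set α := (s - n * τ) / τ with hα
    have hα0 : 0 ≤ α := div_nonneg (by linarith) hτ.le
    have hα1 : α ≤ 1 := by rw [hα, div_le_one hτ]; linarith
    -- Between grid times, A(s,n) is recovered from the interpolation at the cost of one jump e₃.
    have h4 : α * A s n ≤ α * (A s (n + 1) + e₃) := mul_le_mul_of_nonneg_left h3 hα0
    have h5 : α * e₃ ≤ e₃ := mul_le_of_le_one_left he₃ hα1
    have h6 : (n : ℝ) ≤ T / τ := hn1.trans (by gcongr)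
    have h7 : 2 * n * E ≤ 2 * (T / τ) * E := by gcongr
    have h8 : s * G ≤ T * G := by gcongr
    linarith
  have hSle : S ≤ A 0 0 + T * G + 2 * (T / τ + 1) * E + e₃ := by
    refine csSup_le hne ?_
    rintro _ ⟨s, hs, rfl⟩
    exact hpt s hs.1 hs.2
  have h9 := mul_le_mul_of_nonneg_right (hS t ht0 htT) (by linarith : 0 ≤ 1 - η * T)
  rw [hG] at hSle
  linarith

/-! ### Mollifiers and finite differences -/

/-- A continuously differentiable mollifier supported in `[-r,r]` whose derivative has `L¹` norm at
most `a`. -/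
structure IsMollifier (ω : ℝ → ℝ) (r a : ℝ) : Prop where
  contDiff : ContDiff ℝ 1 ω
  hasCompactSupport : HasCompactSupport ω
  nonneg : ∀ x, 0 ≤ ω x
  integral_eq : ∫ x, ω x = 1
  eq_zero : ∀ x, r < |x| → ω x = 0
  integral_deriv_le : ∫ x, |deriv ω x| ≤ a

/-- Rescaling of one bump. That c does not depend on r permits optimizing r at the end. -/
theorem exists_mollifier : ∃ c : ℝ, 0 ≤ c ∧ ∀ r : ℝ, 0 < r → ∃ ω, IsMollifier ω r (c / r) := by
  let b : ContDiffBump (0 : ℝ) := ⟨1 / 2, 1, by norm_num, by norm_num⟩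
  set f : ℝ → ℝ := b.normed volume with hf
  have hfc : ContDiff ℝ 1 f := b.contDiff_normed
  have hfs : HasCompactSupport f := b.hasCompactSupport_normed
  refine ⟨∫ x, |deriv f x|, integral_nonneg fun _ => abs_nonneg _, fun r hr => ?_⟩
  have hd : ∀ x, deriv (fun x => r⁻¹ * f (x / r)) x = r⁻¹ * (deriv f (x / r) * r⁻¹) := by
    intro x
    have h1 : HasDerivAt (fun x : ℝ => x / r) (r⁻¹) x := by
      simpa [div_eq_mul_inv] using (hasDerivAt_id x).mul_const r⁻¹
    have h2 : HasDerivAt f (deriv f (x / r)) (x / r) :=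
      (hfc.differentiable one_ne_zero _).hasDerivAt
    exact ((h2.comp x h1).const_mul r⁻¹).deriv
  refine ⟨fun x => r⁻¹ * f (x / r), ?_, ?_, ?_, ?_, ?_, ?_⟩
  · fun_prop
  · have : HasCompactSupport (fun x => f (x / r)) := by
      have := hfs.comp_homeomorph (Homeomorph.mulRight₀ r⁻¹ (inv_ne_zero hr.ne'))
      exact this
    exact this.mul_left
  · intro x
    exact mul_nonneg (by positivity) (b.nonneg_normed _)
  · rw [integral_const_mul, Measure.integral_comp_div, abs_of_pos hr, smul_eq_mul, hf,
      b.integral_normed]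
    field_simp
  · intro x hx
    have : x / r ∉ Function.support f := by
      rw [hf, b.support_normed_eq, Metric.mem_ball, dist_zero_right, Real.norm_eq_abs, abs_div,
        abs_of_pos hr, not_lt]
      change 1 ≤ |x| / r
      rw [one_le_div hr]
      exact hx.le
    rw [Function.notMem_support] at this
    simp only [this, mul_zero]
  · refine le_of_eq ?_
    simp_rw [hd, abs_mul, abs_of_pos (inv_pos.2 hr)]
    rw [integral_const_mul, integral_mul_const, Measure.integral_comp_div (fun x => |deriv f x|),
      abs_of_pos hr, smul_eq_mul]
    field_simp

theorem continuous_deriv_of_contDiff {Φ : ℝ → ℝ} (hΦ : ContDiff ℝ 1 Φ) : Continuous (deriv Φ) :=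
  hΦ.continuous_deriv le_rfl

theorem integrable_deriv_of_contDiff {Φ : ℝ → ℝ} (hΦ : ContDiff ℝ 1 Φ)
    (hs : HasCompactSupport Φ) : Integrable (deriv Φ) :=
  (continuous_deriv_of_contDiff hΦ).integrable_of_hasCompactSupport hs.deriv

theorem integrable_shift_mul_deriv {Q Φ : ℝ → ℝ} {C h : ℝ} (hQ : Measurable Q)
    (hQC : ∀ x, |Q x| ≤ C) (hΦ : ContDiff ℝ 1 Φ) (hs : HasCompactSupport Φ) :
    Integrable (fun p : ℝ × ℝ => Q p.1 * deriv Φ (p.1 - p.2))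
      (volume.prod (volume.restrict (Ioc 0 h))) := by
  have h1 : Integrable (fun p : ℝ × ℝ => (ContinuousLinearMap.mul ℝ ℝ) ((fun _ => (1 : ℝ)) p.2)
      (deriv Φ (p.1 - p.2))) (volume.prod (volume.restrict (Ioc 0 h))) :=
    Integrable.convolution_integrand _ (integrable_const 1) (integrable_deriv_of_contDiff hΦ hs)
  simp only [ContinuousLinearMap.mul_apply', one_mul] at h1
  exact h1.bdd_mul (hQ.comp measurable_fst).aestronglyMeasurable
    (Eventually.of_forall fun p => hQC p.1)

/-- Move the shift onto Φ and write Φ(x) - Φ(x-h) as an integral of Φ'. This summation by parts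
requires no regularity of Q. -/
theorem neg_integral_shift_sub_mul {Q Φ : ℝ → ℝ} {C h : ℝ} (hh : 0 ≤ h) (hQ : Measurable Q)
    (hQC : ∀ x, |Q x| ≤ C) (hΦ : ContDiff ℝ 1 Φ) (hs : HasCompactSupport Φ) :
    -∫ x, (Q (x + h) - Q x) * Φ x = ∫ s in 0..h, ∫ x, Q (x + s) * deriv Φ x := by
  have hΦi : Integrable Φ := hΦ.continuous.integrable_of_hasCompactSupport hs
  have hi1 : Integrable (fun x => Q (x + h) * Φ x) :=
    hΦi.bdd_mul (hQ.comp (measurable_id.add_const h)).aestronglyMeasurable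
      (Eventually.of_forall fun x => hQC _)
  have hi2 : Integrable (fun x => Q x * Φ x) :=
    hΦi.bdd_mul hQ.aestronglyMeasurable (Eventually.of_forall fun x => hQC _)
  have hi3 : Integrable (fun x => Q x * Φ (x - h)) :=
    (hΦi.comp_sub_right h).bdd_mul hQ.aestronglyMeasurable (Eventually.of_forall fun x => hQC _)
  have e1 : ∫ x, Q (x + h) * Φ x = ∫ x, Q x * Φ (x - h) := by
    rw [← integral_add_right_eq_self (fun x => Q x * Φ (x - h)) h]
    simp
  have e2 : ∀ s, ∫ x, Q (x + s) * deriv Φ x = ∫ x, Q x * deriv Φ (x - s) := fun s => by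
    rw [← integral_add_right_eq_self (fun x => Q x * deriv Φ (x - s)) s]
    simp
  simp_rw [e2, sub_mul]
  rw [integral_sub hi1 hi2, e1, neg_sub, ← integral_sub hi2 hi3, intervalIntegral.integral_of_le hh,
    ← integral_integral_swap (f := fun x s => Q x * deriv Φ (x - s))
      (integrable_shift_mul_deriv hQ hQC hΦ hs)]
  refine integral_congr_ae (Eventually.of_forall fun x => ?_)
  simp only
  rw [integral_const_mul, ← mul_sub, ← intervalIntegral.integral_of_le hh]
  congr 1
  rw [intervalIntegral.integral_comp_sub_left (fun z => deriv Φ z) x, sub_zero,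
    intervalIntegral.integral_deriv_eq_sub (fun z _ => hΦ.differentiable one_ne_zero z)
      ((continuous_deriv_of_contDiff hΦ).intervalIntegrable _ _)]

/-- The finite difference tested with Φ is an average over shifts s in [0,h] of Q(·+s) tested with
Φ'. This is why `IsApproximation.close` asks for closeness of every shifted flux to the same
unshifted value. -/
theorem neg_integral_shift_le {Q q m Φ : ℝ → ℝ} {C C' h : ℝ} (hh : 0 < h) (hQ : Measurable Q)
    (hQC : ∀ x, |Q x| ≤ C) (hq : Measurable q) (hqC : ∀ x, |q x| ≤ C')
    (hm : Integrable m) (hclose : ∀ x, ∀ s ∈ Icc 0 h, |Q (x + s) - q x| ≤ m x)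
    (hΦ : ContDiff ℝ 1 Φ) (hs : HasCompactSupport Φ) :
    -(1 / h * ∫ x, (Q (x + h) - Q x) * Φ x) ≤
      (∫ x, q x * deriv Φ x) + ∫ x, m x * |deriv Φ x| := by
  have hΦ' := integrable_deriv_of_contDiff hΦ hs
  obtain ⟨K, hK⟩ := (continuous_deriv_of_contDiff hΦ).bounded_above_of_compact_support hs.deriv
  have hi1 : Integrable (fun x => q x * deriv Φ x) :=
    hΦ'.bdd_mul hq.aestronglyMeasurable (Eventually.of_forall hqC)
  have hi2 : Integrable (fun x => m x * |deriv Φ x|) :=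
    hm.mul_bdd hΦ'.abs.aestronglyMeasurable
      (Eventually.of_forall fun x => by rw [Real.norm_eq_abs, abs_abs]; exact hK x)
  have hi3 : ∀ s, Integrable (fun x => Q (x + s) * deriv Φ x) := fun s =>
    hΦ'.bdd_mul (hQ.comp (measurable_id.add_const s)).aestronglyMeasurable
      (Eventually.of_forall fun x => hQC _)
  have key : ∀ s ∈ Icc 0 h, ∫ x, Q (x + s) * deriv Φ x ≤
      (∫ x, q x * deriv Φ x) + ∫ x, m x * |deriv Φ x| := by
    intro s hs
    rw [← integral_add hi1 hi2]
    refine integral_mono (hi3 s) (hi1.add hi2) fun x => ?_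
    have h1 := mul_le_mul_of_nonneg_right (hclose x s hs) (abs_nonneg (deriv Φ x))
    rw [← abs_mul, sub_mul] at h1
    simp only
    linarith [le_abs_self (Q (x + s) * deriv Φ x - q x * deriv Φ x)]
  have e2 : ∀ s, ∫ x, Q (x + s) * deriv Φ x = ∫ x, Q x * deriv Φ (x - s) := fun s => by
    rw [← integral_add_right_eq_self (fun x => Q x * deriv Φ (x - s)) s]
    simp
  have hint : IntervalIntegrable (fun s => ∫ x, Q (x + s) * deriv Φ x) volume 0 h := by
    simp_rw [e2]
    rw [intervalIntegrable_iff_integrableOn_Ioc_of_le hh.le]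
    exact (integrable_shift_mul_deriv hQ hQC hΦ hs).integral_prod_right
  have h2 := intervalIntegral.integral_mono_on hh.le hint (by simp) key
  rw [← neg_integral_shift_sub_mul hh.le hQ hQC hΦ hs, intervalIntegral.integral_const,
    smul_eq_mul, sub_zero] at h2
  rw [← mul_neg, one_div, inv_mul_le_iff₀ hh]
  exact h2

/-! ### Doubling of the space variable -/

/-- A smooth integrable weight with `|w'| ≤ δ w`. -/
def weight (δ x : ℝ) : ℝ := (1 + (δ * x) ^ 2)⁻¹

theorem weight_pos (δ x : ℝ) : 0 < weight δ x := by unfold weight; positivity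

theorem weight_le_one (δ x : ℝ) : weight δ x ≤ 1 :=
  inv_le_one_of_one_le₀ (by nlinarith [sq_nonneg (δ * x)])

theorem contDiff_weight (δ : ℝ) : ContDiff ℝ 1 (weight δ) := by
  unfold weight
  exact ContDiff.inv (by fun_prop) (fun x => by positivity)

theorem abs_deriv_weight_le {δ : ℝ} (hδ : 0 ≤ δ) (x : ℝ) :
    |deriv (weight δ) x| ≤ δ * weight δ x := by
  have hpos : (0 : ℝ) < 1 + (δ * x) ^ 2 := by positivity
  have h1 : HasDerivAt (fun x : ℝ => 1 + (δ * x) ^ 2) (2 * (δ * x) * δ) x := by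
    have := (((hasDerivAt_id x).const_mul δ).pow 2).const_add 1
    simpa using this
  have h2 := (h1.inv hpos.ne').deriv
  have h3 : deriv (weight δ) x = -(2 * (δ * x) * δ) / (1 + (δ * x) ^ 2) ^ 2 := h2
  rw [h3, weight, abs_div, abs_neg, abs_of_pos (by positivity : (0 : ℝ) < (1 + (δ * x) ^ 2) ^ 2),
    abs_mul, abs_of_nonneg hδ, div_le_iff₀ (by positivity)]
  have h4 : |2 * (δ * x)| ≤ 1 + (δ * x) ^ 2 := by
    rw [abs_le]; constructor <;> nlinarith [sq_nonneg (δ * x - 1), sq_nonneg (δ * x + 1)]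
  calc |2 * (δ * x)| * δ ≤ (1 + (δ * x) ^ 2) * δ := by gcongr
    _ = δ * (1 + (δ * x) ^ 2)⁻¹ * (1 + (δ * x) ^ 2) ^ 2 := by field_simp

theorem integrable_weight {δ : ℝ} (hδ : 0 < δ) : Integrable (weight δ) :=
  integrable_inv_one_add_sq.comp_mul_left' hδ.ne'

/-- The regularity of the functions to which a numerical solution is compared. -/
structure IsTimeFamily (v : ℝ → ℝ → ℝ) : Prop where
  aestronglyMeasurable :
    AEStronglyMeasurable (fun z : ℝ × ℝ => v z.1 z.2) ((volume.restrict (Ioi 0)).prod volume)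
  slice : ∀ t, 0 ≤ t → AEStronglyMeasurable (v t) volume
  mem : ∀ t x, v t x ∈ Icc (0 : ℝ) 1

/-- A weight in one variable suffices for integrability on the plane, since the kernel couples the
other variable to it. -/
theorem integrable_kernel {k w : ℝ → ℝ} (hk : Integrable k) (hw : Integrable w) :
    Integrable (fun p : ℝ × ℝ => k (p.1 - p.2) * w p.1) (volume.prod volume) := by
  have h1 := (Integrable.convolution_integrand (ContinuousLinearMap.mul ℝ ℝ) hw hk.comp_neg).swap
  refine h1.congr (Eventually.of_forall fun p => ?_)
  simp only [Function.comp, ContinuousLinearMap.mul_apply', Prod.fst_swap, Prod.snd_swap, neg_sub]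
  ring

theorem integral_kernel {k w : ℝ → ℝ} (hk : Integrable k) (hw : Integrable w) :
    ∫ p : ℝ × ℝ, k (p.1 - p.2) * w p.1 ∂(volume.prod volume) = (∫ x, k x) * ∫ x, w x := by
  rw [integral_prod _ (integrable_kernel hk hw)]
  simp only
  simp_rw [integral_mul_const, integral_sub_left_eq_self k, integral_const_mul]

/-! ### Integrals over slices and over space-time -/

section Family

variable {v : ℝ → ℝ → ℝ} {Φ : ℝ → ℝ → ℝ} {C : ℝ} {K : ℝ × ℝ → ℝ}

theorem IsTimeFamily.integrable_slice (hv : IsTimeFamily v) {t : ℝ} (ht : 0 ≤ t)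
    (hΦ : Measurable (fun p : ℝ × ℝ => Φ p.1 p.2)) (hC : ∀ c ∈ Icc (0 : ℝ) 1, ∀ x, |Φ c x| ≤ C)
    (hK : Integrable K (volume.prod volume)) :
    Integrable (fun p : ℝ × ℝ => Φ (v t p.2) p.1 * K p) (volume.prod volume) := by
  refine hK.bdd_mul ?_ (Eventually.of_forall fun p => hC _ (hv.mem _ _) _)
  have h1 : AEMeasurable (fun p : ℝ × ℝ => (v t p.2, p.1)) (volume.prod volume) :=
    ((hv.slice t ht).comp_snd).aemeasurable.prodMk measurable_fst.aemeasurable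
  exact (hΦ.comp_aemeasurable h1).aestronglyMeasurable

theorem IsTimeFamily.restrict (hv : IsTimeFamily v) {a b : ℝ} (ha : 0 ≤ a) :
    AEStronglyMeasurable (fun z : ℝ × ℝ => v z.1 z.2)
      ((volume.restrict (Ioc a b)).prod volume) := by
  refine hv.aestronglyMeasurable.mono_ac
    (Measure.AbsolutelyContinuous.prod ?_ Measure.AbsolutelyContinuous.rfl)
  exact (Measure.restrict_mono (fun x hx => ha.trans_lt hx.1) le_rfl).absolutelyContinuous

theorem IsTimeFamily.integrable_spacetime (hv : IsTimeFamily v) {a b : ℝ} (ha : 0 ≤ a)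
    (hΦ : Measurable (fun p : ℝ × ℝ => Φ p.1 p.2)) (hC : ∀ c ∈ Icc (0 : ℝ) 1, ∀ x, |Φ c x| ≤ C)
    (hK : Integrable K (volume.prod volume)) :
    Integrable (fun z : ℝ × (ℝ × ℝ) => Φ (v z.1 z.2.2) z.2.1 * K z.2)
      ((volume.restrict (Ioc a b)).prod (volume.prod volume)) := by
  have hK' : Integrable (fun z : ℝ × (ℝ × ℝ) => K z.2)
      ((volume.restrict (Ioc a b)).prod (volume.prod volume)) := by
    simpa using (integrable_const (μ := volume.restrict (Ioc a b)) (1 : ℝ)).mul_prod hK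
  refine hK'.bdd_mul ?_ (Eventually.of_forall fun p => hC _ (hv.mem _ _) _)
  have hq : Measure.QuasiMeasurePreserving (fun z : ℝ × (ℝ × ℝ) => (z.1, z.2.2))
      ((volume.restrict (Ioc a b)).prod (volume.prod volume))
      ((volume.restrict (Ioc a b)).prod volume) :=
    QuasiMeasurePreserving.prodMap (Measure.QuasiMeasurePreserving.id _)
      Measure.quasiMeasurePreserving_snd
  have h1 : AEMeasurable (fun z : ℝ × (ℝ × ℝ) => (v z.1 z.2.2, z.2.1))
      ((volume.restrict (Ioc a b)).prod (volume.prod volume)) :=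
    ((hv.restrict ha).comp_quasiMeasurePreserving hq).aemeasurable.prodMk
      (measurable_fst.comp measurable_snd).aemeasurable
  exact (hΦ.comp_aemeasurable h1).aestronglyMeasurable

theorem IsTimeFamily.intervalIntegrable (hv : IsTimeFamily v) {T : ℝ} (hT : 0 ≤ T)
    (hΦ : Measurable (fun p : ℝ × ℝ => Φ p.1 p.2)) (hC : ∀ c ∈ Icc (0 : ℝ) 1, ∀ x, |Φ c x| ≤ C)
    (hK : Integrable K (volume.prod volume)) :
    IntervalIntegrable (fun s => ∫ p : ℝ × ℝ, Φ (v s p.2) p.1 * K p ∂(volume.prod volume))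
      volume 0 T := by
  rw [intervalIntegrable_iff_integrableOn_Ioc_of_le hT]
  exact (hv.integrable_spacetime le_rfl hΦ hC hK).integral_prod_left

/-- Fubini for the order x, s, y. It is needed since the entropy inequality of v is available for
each fixed x, with its own time integral inside. -/
theorem integral_triple {μ : Measure ℝ} [SFinite μ] {H : ℝ × (ℝ × ℝ) → ℝ}
    (hH : Integrable H (μ.prod (volume.prod volume))) :
    Integrable (fun x => ∫ s, (∫ y, H (s, (x, y))) ∂μ) ∧
    ∫ x, ∫ s, (∫ y, H (s, (x, y))) ∂μ = ∫ s, (∫ p, H (s, p) ∂(volume.prod volume)) ∂μ := by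
  have hmp := measurePreserving_prodAssoc μ (volume : Measure ℝ) (volume : Measure ℝ)
  have h1 : Integrable (fun z : (ℝ × ℝ) × ℝ => H (z.1.1, (z.1.2, z.2)))
      ((μ.prod volume).prod volume) :=
    (hmp.integrable_comp_emb (MeasurableEquiv.measurableEmbedding _)).2 hH
  have h2 : Integrable (fun z : ℝ × ℝ => ∫ y, H (z.1, (z.2, y))) (μ.prod volume) :=
    h1.integral_prod_left
  refine ⟨h2.integral_prod_right, ?_⟩
  rw [← integral_prod _ hH, ← hmp.integral_comp']
  refine Eq.trans ?_ (integral_prod (fun z : (ℝ × ℝ) × ℝ => H (z.1.1, (z.1.2, z.2))) h1).symm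
  exact (integral_prod_symm _ h2).symm

end Family

/-- The weighted, mollified `L¹` distance of `v(t,·)` and `u_n`. -/
def doubledDist (v : ℝ → ℝ → ℝ) (u : ℕ → ℝ → ℝ) (ω : ℝ → ℝ) (δ t : ℝ) (n : ℕ) : ℝ :=
  ∫ p : ℝ × ℝ, |v t p.2 - u n p.1| * (ω (p.1 - p.2) * weight δ p.1) ∂(volume.prod volume)

/-- The contribution of the evolution of `v` to the change of `doubledDist`. -/
def doubledFlux (q : ℝ → ℝ → ℝ) (v : ℝ → ℝ → ℝ) (u : ℕ → ℝ → ℝ) (ω : ℝ → ℝ) (δ t : ℝ) (n : ℕ) : ℝ :=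
  ∫ p : ℝ × ℝ, q (u n p.1) (v t p.2) * (deriv ω (p.1 - p.2) * weight δ p.1) ∂(volume.prod volume)

/-- The contribution of the evolution of `u` to the change of `doubledDist`. -/
def doubledJump (Q : ℕ → ℝ → ℝ → ℝ) (h : ℝ) (v : ℝ → ℝ → ℝ) (ω : ℝ → ℝ) (δ t : ℝ) (n : ℕ) : ℝ :=
  ∫ p : ℝ × ℝ, (1 / h * (Q n (v t p.2) (p.1 + h) - Q n (v t p.2) p.1))
    * (ω (p.1 - p.2) * weight δ p.1) ∂(volume.prod volume)

/-! ### Evolution of the doubled distance -/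

section Doubling

variable {q : ℝ → ℝ → ℝ} {F τ h D B S r a δ : ℝ} {u : ℕ → ℝ → ℝ} {Q : ℕ → ℝ → ℝ → ℝ}
  {m : ℕ → ℝ → ℝ} {v : ℝ → ℝ → ℝ} {ω : ℝ → ℝ}

theorem IsMollifier.integrable (hω : IsMollifier ω r a) : Integrable ω :=
  hω.contDiff.continuous.integrable_of_hasCompactSupport hω.hasCompactSupport

theorem IsMollifier.integrable_deriv (hω : IsMollifier ω r a) : Integrable (deriv ω) :=
  integrable_deriv_of_contDiff hω.contDiff hω.hasCompactSupport

theorem IsMollifier.bound_nonneg (hω : IsMollifier ω r a) : 0 ≤ a :=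
  (integral_nonneg fun _ => abs_nonneg _).trans hω.integral_deriv_le

theorem abs_sub_le_one {x y : ℝ} (hx : x ∈ Icc (0 : ℝ) 1) (hy : y ∈ Icc (0 : ℝ) 1) :
    |x - y| ≤ 1 := by
  rw [abs_le]; constructor <;> linarith [hx.1, hx.2, hy.1, hy.2]

theorem IsApproximation.measurable_dist (ap : IsApproximation q τ h D B S u Q m) (n : ℕ) :
    Measurable (fun p : ℝ × ℝ => |p.1 - u n p.2|) :=
  (measurable_fst.sub ((ap.measurable n).comp measurable_snd)).abs

theorem IsApproximation.dist_bound (ap : IsApproximation q τ h D B S u Q m) (n : ℕ) :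
    ∀ c ∈ Icc (0 : ℝ) 1, ∀ x, |(|c - u n x|)| ≤ 1 := fun c hc x => by
  rw [abs_abs]; exact abs_sub_le_one hc (ap.mem n x)

theorem IsApproximation.measurable_entropyFlux (hq : IsKruzkovFlux q F)
    (ap : IsApproximation q τ h D B S u Q m) (n : ℕ) :
    Measurable (fun p : ℝ × ℝ => q (u n p.2) p.1) :=
  hq.continuous.measurable.comp (((ap.measurable n).comp measurable_snd).prodMk measurable_fst)

theorem IsApproximation.entropyFlux_bound (hq : IsKruzkovFlux q F)
    (ap : IsApproximation q τ h D B S u Q m) (n : ℕ) :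
    ∀ c ∈ Icc (0 : ℝ) 1, ∀ x, |q (u n x) c| ≤ F := fun _ hc x => hq.abs_le_const (ap.mem n x) hc

theorem IsApproximation.measurable_jump (ap : IsApproximation q τ h D B S u Q m) (n : ℕ) :
    Measurable (fun p : ℝ × ℝ => 1 / h * (Q n p.1 (p.2 + h) - Q n p.1 p.2)) := by
  have h1 := ap.measurable_flux n
  have h2 : Measurable (fun p : ℝ × ℝ => Q n p.1 (p.2 + h)) :=
    h1.comp (measurable_fst.prodMk (measurable_snd.add_const h))
  exact (h2.sub h1).const_mul _

theorem IsApproximation.jump_bound (ap : IsApproximation q τ h D B S u Q m) :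
    ∃ C, ∀ n, ∀ c ∈ Icc (0 : ℝ) 1, ∀ x, |1 / h * (Q n c (x + h) - Q n c x)| ≤ C := by
  obtain ⟨C, hC⟩ := ap.flux_bound
  refine ⟨1 / h * (C + C), fun n c hc x => ?_⟩
  have hh := ap.h_pos
  rw [abs_mul, abs_of_pos (by positivity : 0 < 1 / h)]
  gcongr
  exact (abs_sub _ _).trans (add_le_add (hC n c hc _) (hC n c hc _))

theorem IsMollifier.integrable_weighted (hω : IsMollifier ω r a) (hδ : 0 < δ) :
    Integrable (fun p : ℝ × ℝ => ω (p.1 - p.2) * weight δ p.1) (volume.prod volume) :=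
  integrable_kernel hω.integrable (integrable_weight hδ)

theorem IsMollifier.integrable_deriv_weighted (hω : IsMollifier ω r a) (hδ : 0 < δ) :
    Integrable (fun p : ℝ × ℝ => deriv ω (p.1 - p.2) * weight δ p.1) (volume.prod volume) :=
  integrable_kernel hω.integrable_deriv (integrable_weight hδ)

theorem doubledDist_nonneg (hω : IsMollifier ω r a) (t : ℝ) (n : ℕ) :
    0 ≤ doubledDist v u ω δ t n :=
  integral_nonneg fun _ => mul_nonneg (abs_nonneg _) (mul_nonneg (hω.nonneg _) (weight_pos _ _).le)

theorem doubledDist_le (ap : IsApproximation q τ h D B S u Q m) (hv : IsTimeFamily v)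
    (hω : IsMollifier ω r a) (hδ : 0 < δ) {t : ℝ} (ht : 0 ≤ t) (n : ℕ) :
    doubledDist v u ω δ t n ≤ ∫ x, weight δ x := by
  have h1 := hv.integrable_slice ht (ap.measurable_dist n) (ap.dist_bound n)
    (hω.integrable_weighted hδ)
  have h2 := integral_mono h1 (hω.integrable_weighted hδ) fun p =>
    mul_le_of_le_one_left (mul_nonneg (hω.nonneg _) (weight_pos _ _).le)
      (abs_sub_le_one (hv.mem t p.2) (ap.mem n p.1))
  rwa [integral_kernel hω.integrable (integrable_weight hδ), hω.integral_eq, one_mul] at h2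

/-- The discrete entropy inequality with κ = v(t,y), integrated over both variables. -/
theorem doubledDist_succ_le (ap : IsApproximation q τ h D B S u Q m) (hv : IsTimeFamily v)
    (hω : IsMollifier ω r a) (hδ : 0 < δ) {t : ℝ} (ht : 0 ≤ t) (n : ℕ) :
    doubledDist v u ω δ t (n + 1)
      ≤ doubledDist v u ω δ t n - τ * doubledJump Q h v ω δ t n := by
  obtain ⟨C, hC⟩ := ap.jump_bound
  have hk := hω.integrable_weighted hδ
  have h1 := hv.integrable_slice ht (ap.measurable_dist n) (ap.dist_bound n) hk
  have h2 := hv.integrable_slice ht (ap.measurable_dist (n + 1)) (ap.dist_bound (n + 1)) hk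
  have h3 := hv.integrable_slice ht (ap.measurable_jump n) (hC n) hk
  rw [doubledDist, doubledDist, doubledJump, ← integral_const_mul,
    ← integral_sub h1 (h3.const_mul τ)]
  refine integral_mono h2 (h1.sub (h3.const_mul τ)) fun p => ?_
  have h4 := ap.entropy n (v t p.2) p.1
  have h5 := mul_le_mul_of_nonneg_right h4 (mul_nonneg (hω.nonneg (p.1 - p.2)) (weight_pos δ p.1).le)
  simp only
  rw [abs_sub_comm (v t p.2), abs_sub_comm (v t p.2)]
  refine h5.trans (le_of_eq ?_)
  ring

theorem integral_abs_time_le (ap : IsApproximation q τ h D B S u Q m) (n : ℕ) :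
    Integrable (fun x => |u (n + 1) x - u n x|) ∧ ∫ x, |u (n + 1) x - u n x| ≤ τ * S := by
  have hm : AEStronglyMeasurable (fun x => |u (n + 1) x - u n x|) volume :=
    ((ap.measurable (n + 1)).sub (ap.measurable n)).abs.aestronglyMeasurable
  have h1 := ap.time n
  simp_rw [Real.enorm_eq_ofReal_abs] at h1
  have hn : 0 ≤ᵐ[volume] (fun x => |u (n + 1) x - u n x|) :=
    Eventually.of_forall fun x => abs_nonneg _
  refine ⟨⟨hm, ?_⟩, ?_⟩
  · rw [hasFiniteIntegral_iff_ofReal hn]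
    exact h1.trans_lt ENNReal.ofReal_lt_top
  · rw [integral_eq_lintegral_of_nonneg_ae hn hm]
    exact ENNReal.toReal_le_of_le_ofReal (mul_nonneg ap.τ_pos.le ap.S_nonneg) h1

theorem doubledDist_le_succ (ap : IsApproximation q τ h D B S u Q m) (hv : IsTimeFamily v)
    (hω : IsMollifier ω r a) (hδ : 0 < δ) {t : ℝ} (ht : 0 ≤ t) (n : ℕ) :
    doubledDist v u ω δ t n ≤ doubledDist v u ω δ t (n + 1) + τ * S := by
  have hk := hω.integrable_weighted hδ
  have h1 := hv.integrable_slice ht (ap.measurable_dist n) (ap.dist_bound n) hk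
  have h2 := hv.integrable_slice ht (ap.measurable_dist (n + 1)) (ap.dist_bound (n + 1)) hk
  obtain ⟨h3, h4⟩ := integral_abs_time_le ap n
  have h5 := integrable_kernel hω.integrable h3
  have h6 := integral_kernel hω.integrable h3
  rw [hω.integral_eq, one_mul] at h6
  have h7 := integral_mono h1 (h2.add h5) fun p => ?_
  · rw [integral_add' h2 h5, h6] at h7
    exact h7.trans (add_le_add le_rfl h4)
  · have hw : 0 ≤ ω (p.1 - p.2) * weight δ p.1 := mul_nonneg (hω.nonneg _) (weight_pos _ _).le
    have hw1 : ω (p.1 - p.2) * weight δ p.1 ≤ ω (p.1 - p.2) :=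
      mul_le_of_le_one_right (hω.nonneg _) (weight_le_one _ _)
    have h8 : |v t p.2 - u n p.1| ≤ |v t p.2 - u (n + 1) p.1| + |u (n + 1) p.1 - u n p.1| :=
      abs_sub_le _ _ _
    have h9 := mul_le_mul_of_nonneg_right h8 hw
    have h10 := mul_le_mul_of_nonneg_left hw1 (abs_nonneg (u (n + 1) p.1 - u n p.1))
    simp only [Pi.add_apply]
    linarith

/-- By symmetry the entropy flux is Lipschitz in its u-argument too, so time regularity of u in L¹
suffices and none of v is used. -/
theorem abs_doubledFlux_succ_sub_le (hq : IsKruzkovFlux q F)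
    (ap : IsApproximation q τ h D B S u Q m) (hv : IsTimeFamily v)
    (hω : IsMollifier ω r a) (hδ : 0 < δ) {t : ℝ} (ht : 0 ≤ t) (n : ℕ) :
    |doubledFlux q v u ω δ t (n + 1) - doubledFlux q v u ω δ t n| ≤ F * (a * (τ * S)) := by
  have hk := hω.integrable_deriv_weighted hδ
  have h1 := hv.integrable_slice ht (ap.measurable_entropyFlux hq n) (ap.entropyFlux_bound hq n) hk
  have h2 := hv.integrable_slice ht (ap.measurable_entropyFlux hq (n + 1))
    (ap.entropyFlux_bound hq (n + 1)) hk
  obtain ⟨h3, h4⟩ := integral_abs_time_le ap n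
  have h5 := integrable_kernel hω.integrable_deriv.abs h3
  have h6 := integral_kernel hω.integrable_deriv.abs h3
  rw [doubledFlux, doubledFlux, ← integral_sub h2 h1]
  refine abs_integral_le_integral_abs.trans ?_
  have h7 := integral_mono (h2.sub h1).abs (h5.const_mul F) fun p => ?_
  · refine h7.trans ?_
    rw [integral_const_mul, h6]
    refine mul_le_mul_of_nonneg_left ?_ hq.nonneg
    exact mul_le_mul hω.integral_deriv_le h4 (integral_nonneg fun _ => abs_nonneg _)
      hω.bound_nonneg
  · simp only [Pi.sub_apply]
    rw [← sub_mul, abs_mul, abs_mul, abs_of_pos (weight_pos δ p.1), hq.symm _ (v t p.2),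
      hq.symm _ (v t p.2)]
    have h8 := hq.lip _ (hv.mem t p.2) _ (ap.mem (n + 1) p.1) _ (ap.mem n p.1)
    have h9 : |deriv ω (p.1 - p.2)| * weight δ p.1 ≤ |deriv ω (p.1 - p.2)| :=
      mul_le_of_le_one_right (abs_nonneg _) (weight_le_one _ _)
    calc _ ≤ F * |u (n + 1) p.1 - u n p.1| * |deriv ω (p.1 - p.2)| :=
          mul_le_mul h8 h9 (mul_nonneg (abs_nonneg _) (weight_pos _ _).le)
            (mul_nonneg hq.nonneg (abs_nonneg _))
      _ = _ := by ring

/-- The heart of the doubling, for fixed y and κ. Testing the discrete flux with ω(x - y) w(x)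
produces ω' w, which cancels against the contribution of v. There remain the flux error, tested with
|ω'| + δ ω, and the term with w', which |w'| ≤ δ w turns into a multiple of the weighted distance.
-/
theorem neg_slice_flux_le (hq : IsKruzkovFlux q F) (ap : IsApproximation q τ h D B S u Q m)
    (hω : IsMollifier ω r a) (hδ : 0 < δ) (n : ℕ) {κ : ℝ} (hκ : κ ∈ Icc (0 : ℝ) 1) (y : ℝ) :
    -((∫ x, q (u n x) κ * (deriv ω (x - y) * weight δ x))
      + ∫ x, (1 / h * (Q n κ (x + h) - Q n κ x)) * (ω (x - y) * weight δ x)) ≤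
      (∫ x, |deriv ω (x - y)| * m n x) + δ * (∫ x, ω (x - y) * m n x)
        + F * δ * ∫ x, |κ - u n x| * (ω (x - y) * weight δ x) := by
  obtain ⟨C, hC⟩ := ap.flux_bound
  set Φ : ℝ → ℝ := fun x => ω (x - y) * weight δ x with hΦ
  have hωy : ContDiff ℝ 1 (fun x => ω (x - y)) := hω.contDiff.comp (by fun_prop)
  have hωs : HasCompactSupport (fun x => ω (x - y)) :=
    hω.hasCompactSupport.comp_homeomorph (Homeomorph.subRight y)
  have hΦc : ContDiff ℝ 1 Φ := hωy.mul (contDiff_weight δ)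
  have hΦs : HasCompactSupport Φ := hωs.mul_right
  have hd : ∀ x, deriv Φ x = deriv ω (x - y) * weight δ x + ω (x - y) * deriv (weight δ) x := by
    intro x
    have h1 : HasDerivAt (fun x => ω (x - y)) (deriv ω (x - y)) x :=
      ((hω.contDiff.differentiable one_ne_zero (x - y)).hasDerivAt).comp_sub_const x y
    have h2 : HasDerivAt (weight δ) (deriv (weight δ) x) x :=
      ((contDiff_weight δ).differentiable one_ne_zero x).hasDerivAt
    exact (h1.mul h2).deriv
  have hqm : Measurable (fun x => q κ (u n x)) :=
    hq.continuous.measurable.comp (measurable_const.prodMk (ap.measurable n))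
  have hqb : ∀ x, |q κ (u n x)| ≤ F := fun x => hq.abs_le_const hκ (ap.mem n x)
  have hQm : Measurable (Q n κ) := (ap.measurable_flux n).comp (measurable_const.prodMk measurable_id)
  have h1 := neg_integral_shift_le ap.h_pos hQm (hC n κ hκ) hqm hqb (ap.integrable_error n)
    (ap.close n κ hκ) hΦc hΦs
  have hm0 : ∀ x, 0 ≤ m n x := fun x =>
    (abs_nonneg _).trans (ap.close n κ hκ x 0 ⟨le_rfl, ap.h_pos.le⟩)
  have hωd := continuous_deriv_of_contDiff hω.contDiff
  have hwc : Continuous (weight δ) := (contDiff_weight δ).continuous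
  have hwd := continuous_deriv_of_contDiff (contDiff_weight δ)
  have hωc := hω.contDiff.continuous
  have hωds : HasCompactSupport (fun x => deriv ω (x - y)) :=
    hω.hasCompactSupport.deriv.comp_homeomorph (Homeomorph.subRight y)
  have i1 : Integrable (fun x => q κ (u n x) * (deriv ω (x - y) * weight δ x)) :=
    ((by fun_prop : Continuous (fun x => deriv ω (x - y) * weight δ x)).integrable_of_hasCompactSupport
      hωds.mul_right).bdd_mul hqm.aestronglyMeasurable (Eventually.of_forall hqb)
  have i2 : Integrable (fun x => q κ (u n x) * (ω (x - y) * deriv (weight δ) x)) :=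
    ((by fun_prop : Continuous (fun x => ω (x - y) * deriv (weight δ) x)).integrable_of_hasCompactSupport
      hωs.mul_right).bdd_mul hqm.aestronglyMeasurable (Eventually.of_forall hqb)
  have i3 : Integrable (fun x => |κ - u n x| * (ω (x - y) * weight δ x)) :=
    (hΦc.continuous.integrable_of_hasCompactSupport hΦs).bdd_mul
      ((measurable_const.sub (ap.measurable n)).abs.aestronglyMeasurable)
      (Eventually.of_forall fun x => ap.dist_bound n κ hκ x)
  obtain ⟨K₁, hK₁⟩ := hωc.bounded_above_of_compact_support hω.hasCompactSupport
  obtain ⟨K₂, hK₂⟩ := hωd.bounded_above_of_compact_support hω.hasCompactSupport.deriv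
  have i4 : Integrable (fun x => |deriv ω (x - y)| * m n x) :=
    (ap.integrable_error n).bdd_mul (by fun_prop : Continuous _).aestronglyMeasurable
      (Eventually.of_forall fun x => by rw [Real.norm_eq_abs, abs_abs]; exact hK₂ _)
  have i5 : Integrable (fun x => ω (x - y) * m n x) :=
    (ap.integrable_error n).bdd_mul (by fun_prop : Continuous _).aestronglyMeasurable
      (Eventually.of_forall fun x => hK₁ _)
  have e1 : ∫ x, q κ (u n x) * deriv Φ x = (∫ x, q (u n x) κ * (deriv ω (x - y) * weight δ x))
      + ∫ x, q κ (u n x) * (ω (x - y) * deriv (weight δ) x) := by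
    simp_rw [hq.symm _ κ]
    rw [← integral_add i1 i2]
    refine integral_congr_ae (Eventually.of_forall fun x => ?_)
    simp only [hd x]
    ring
  have e2 : ∫ x, (1 / h * (Q n κ (x + h) - Q n κ x)) * (ω (x - y) * weight δ x)
      = 1 / h * ∫ x, (Q n κ (x + h) - Q n κ x) * Φ x := by
    rw [← integral_const_mul]
    simp only [mul_assoc, hΦ]
  -- Here |q(κ, u)| ≤ F |κ - u| matters: the weight costs a multiple of the distance itself, not a
  -- constant.
  have b1 : ∫ x, q κ (u n x) * (ω (x - y) * deriv (weight δ) x)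
      ≤ F * δ * ∫ x, |κ - u n x| * (ω (x - y) * weight δ x) := by
    rw [← integral_const_mul]
    refine integral_mono i2 (i3.const_mul _) fun x => ?_
    refine (le_abs_self _).trans ?_
    rw [abs_mul, abs_mul, abs_of_nonneg (hω.nonneg _)]
    calc _ ≤ F * |κ - u n x| * (ω (x - y) * (δ * weight δ x)) :=
          mul_le_mul (hq.abs_le hκ (ap.mem n x))
            (mul_le_mul_of_nonneg_left (abs_deriv_weight_le hδ.le x) (hω.nonneg _))
            (mul_nonneg (hω.nonneg _) (abs_nonneg _)) (mul_nonneg hq.nonneg (abs_nonneg _))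
      _ = _ := by ring
  have b2 : ∫ x, m n x * |deriv Φ x| ≤
      (∫ x, |deriv ω (x - y)| * m n x) + δ * ∫ x, ω (x - y) * m n x := by
    rw [← integral_const_mul, ← integral_add i4 (i5.const_mul δ)]
    refine integral_mono_of_nonneg (Eventually.of_forall fun x => mul_nonneg (hm0 x) (abs_nonneg _))
      (i4.add (i5.const_mul δ)) (Eventually.of_forall fun x => ?_)
    have c1 : |deriv Φ x| ≤ |deriv ω (x - y)| + δ * ω (x - y) := by
      rw [hd x]
      refine (abs_add_le _ _).trans (add_le_add ?_ ?_)
      · rw [abs_mul, abs_of_pos (weight_pos _ _)]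
        exact mul_le_of_le_one_right (abs_nonneg _) (weight_le_one _ _)
      · rw [abs_mul, abs_of_nonneg (hω.nonneg _), mul_comm]
        refine mul_le_mul_of_nonneg_right ?_ (hω.nonneg _)
        exact (abs_deriv_weight_le hδ.le x).trans (mul_le_of_le_one_right hδ.le (weight_le_one _ _))
    have := mul_le_mul_of_nonneg_left c1 (hm0 x)
    simp only
    linarith
  rw [e2]
  linarith

theorem neg_doubledFlux_add_le (hq : IsKruzkovFlux q F) (ap : IsApproximation q τ h D B S u Q m)
    (hv : IsTimeFamily v) (hω : IsMollifier ω r a) (hδ : 0 < δ) {t : ℝ} (ht : 0 ≤ t) (n : ℕ) :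
    -(doubledFlux q v u ω δ t n + doubledJump Q h v ω δ t n) ≤
      (a + δ) * D + F * δ * doubledDist v u ω δ t n := by
  obtain ⟨C, hC⟩ := ap.jump_bound
  have hk := hω.integrable_weighted hδ
  have i1 := hv.integrable_slice ht (ap.measurable_entropyFlux hq n) (ap.entropyFlux_bound hq n)
    (hω.integrable_deriv_weighted hδ)
  have i2 := hv.integrable_slice ht (ap.measurable_jump n) (hC n) hk
  have i3 := hv.integrable_slice ht (ap.measurable_dist n) (ap.dist_bound n) hk
  have i4 := integrable_kernel hω.integrable_deriv.abs (ap.integrable_error n)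
  have i5 := integrable_kernel hω.integrable (ap.integrable_error n)
  have e4 := integral_kernel hω.integrable_deriv.abs (ap.integrable_error n)
  have e5 := integral_kernel hω.integrable (ap.integrable_error n)
  have hm0 : 0 ≤ ∫ x, m n x := integral_nonneg fun x =>
    (abs_nonneg _).trans (ap.close n 0 ⟨le_rfl, zero_le_one⟩ x 0 ⟨le_rfl, ap.h_pos.le⟩)
  have hmD := ap.integral_error_le n
  rw [hω.integral_eq, one_mul] at e5
  rw [integral_prod_symm _ i4] at e4
  rw [integral_prod_symm _ i5] at e5
  rw [doubledFlux, doubledJump, doubledDist, integral_prod_symm _ i1, integral_prod_symm _ i2,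
    integral_prod_symm _ i3, ← integral_add i1.integral_prod_right i2.integral_prod_right,
    ← integral_neg]
  have key := integral_mono (i1.integral_prod_right.add i2.integral_prod_right).neg
    ((i4.integral_prod_right.add (i5.integral_prod_right.const_mul δ)).add
      (i3.integral_prod_right.const_mul (F * δ)))
    (fun y => neg_slice_flux_le hq ap hω hδ n (hv.mem t y) y)
  refine key.trans ?_
  rw [integral_add' (i4.integral_prod_right.add (i5.integral_prod_right.const_mul δ))
      (i3.integral_prod_right.const_mul (F * δ)), integral_add' i4.integral_prod_right
      (i5.integral_prod_right.const_mul δ), integral_const_mul, integral_const_mul, e4, e5]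
  have b1 : (∫ x, |deriv ω x|) * ∫ x, m n x ≤ a * D :=
    mul_le_mul hω.integral_deriv_le hmD hm0 hω.bound_nonneg
  have b2 : δ * ∫ x, m n x ≤ δ * D := mul_le_mul_of_nonneg_left hmD hδ.le
  linarith

/-- The entropy inequality of v in the variable y with κ = u_n(x), multiplied by the weight and
integrated over x. -/
theorem doubledDist_evolution_le {T E : ℝ} (hq : IsKruzkovFlux q F)
    (ap : IsApproximation q τ h D B S u Q m)
    (hv : IsTimeFamily v) (hω : IsMollifier ω r a) (hδ : 0 < δ)
    (hvE : ∀ x, ∀ κ ∈ Icc (0 : ℝ) 1, ∀ b c, 0 ≤ b → b ≤ c → c ≤ T →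
      ∫ y, |v c y - κ| * ω (x - y) ≤ (∫ y, |v b y - κ| * ω (x - y))
        - (∫ s in b..c, ∫ y, q κ (v s y) * deriv ω (x - y)) + E)
    (n : ℕ) (b c : ℝ) (hb : 0 ≤ b) (hbc : b ≤ c) (hcT : c ≤ T) :
    doubledDist v u ω δ c n ≤ doubledDist v u ω δ b n
      - (∫ s in b..c, doubledFlux q v u ω δ s n) + E * ∫ x, weight δ x := by
  have hk := hω.integrable_weighted hδ
  have ib := hv.integrable_slice hb (ap.measurable_dist n) (ap.dist_bound n) hk
  have ic := hv.integrable_slice (hb.trans hbc) (ap.measurable_dist n) (ap.dist_bound n) hk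
  have is := hv.integrable_spacetime (b := c) hb (ap.measurable_entropyFlux hq n)
    (ap.entropyFlux_bound hq n) (hω.integrable_deriv_weighted hδ)
  obtain ⟨it, et⟩ := integral_triple is
  rw [doubledDist, doubledDist, integral_prod _ ib, integral_prod _ ic,
    intervalIntegral.integral_of_le hbc]
  simp only [doubledFlux]
  simp only at it et
  rw [← et]
  have key := integral_mono ic.integral_prod_left
    ((ib.integral_prod_left.sub it).add ((integrable_weight hδ).const_mul E)) fun x => ?_
  · rw [integral_add' (ib.integral_prod_left.sub it) ((integrable_weight hδ).const_mul E),
      integral_sub' ib.integral_prod_left it, integral_const_mul] at key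
    exact key
  have h1 := hvE x (u n x) (ap.mem n x) b c hb hbc hcT
  have h2 := mul_le_mul_of_nonneg_right h1 (weight_pos δ x).le
  rw [add_mul, sub_mul, intervalIntegral.integral_of_le hbc] at h2
  simp only [← integral_mul_const] at h2
  simpa only [mul_assoc, Pi.add_apply, Pi.sub_apply] using h2

theorem doubledDist_final {T E : ℝ} (hq : IsKruzkovFlux q F)
    (ap : IsApproximation q τ h D B S u Q m) (hD : 0 ≤ D)
    (hv : IsTimeFamily v) (hω : IsMollifier ω r a) (hδ : 0 < δ) (hT : 0 ≤ T) (hE : 0 ≤ E)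
    (hδT : F * δ * T ≤ 1)
    (hvE : ∀ x, ∀ κ ∈ Icc (0 : ℝ) 1, ∀ b c, 0 ≤ b → b ≤ c → c ≤ T →
      ∫ y, |v c y - κ| * ω (x - y) ≤ (∫ y, |v b y - κ| * ω (x - y))
        - (∫ s in b..c, ∫ y, q κ (v s y) * deriv ω (x - y)) + E)
    {t : ℝ} (ht0 : 0 ≤ t) (htT : t ≤ T) :
    doubledDist v u ω δ t ⌊t / τ⌋₊ * (1 - F * δ * T) ≤ doubledDist v u ω δ 0 0
      + T * ((a + δ) * D + F * (a * (τ * S)))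
      + 2 * (T / τ + 1) * (E * ∫ x, weight δ x) + τ * S := by
  obtain ⟨C, hC⟩ := ap.jump_bound
  have ha := hω.bound_nonneg
  have hτ := ap.τ_pos
  have hS := ap.S_nonneg
  have hF := hq.nonneg
  exact coupled_le (A := doubledDist v u ω δ) (Jv := doubledFlux q v u ω δ)
    (Ju := doubledJump Q h v ω δ) hτ hT
    (mul_nonneg hE (integral_nonneg fun x => (weight_pos δ x).le)) (by positivity) (by positivity)
    (by positivity) hδT
    (fun n => hv.intervalIntegrable hT (ap.measurable_entropyFlux hq n) (ap.entropyFlux_bound hq n)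
      (hω.integrable_deriv_weighted hδ))
    (fun n => hv.intervalIntegrable hT (ap.measurable_jump n) (hC n) (hω.integrable_weighted hδ))
    (doubledDist_evolution_le hq ap hv hω hδ hvE)
    (fun n t h0 _ => doubledDist_succ_le ap hv hω hδ h0 n)
    (fun n t h0 _ => neg_doubledFlux_add_le hq ap hv hω hδ h0 n)
    (fun n t h0 _ => abs_doubledFlux_succ_sub_le hq ap hv hω hδ h0 n)
    (fun n t h0 _ => doubledDist_le_succ ap hv hω hδ h0 n) (by positivity)
    (fun n t _ _ => doubledDist_nonneg hω t n)
    (fun n t h0 _ => doubledDist_le ap hv hω hδ h0 n) ht0 htT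

end Doubling

/-! ### From the doubled distance to `L¹` estimates -/

section Estimates

variable {q : ℝ → ℝ → ℝ} {F τ h D B S r a δ : ℝ} {u : ℕ → ℝ → ℝ} {Q : ℕ → ℝ → ℝ → ℝ}
  {m : ℕ → ℝ → ℝ} {v : ℝ → ℝ → ℝ} {ω : ℝ → ℝ}

theorem IsMollifier.lintegral_eq (hω : IsMollifier ω r a) : ∫⁻ x, ENNReal.ofReal (ω x) = 1 := by
  rw [← ofReal_integral_eq_lintegral_ofReal hω.integrable (Eventually.of_forall hω.nonneg),
    hω.integral_eq, ENNReal.ofReal_one]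

theorem IsMollifier.measurable_ofReal (hω : IsMollifier ω r a) :
    Measurable (fun x => ENNReal.ofReal (ω x)) :=
  hω.contDiff.continuous.measurable.ennreal_ofReal

theorem IsMollifier.lintegral_mul_snd (hω : IsMollifier ω r a) {f : ℝ → ℝ≥0∞}
    (hf : AEMeasurable f) :
    ∫⁻ p : ℝ × ℝ, f p.2 * ENNReal.ofReal (ω (p.1 - p.2)) ∂(volume.prod volume) = ∫⁻ y, f y := by
  have hω' := hω.measurable_ofReal
  have hm : AEMeasurable (fun p : ℝ × ℝ => f p.2 * ENNReal.ofReal (ω (p.1 - p.2)))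
      (volume.prod volume) :=
    hf.comp_snd.mul (hω'.comp (measurable_fst.sub measurable_snd)).aemeasurable
  rw [lintegral_prod_symm _ hm]
  refine lintegral_congr fun y => ?_
  have hy : Measurable (fun x => ENNReal.ofReal (ω (x - y))) :=
    hω'.comp (measurable_id.sub_const y)
  simp only
  rw [lintegral_const_mul _ hy,
    lintegral_sub_right_eq_self (fun x => ENNReal.ofReal (ω x)) y, hω.lintegral_eq, mul_one]

/-- The price of removing the mollifier. It is charged to the spatial modulus of u alone, so v needs
no variation bound. -/
theorem IsApproximation.lintegral_mollified_le (ap : IsApproximation q τ h D B S u Q m)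
    (hω : IsMollifier ω r a) (n : ℕ) :
    ∫⁻ p : ℝ × ℝ, ‖u n p.2 - u n p.1‖ₑ * ENNReal.ofReal (ω (p.1 - p.2)) ∂(volume.prod volume)
      ≤ ENNReal.ofReal (r * B) := by
  have hu := ap.measurable n
  have hω' := hω.measurable_ofReal
  have hm : Measurable (fun p : ℝ × ℝ => ‖u n p.2 - u n p.1‖ₑ * ENNReal.ofReal (ω (p.1 - p.2))) :=
    ((hu.comp measurable_snd).sub (hu.comp measurable_fst)).enorm.mul
      (hω'.comp (measurable_fst.sub measurable_snd))
  rw [lintegral_prod _ hm.aemeasurable]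
  have h1 : ∀ x, ∫⁻ y, ‖u n y - u n x‖ₑ * ENNReal.ofReal (ω (x - y))
      = ∫⁻ z, ‖u n (x - z) - u n x‖ₑ * ENNReal.ofReal (ω z) := by
    intro x
    rw [← lintegral_sub_left_eq_self _ x]
    simp only [sub_sub_cancel]
  simp_rw [h1]
  have hm2 : Measurable (fun p : ℝ × ℝ =>
      ‖u n (p.1 - p.2) - u n p.1‖ₑ * ENNReal.ofReal (ω p.2)) :=
    ((hu.comp (measurable_fst.sub measurable_snd)).sub (hu.comp measurable_fst)).enorm.mul
      (hω'.comp measurable_snd)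
  rw [lintegral_lintegral_swap hm2.aemeasurable]
  calc _ ≤ ∫⁻ z, ENNReal.ofReal (r * B) * ENNReal.ofReal (ω z) := by
        refine lintegral_mono fun z => ?_
        rw [lintegral_mul_const' _ _ ENNReal.ofReal_ne_top]
        rcases lt_or_ge r |z| with hz | hz
        · simp [hω.eq_zero z hz]
        · refine mul_le_mul_left ?_ _
          have := ap.translate n (-z)
          simp only [← sub_eq_add_neg, abs_neg] at this
          exact this.trans (ENNReal.ofReal_le_ofReal (mul_le_mul_of_nonneg_right hz ap.B_nonneg))
    _ = _ := by rw [lintegral_const_mul _ hω', hω.lintegral_eq, mul_one]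

theorem ofReal_doubledDist (ap : IsApproximation q τ h D B S u Q m) (hv : IsTimeFamily v)
    (hω : IsMollifier ω r a) (hδ : 0 < δ) {t : ℝ} (ht : 0 ≤ t) (n : ℕ) :
    ENNReal.ofReal (doubledDist v u ω δ t n) = ∫⁻ p : ℝ × ℝ, ‖v t p.2 - u n p.1‖ₑ
      * (ENNReal.ofReal (ω (p.1 - p.2)) * ENNReal.ofReal (weight δ p.1)) ∂(volume.prod volume) := by
  have hi := hv.integrable_slice ht (ap.measurable_dist n) (ap.dist_bound n)
    (hω.integrable_weighted hδ)
  rw [doubledDist, ofReal_integral_eq_lintegral_ofReal hi (Eventually.of_forall fun p =>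
    mul_nonneg (abs_nonneg _) (mul_nonneg (hω.nonneg _) (weight_pos _ _).le))]
  refine lintegral_congr fun p => ?_
  rw [ENNReal.ofReal_mul (abs_nonneg _), ENNReal.ofReal_mul (hω.nonneg _),
    Real.enorm_eq_ofReal_abs]

theorem IsApproximation.aemeasurable_enorm_sub (ap : IsApproximation q τ h D B S u Q m)
    (hv : IsTimeFamily v) {t : ℝ} (ht : 0 ≤ t) (n : ℕ) :
    AEMeasurable (fun y => ‖v t y - u n y‖ₑ) :=
  ((hv.slice t ht).sub (ap.measurable n).aestronglyMeasurable).enorm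

theorem ofReal_doubledDist_le (ap : IsApproximation q τ h D B S u Q m) (hv : IsTimeFamily v)
    (hω : IsMollifier ω r a) (hδ : 0 < δ) {t : ℝ} (ht : 0 ≤ t) (n : ℕ) :
    ENNReal.ofReal (doubledDist v u ω δ t n)
      ≤ (∫⁻ y, ‖v t y - u n y‖ₑ) + ENNReal.ofReal (r * B) := by
  have hm := ap.aemeasurable_enorm_sub hv ht n
  rw [ofReal_doubledDist ap hv hω hδ ht, ← hω.lintegral_mul_snd hm]
  refine le_trans ?_ (add_le_add le_rfl (ap.lintegral_mollified_le hω n))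
  have hu := ap.measurable n
  have hmm : Measurable (fun p : ℝ × ℝ => ‖u n p.2 - u n p.1‖ₑ * ENNReal.ofReal (ω (p.1 - p.2))) :=
    ((hu.comp measurable_snd).sub (hu.comp measurable_fst)).enorm.mul
      (hω.measurable_ofReal.comp (measurable_fst.sub measurable_snd))
  rw [← lintegral_add_right _ hmm]
  refine lintegral_mono fun p => ?_
  have h1 : ENNReal.ofReal (weight δ p.1) ≤ 1 := by
    simpa using ENNReal.ofReal_le_ofReal (weight_le_one δ p.1)
  have h2 : ‖v t p.2 - u n p.1‖ₑ ≤ ‖v t p.2 - u n p.2‖ₑ + ‖u n p.2 - u n p.1‖ₑ := by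
    refine le_trans (le_of_eq ?_) (enorm_add_le _ _)
    rw [sub_add_sub_cancel]
  calc _ ≤ (‖v t p.2 - u n p.2‖ₑ + ‖u n p.2 - u n p.1‖ₑ) * (ENNReal.ofReal (ω (p.1 - p.2)) * 1) := by
        gcongr
    _ = _ := by rw [mul_one, add_mul]

theorem weight_anti {x y : ℝ} (hxy : |x| ≤ y) : weight δ y ≤ weight δ x := by
  unfold weight
  have h1 : x ^ 2 ≤ y ^ 2 := by rw [← sq_abs x]; gcongr
  have : δ ^ 2 * x ^ 2 ≤ δ ^ 2 * y ^ 2 := by gcongr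
  refine inv_anti₀ (by positivity) ?_
  rw [mul_pow, mul_pow]
  linarith

/-- If |y| ≤ R and |x - y| ≤ r, then |x| ≤ R + r, so the weight is bounded below on the support of
the mollifier. -/
theorem weight_mul_setLIntegral_le (ap : IsApproximation q τ h D B S u Q m) (hv : IsTimeFamily v)
    (hω : IsMollifier ω r a) (hδ : 0 < δ) {t : ℝ} (ht : 0 ≤ t) (n : ℕ) (R : ℝ) :
    ENNReal.ofReal (weight δ (R + r)) * (∫⁻ y in Icc (-R) R, ‖v t y - u n y‖ₑ)
      ≤ ENNReal.ofReal (doubledDist v u ω δ t n) + ENNReal.ofReal (r * B) := by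
  have hm := ap.aemeasurable_enorm_sub hv ht n
  have hm' := hm.indicator (measurableSet_Icc (a := -R) (b := R))
  rw [ofReal_doubledDist ap hv hω hδ ht, ← lintegral_indicator measurableSet_Icc,
    ← hω.lintegral_mul_snd hm', ← lintegral_const_mul' _ _ ENNReal.ofReal_ne_top]
  refine le_trans ?_ (add_le_add le_rfl (ap.lintegral_mollified_le hω n))
  have hu := ap.measurable n
  have hmm : Measurable (fun p : ℝ × ℝ => ‖u n p.2 - u n p.1‖ₑ * ENNReal.ofReal (ω (p.1 - p.2))) :=
    ((hu.comp measurable_snd).sub (hu.comp measurable_fst)).enorm.mul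
      (hω.measurable_ofReal.comp (measurable_fst.sub measurable_snd))
  rw [← lintegral_add_right _ hmm]
  refine lintegral_mono fun p => ?_
  by_cases hp : p.2 ∈ Icc (-R) R
  swap
  · simp [indicator_of_notMem hp]
  rw [indicator_of_mem hp]
  rcases lt_or_ge r |p.1 - p.2| with hz | hz
  · simp [hω.eq_zero _ hz]
  have hx : |p.1| ≤ R + r := by
    have h1 : |p.2| ≤ R := abs_le.2 hp
    have h2 : |p.1| ≤ |p.2| + |p.1 - p.2| := by
      refine le_trans (le_of_eq ?_) (abs_add_le _ _)
      rw [add_sub_cancel]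
    linarith
  have h1 : ENNReal.ofReal (weight δ p.1) ≤ 1 := by
    simpa using ENNReal.ofReal_le_ofReal (weight_le_one δ p.1)
  have h2 : ‖v t p.2 - u n p.2‖ₑ ≤ ‖v t p.2 - u n p.1‖ₑ + ‖u n p.2 - u n p.1‖ₑ := by
    rw [← enorm_neg (u n p.2 - u n p.1)]
    refine le_trans (le_of_eq ?_) (enorm_add_le _ _)
    congr 1; ring
  calc _ ≤ ENNReal.ofReal (weight δ p.1) * ((‖v t p.2 - u n p.1‖ₑ + ‖u n p.2 - u n p.1‖ₑ)
          * ENNReal.ofReal (ω (p.1 - p.2))) := by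
        gcongr
        exact weight_anti hx
    _ = ‖v t p.2 - u n p.1‖ₑ * (ENNReal.ofReal (ω (p.1 - p.2)) * ENNReal.ofReal (weight δ p.1))
          + ENNReal.ofReal (weight δ p.1) *
            (‖u n p.2 - u n p.1‖ₑ * ENNReal.ofReal (ω (p.1 - p.2))) := by ring
    _ ≤ _ := add_le_add le_rfl (mul_le_of_le_one_left zero_le h1)

/-- The comparison on bounded intervals. Here δ stays positive because the defect E is multiplied by
∫ w, which blows up as δ tends to 0; for this reason the case E > 0 is only used locally. -/
theorem setLIntegral_sub_le {T E : ℝ} (hq : IsKruzkovFlux q F)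
    (ap : IsApproximation q τ h D B S u Q m) (hD : 0 ≤ D)
    (hv : IsTimeFamily v) (hω : IsMollifier ω r a) (hr : 0 ≤ r) (hδ : 0 < δ) (hT : 0 ≤ T)
    (hE : 0 ≤ E) (hδT : F * δ * T ≤ 1)
    (hvE : ∀ x, ∀ κ ∈ Icc (0 : ℝ) 1, ∀ b c, 0 ≤ b → b ≤ c → c ≤ T →
      ∫ y, |v c y - κ| * ω (x - y) ≤ (∫ y, |v b y - κ| * ω (x - y))
        - (∫ s in b..c, ∫ y, q κ (v s y) * deriv ω (x - y)) + E)
    {t : ℝ} (ht0 : 0 ≤ t) (htT : t ≤ T) (R : ℝ) :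
    ENNReal.ofReal (weight δ (R + r) * (1 - F * δ * T)) *
        (∫⁻ y in Icc (-R) R, ‖v t y - u ⌊t / τ⌋₊ y‖ₑ)
      ≤ (∫⁻ y, ‖v 0 y - u 0 y‖ₑ) + ENNReal.ofReal (T * ((a + δ) * D + F * (a * (τ * S)))
        + 2 * (T / τ + 1) * (E * ∫ x, weight δ x) + τ * S + 2 * r * B) := by
  have ha := hω.bound_nonneg
  have hτ := ap.τ_pos
  have hS := ap.S_nonneg
  have hB := ap.B_nonneg
  have hF := hq.nonneg
  have hw : 0 ≤ ∫ x, weight δ x := integral_nonneg fun x => (weight_pos δ x).le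
  have h1 := ENNReal.ofReal_le_ofReal
    (doubledDist_final hq ap hD hv hω hδ hT hE hδT hvE ht0 htT)
  rw [ENNReal.ofReal_mul (doubledDist_nonneg hω t _)] at h1
  have h2 := weight_mul_setLIntegral_le ap hv hω hδ ht0 ⌊t / τ⌋₊ R
  have h3 := ofReal_doubledDist_le ap hv hω hδ le_rfl 0
  have h4 : ENNReal.ofReal (1 - F * δ * T) ≤ 1 := by
    rw [← ENNReal.ofReal_one]
    exact ENNReal.ofReal_le_ofReal (by linarith [mul_nonneg (mul_nonneg hF hδ.le) hT])
  have hN : 0 ≤ T * ((a + δ) * D + F * (a * (τ * S)))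
        + 2 * (T / τ + 1) * (E * ∫ x, weight δ x) + τ * S := by positivity
  calc _ = ENNReal.ofReal (1 - F * δ * T) * (ENNReal.ofReal (weight δ (R + r)) *
        (∫⁻ y in Icc (-R) R, ‖v t y - u ⌊t / τ⌋₊ y‖ₑ)) := by
        rw [ENNReal.ofReal_mul (weight_pos _ _).le]; ring
    _ ≤ ENNReal.ofReal (1 - F * δ * T) * (ENNReal.ofReal (doubledDist v u ω δ t ⌊t / τ⌋₊)
        + ENNReal.ofReal (r * B)) := by gcongr
    _ ≤ ENNReal.ofReal (doubledDist v u ω δ t ⌊t / τ⌋₊) * ENNReal.ofReal (1 - F * δ * T)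
        + ENNReal.ofReal (r * B) := by
        rw [mul_add, mul_comm]
        gcongr
        exact mul_le_of_le_one_left zero_le h4
    _ ≤ ENNReal.ofReal (doubledDist v u ω δ 0 0) + ENNReal.ofReal (T * ((a + δ) * D + F * (a * (τ * S)))
        + 2 * (T / τ + 1) * (E * ∫ x, weight δ x) + τ * S) + ENNReal.ofReal (r * B) := by
        gcongr
        refine h1.trans ?_
        rw [← ENNReal.ofReal_add (doubledDist_nonneg hω 0 0) hN]
        exact ENNReal.ofReal_le_ofReal (by linarith)
    _ ≤ (∫⁻ y, ‖v 0 y - u 0 y‖ₑ) + ENNReal.ofReal (r * B)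
        + ENNReal.ofReal (T * ((a + δ) * D + F * (a * (τ * S)))
        + 2 * (T / τ + 1) * (E * ∫ x, weight δ x) + τ * S) + ENNReal.ofReal (r * B) := by gcongr
    _ = _ := by
        rw [add_right_comm, add_assoc, add_assoc, ← ENNReal.ofReal_add (by positivity) hN,
          ← ENNReal.ofReal_add (by positivity) (by positivity)]
        congr 2
        ring

/-- The `L¹` error estimate against a function that satisfies the entropy inequalities exactly. -/
theorem lintegral_sub_le {t : ℝ} (hq : IsKruzkovFlux q F)
    (ap : IsApproximation q τ h D B S u Q m) (hD : 0 ≤ D)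
    (hv : IsTimeFamily v) (hω : IsMollifier ω r a) (hr : 0 ≤ r) (ht : 0 ≤ t)
    (hvE : ∀ x, ∀ κ ∈ Icc (0 : ℝ) 1, ∀ b c, 0 ≤ b → b ≤ c → c ≤ t →
      ∫ y, |v c y - κ| * ω (x - y) ≤ (∫ y, |v b y - κ| * ω (x - y))
        - (∫ s in b..c, ∫ y, q κ (v s y) * deriv ω (x - y))) :
    ∫⁻ y, ‖v t y - u ⌊t / τ⌋₊ y‖ₑ
      ≤ (∫⁻ y, ‖v 0 y - u 0 y‖ₑ)
        + ENNReal.ofReal (t * (a * D + F * (a * (τ * S))) + τ * S + 2 * r * B) := by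
  have hR : ∀ R : ℝ, ∫⁻ y in Icc (-R) R, ‖v t y - u ⌊t / τ⌋₊ y‖ₑ ≤ (∫⁻ y, ‖v 0 y - u 0 y‖ₑ)
      + ENNReal.ofReal (t * (a * D + F * (a * (τ * S))) + τ * S + 2 * r * B) := by
    intro R
    -- With E = 0 nothing blows up as δ ↘ 0, and both the weight and the absorption factor tend to
    -- 1.
    have l1 : Tendsto (fun δ : ℝ => ENNReal.ofReal (weight δ (R + r) * (1 - F * δ * t)) *
        (∫⁻ y in Icc (-R) R, ‖v t y - u ⌊t / τ⌋₊ y‖ₑ)) (𝓝[>] 0)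
        (𝓝 (ENNReal.ofReal 1 * (∫⁻ y in Icc (-R) R, ‖v t y - u ⌊t / τ⌋₊ y‖ₑ))) := by
      refine ENNReal.Tendsto.mul_const (ENNReal.tendsto_ofReal ?_) (Or.inl (by simp))
      have hc : Continuous (fun δ : ℝ => weight δ (R + r) * (1 - F * δ * t)) := by
        unfold weight
        refine Continuous.mul (Continuous.inv₀ (by fun_prop) fun x => by positivity) (by fun_prop)
      have := hc.tendsto 0
      simp only [weight, zero_mul, mul_zero, sub_zero, mul_one] at this
      norm_num at this
      exact this.mono_left nhdsWithin_le_nhds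
    have l2 : Tendsto (fun δ : ℝ => (∫⁻ y, ‖v 0 y - u 0 y‖ₑ)
        + ENNReal.ofReal (t * ((a + δ) * D + F * (a * (τ * S))) + τ * S + 2 * r * B)) (𝓝[>] 0)
        (𝓝 ((∫⁻ y, ‖v 0 y - u 0 y‖ₑ)
        + ENNReal.ofReal (t * ((a + 0) * D + F * (a * (τ * S))) + τ * S + 2 * r * B))) := by
      refine tendsto_const_nhds.add (ENNReal.tendsto_ofReal ?_)
      have hc : Continuous (fun δ : ℝ =>
        t * ((a + δ) * D + F * (a * (τ * S))) + τ * S + 2 * r * B) := by fun_prop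
      exact (hc.tendsto 0).mono_left nhdsWithin_le_nhds
    rw [ENNReal.ofReal_one, one_mul] at l1
    rw [add_zero] at l2
    refine le_of_tendsto_of_tendsto l1 l2 ?_
    have hsmall : ∀ᶠ δ : ℝ in 𝓝[>] 0, F * δ * t ≤ 1 := by
      have hc : Continuous (fun δ : ℝ => F * δ * t) := by fun_prop
      have := (hc.tendsto 0).mono_left (nhdsWithin_le_nhds (s := Ioi 0))
      rw [mul_zero, zero_mul] at this
      exact (this.eventually (gt_mem_nhds zero_lt_one)).mono fun _ h => le_of_lt h
    filter_upwards [hsmall, self_mem_nhdsWithin] with δ h1 h2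
    have h3 := setLIntegral_sub_le hq ap hD hv hω hr h2 ht le_rfl h1
      (fun x κ hκ b c hb hbc hc => by rw [add_zero]; exact hvE x κ hκ b c hb hbc hc) ht le_rfl R
    simpa using h3
  have hmono : Monotone (fun k : ℕ => Icc (-(k : ℝ)) (k : ℝ)) := fun i j hij =>
    Icc_subset_Icc (by simpa using hij) (by simpa using hij)
  have hU : (⋃ k : ℕ, Icc (-(k : ℝ)) (k : ℝ)) = univ := by
    refine eq_univ_of_forall fun x => ?_
    obtain ⟨k, hk⟩ := exists_nat_ge |x|
    exact mem_iUnion.2 ⟨k, abs_le.1 hk⟩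
  rw [← setLIntegral_univ, ← hU, setLIntegral_iUnion_of_directed _ hmono.directed_le]
  exact iSup_le fun k => hR k

end Estimates

/-! ### Entropy inequalities between two times -/

/-- The entropy inequalities for `v`, tested with functions of `x` on time intervals. -/
def IsSliceEntropic (q : ℝ → ℝ → ℝ) (v : ℝ → ℝ → ℝ) : Prop :=
  ∀ κ ∈ Icc (0 : ℝ) 1, ∀ φ : ℝ → ℝ, ContDiff ℝ 1 φ → HasCompactSupport φ → (∀ x, 0 ≤ φ x) →
    ∀ b c, 0 ≤ b → b ≤ c →
      ∫ x, |v c x - κ| * φ x ≤ (∫ x, |v b x - κ| * φ x)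
        + ∫ s in b..c, ∫ x, q κ (v s x) * deriv φ x

theorem IsSliceEntropic.mollified {q v : ℝ → ℝ → ℝ} (hv : IsSliceEntropic q v) {ω : ℝ → ℝ}
    {r a : ℝ} (hω : IsMollifier ω r a) (x : ℝ) {κ : ℝ} (hκ : κ ∈ Icc (0 : ℝ) 1) {b c : ℝ}
    (hb : 0 ≤ b) (hbc : b ≤ c) :
    ∫ y, |v c y - κ| * ω (x - y) ≤ (∫ y, |v b y - κ| * ω (x - y))
        - (∫ s in b..c, ∫ y, q κ (v s y) * deriv ω (x - y)) := by
  have hc : ContDiff ℝ 1 (fun y => ω (x - y)) := hω.contDiff.comp (by fun_prop)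
  have hs : HasCompactSupport (fun y => ω (x - y)) :=
    hω.hasCompactSupport.comp_homeomorph (Homeomorph.subLeft x)
  have h1 := hv κ hκ _ hc hs (fun y => hω.nonneg _) b c hb hbc
  have hd : ∀ y, deriv (fun y => ω (x - y)) y = -deriv ω (x - y) := fun y => deriv_comp_const_sub ω x y
  simp only [hd, mul_neg, integral_neg, intervalIntegral.integral_neg] at h1
  linarith

theorem exists_Icc_support {φ : ℝ → ℝ} (hφs : HasCompactSupport φ) :
    ∃ R : ℝ, 0 < R ∧ ∀ x ∉ Icc (-R) R, φ x = 0 := by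
  obtain ⟨R, hR, hb⟩ := hφs.isCompact.isBounded.subset_closedBall_lt 0 (0 : ℝ)
  refine ⟨R, hR, fun x hx => ?_⟩
  by_contra h
  have := hb (subset_tsupport φ h)
  rw [Real.closedBall_eq_Icc, zero_sub, zero_add] at this
  exact hx this

theorem integrable_comp_mul {θ f φ : ℝ → ℝ} (hθ : Continuous θ) (hf : AEStronglyMeasurable f volume)
    (h01 : ∀ x, f x ∈ Icc (0 : ℝ) 1) (hφ : Integrable φ) : Integrable (fun x => θ (f x) * φ x) := by
  obtain ⟨C, hC⟩ := isCompact_Icc.exists_bound_of_continuousOn (hθ.continuousOn (s := Icc (0 : ℝ) 1))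
  exact hφ.bdd_mul (hθ.comp_aestronglyMeasurable hf) (Eventually.of_forall fun x => hC _ (h01 x))

theorem setLIntegral_enorm_sub_ne_top {f g : ℝ → ℝ} (hf01 : ∀ x, f x ∈ Icc (0 : ℝ) 1)
    (hg01 : ∀ x, g x ∈ Icc (0 : ℝ) 1) (R : ℝ) : ∫⁻ x in Icc (-R) R, ‖f x - g x‖ₑ ≠ ∞ := by
  refine ((setLIntegral_mono' (g := fun _ => (1 : ℝ≥0∞)) measurableSet_Icc fun x _ => ?_).trans_lt
    ?_).ne
  · rw [Real.enorm_eq_ofReal_abs, ← ENNReal.ofReal_one]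
    exact ENNReal.ofReal_le_ofReal (abs_sub_le_one (hf01 x) (hg01 x))
  · simp

theorem abs_integral_comp_mul_sub_le {θ f g φ : ℝ → ℝ} {K C R : ℝ} (hθ : Continuous θ)
    (hK : ∀ a ∈ Icc (0 : ℝ) 1, ∀ b ∈ Icc (0 : ℝ) 1, |θ a - θ b| ≤ K * |a - b|) (hK0 : 0 ≤ K)
    (hf : AEStronglyMeasurable f volume) (hf01 : ∀ x, f x ∈ Icc (0 : ℝ) 1)
    (hg : AEStronglyMeasurable g volume) (hg01 : ∀ x, g x ∈ Icc (0 : ℝ) 1)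
    (hφ : Integrable φ) (hC : ∀ x, |φ x| ≤ C) (hR : ∀ x ∉ Icc (-R) R, φ x = 0) :
    |(∫ x, θ (f x) * φ x) - ∫ x, θ (g x) * φ x|
      ≤ K * C * (∫⁻ x in Icc (-R) R, ‖f x - g x‖ₑ).toReal := by
  have hC0 : 0 ≤ C := (abs_nonneg _).trans (hC 0)
  have hfin := setLIntegral_enorm_sub_ne_top hf01 hg01 R
  rw [← integral_sub (integrable_comp_mul hθ hf hf01 hφ) (integrable_comp_mul hθ hg hg01 hφ)]
  rw [← Real.norm_eq_abs]
  refine (norm_integral_le_lintegral_norm _).trans ?_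
  have h2 : K * C * (∫⁻ x in Icc (-R) R, ‖f x - g x‖ₑ).toReal
      = (ENNReal.ofReal (K * C) * ∫⁻ x in Icc (-R) R, ‖f x - g x‖ₑ).toReal := by
    rw [ENNReal.toReal_mul, ENNReal.toReal_ofReal (by positivity)]
  rw [h2]
  refine ENNReal.toReal_mono (ENNReal.mul_ne_top ENNReal.ofReal_ne_top hfin) ?_
  rw [← lintegral_indicator measurableSet_Icc, ← lintegral_const_mul' _ _ ENNReal.ofReal_ne_top]
  refine lintegral_mono fun x => ?_
  by_cases hx : x ∈ Icc (-R) R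
  · rw [indicator_of_mem hx, Real.enorm_eq_ofReal_abs, ← ENNReal.ofReal_mul (by positivity)]
    refine ENNReal.ofReal_le_ofReal ?_
    rw [Real.norm_eq_abs, ← sub_mul, abs_mul]
    calc _ ≤ K * |f x - g x| * C :=
          mul_le_mul (hK _ (hf01 x) _ (hg01 x)) (hC x) (abs_nonneg _) (by positivity)
      _ = _ := by ring
  · rw [hR x hx, mul_zero, mul_zero, sub_zero, norm_zero, ENNReal.ofReal_zero]
    exact zero_le

theorem continuousOn_integral_comp_mul {θ φ : ℝ → ℝ} {v : ℝ → ℝ → ℝ} {K : ℝ} (hθ : Continuous θ)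
    (hK : ∀ a ∈ Icc (0 : ℝ) 1, ∀ b ∈ Icc (0 : ℝ) 1, |θ a - θ b| ≤ K * |a - b|) (hK0 : 0 ≤ K)
    (hv : IsTimeFamily v)
    (hcont : ∀ t, 0 ≤ t → ∀ R : ℝ,
      Tendsto (fun s => ∫⁻ x in Icc (-R) R, ‖v s x - v t x‖ₑ) (𝓝[Ici 0] t) (𝓝 0))
    (hφ : Continuous φ) (hφs : HasCompactSupport φ) :
    ContinuousOn (fun t => ∫ x, θ (v t x) * φ x) (Ici 0) := by
  obtain ⟨R, -, hR⟩ := exists_Icc_support hφs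
  obtain ⟨C, hC⟩ := hφ.bounded_above_of_compact_support hφs
  intro t ht
  rw [ContinuousWithinAt, tendsto_iff_norm_sub_tendsto_zero]
  have h1 := (ENNReal.tendsto_toReal ENNReal.zero_ne_top).comp (hcont t ht R)
  have h2 := h1.const_mul (K * C)
  rw [ENNReal.toReal_zero, mul_zero] at h2
  refine squeeze_zero' (Eventually.of_forall fun _ => norm_nonneg _) ?_ h2
  filter_upwards [self_mem_nhdsWithin] with s hs
  exact abs_integral_comp_mul_sub_le hθ hK hK0 (hv.slice s hs) (hv.mem s) (hv.slice t ht)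
    (hv.mem t) (hφ.integrable_of_hasCompactSupport hφs) hC hR

/-! ### A scalar differential inequality in the sense of distributions -/

theorem tendsto_mollified {G : ℝ → ℝ} (hG : Continuous G) {ω : ℝ → ℝ → ℝ} {a : ℝ → ℝ}
    (hω : ∀ r, 0 < r → IsMollifier (ω r) r (a r)) (b : ℝ) :
    Tendsto (fun r => ∫ s, G s * ω r (s - b)) (𝓝[>] 0) (𝓝 (G b)) := by
  rw [Metric.tendsto_nhds]
  intro ε hε
  obtain ⟨d, hd, hGd⟩ := Metric.continuousAt_iff.1 hG.continuousAt (ε / 2) (half_pos hε)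
  filter_upwards [Ioo_mem_nhdsGT hd] with r hr
  have hm := hω r hr.1
  have hi : Integrable (fun s => ω r (s - b)) := hm.integrable.comp_sub_right b
  have hs : HasCompactSupport (fun s => ω r (s - b)) :=
    hm.hasCompactSupport.comp_homeomorph (Homeomorph.subRight b)
  have hc : Continuous (fun s => ω r (s - b)) := hm.contDiff.continuous.comp (by fun_prop)
  have h1 : ∫ s, ω r (s - b) = 1 := by
    rw [integral_sub_right_eq_self (ω r) b]; exact hm.integral_eq
  have i1 : Integrable (fun s => G s * ω r (s - b)) :=
    (hG.mul hc).integrable_of_hasCompactSupport hs.mul_left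
  have h2 : (∫ s, G s * ω r (s - b)) - G b = ∫ s, (G s - G b) * ω r (s - b) := by
    simp_rw [sub_mul]
    rw [integral_sub i1 (hi.const_mul _), integral_const_mul, h1, mul_one]
  rw [dist_eq_norm, h2]
  refine lt_of_le_of_lt (b := ε / 2) ?_ (half_lt_self hε)
  have h3 := norm_integral_le_of_norm_le (hi.const_mul (ε / 2))
    (f := fun s => (G s - G b) * ω r (s - b)) (Eventually.of_forall fun s => ?_)
  · rwa [integral_const_mul, h1, mul_one] at h3
  · rw [norm_mul, Real.norm_of_nonneg (hm.nonneg _)]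
    rcases lt_or_ge r |s - b| with h | h
    · rw [hm.eq_zero _ h]; simp
    · refine mul_le_mul_of_nonneg_right ?_ (hm.nonneg _)
      have := hGd (x := s) (by rw [Real.dist_eq]; exact h.trans_lt hr.2)
      rw [Real.dist_eq] at this
      exact this.le

/-- Test with smooth approximations of the indicator of (b,c]. Continuity of G turns the two
approximate point masses in χ' into G(b) and G(c). -/
theorem le_add_integral_of_test {G H : ℝ → ℝ} (hG : ContinuousOn G (Ici 0))
    (hH : ∀ T, IntegrableOn H (Ioc 0 T))
    (htest : ∀ χ : ℝ → ℝ, ContDiff ℝ 1 χ → HasCompactSupport χ → (∀ t, 0 ≤ χ t) →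
      0 ≤ (∫ t in Ioi 0, (G t * deriv χ t + H t * χ t)) + G 0 * χ 0)
    {b c : ℝ} (hb : 0 ≤ b) (hbc : b ≤ c) : G c ≤ G b + ∫ s in b..c, H s := by
  -- The constant extension to negative times makes b = 0 no exception: mollifiers may reach across
  -- 0.
  set G' : ℝ → ℝ := fun t => G (max 0 t) with hG'
  have hG'c : Continuous G' :=
    hG.comp_continuous (by fun_prop) fun t => le_max_left (0 : ℝ) t
  obtain ⟨c₀, -, hex⟩ := exists_mollifier
  choose! ω hω using hex
  -- The indicator of an interval mollified, with derivative ω_r(t - b) - ω_r(t - c).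
  set χ : ℝ → ℝ → ℝ := fun r t => ∫ s in (t - c)..(t - b), ω r s with hχ
  have hcont : ∀ r, 0 < r → Continuous (ω r) := fun r hr => (hω r hr).contDiff.continuous
  have hii : ∀ r, 0 < r → ∀ x y, IntervalIntegrable (ω r) volume x y :=
    fun r hr x y => (hcont r hr).intervalIntegrable x y
  have hder : ∀ r, 0 < r → ∀ t, HasDerivAt (χ r) (ω r (t - b) - ω r (t - c)) t := by
    intro r hr t
    have e : χ r = fun t => (∫ s in (0 : ℝ)..(t - b), ω r s) - ∫ s in (0 : ℝ)..(t - c), ω r s := by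
      funext t
      rw [hχ, intervalIntegral.integral_interval_sub_left (hii r hr _ _) (hii r hr _ _)]
    rw [e]
    have hp : ∀ z, HasDerivAt (fun t => ∫ s in (0 : ℝ)..(t - z), ω r s) (ω r (t - z)) t := fun z =>
      HasDerivAt.comp_sub_const t z ((hcont r hr).integral_hasStrictDerivAt 0 (t - z)).hasDerivAt
    exact (hp b).sub (hp c)
  have hχd : ∀ r, 0 < r → deriv (χ r) = fun t => ω r (t - b) - ω r (t - c) :=
    fun r hr => funext fun t => (hder r hr t).deriv
  have hχ1 : ∀ r, 0 < r → ContDiff ℝ 1 (χ r) := by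
    intro r hr
    rw [contDiff_one_iff_deriv, hχd r hr]
    have := hcont r hr
    exact ⟨fun t => (hder r hr t).differentiableAt, by fun_prop⟩
  have hχ0 : ∀ r, 0 < r → ∀ t, 0 ≤ χ r t := fun r hr t =>
    intervalIntegral.integral_nonneg (by linarith) fun s _ => (hω r hr).nonneg s
  have hχle : ∀ r, 0 < r → ∀ t, χ r t ≤ 1 := by
    intro r hr t
    rw [hχ, ← (hω r hr).integral_eq]
    simp only
    rw [intervalIntegral.integral_of_le (by linarith)]
    exact setIntegral_le_integral (hω r hr).integrable (Eventually.of_forall (hω r hr).nonneg)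
  have hχout : ∀ r, 0 < r → ∀ t, t ∉ Icc (b - r) (c + r) → χ r t = 0 := by
    intro r hr t ht
    rw [hχ]
    refine (intervalIntegral.integral_congr (g := fun _ => (0 : ℝ)) fun s hs => ?_).trans
      intervalIntegral.integral_zero
    rw [uIcc_of_le (by linarith)] at hs
    refine (hω r hr).eq_zero s ?_
    rw [mem_Icc, not_and_or, not_le, not_le] at ht
    rcases ht with ht | ht
    · exact (by linarith [hs.2] : r < -s).trans_le (neg_le_abs s)
    · exact (by linarith [hs.1] : r < s).trans_le (le_abs_self s)
  have hχs : ∀ r, 0 < r → HasCompactSupport (χ r) := fun r hr =>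
    HasCompactSupport.intro isCompact_Icc (hχout r hr)
  have hχin : ∀ r, 0 < r → ∀ t, b + r < t → t < c - r → χ r t = 1 := by
    intro r hr t h1 h2
    rw [hχ, ← (hω r hr).integral_eq]
    simp only
    rw [intervalIntegral.integral_of_le (by linarith)]
    refine setIntegral_eq_integral_of_forall_compl_eq_zero fun s hs => (hω r hr).eq_zero s ?_
    rw [mem_Ioc, not_and_or, not_lt, not_le] at hs
    rcases hs with hs | hs
    · exact (by linarith : r < -s).trans_le (neg_le_abs s)
    · exact (by linarith : r < s).trans_le (le_abs_self s)
  have hineq : ∀ r ∈ Ioo (0 : ℝ) 1, 0 ≤ (∫ s, G' s * ω r (s - b)) - (∫ s, G' s * ω r (s - c))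
      + ∫ t in Ioc 0 (c + 1), H t * χ r t := by
    rintro r ⟨hr, hr1⟩
    have h0 := htest (χ r) (hχ1 r hr) (hχs r hr) (hχ0 r hr)
    have hdc := continuous_deriv_of_contDiff (hχ1 r hr)
    have iG : Integrable (fun t => G' t * deriv (χ r) t) :=
      (hG'c.mul hdc).integrable_of_hasCompactSupport (hχs r hr).deriv.mul_left
    have eG : EqOn (fun t => G' t * deriv (χ r) t) (fun t => G t * deriv (χ r) t) (Ioi 0) := by
      intro t ht
      simp only [hG', max_eq_right (show (0 : ℝ) < t from ht).le]
    have iG1 : IntegrableOn (fun t => G t * deriv (χ r) t) (Ioi 0) :=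
      iG.integrableOn.congr_fun eG measurableSet_Ioi
    have hz : ∀ t ∈ Ioi (0 : ℝ) \ Ioc 0 (c + 1), H t * χ r t = 0 := by
      intro t ht
      rw [hχout r hr t, mul_zero]
      intro h
      exact ht.2 ⟨ht.1, by linarith [h.2]⟩
    have iH0 : IntegrableOn (fun t => H t * χ r t) (Ioc 0 (c + 1)) :=
      (hH (c + 1)).mul_bdd (c := 1) (hχ1 r hr).continuous.aestronglyMeasurable
        (Eventually.of_forall fun t => by
          rw [Real.norm_of_nonneg (hχ0 r hr t)]; exact hχle r hr t)
    have iH : IntegrableOn (fun t => H t * χ r t) (Ioi 0) :=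
      iH0.of_forall_sdiff_eq_zero measurableSet_Ioi hz
    rw [integral_add iG1 iH, setIntegral_eq_of_subset_of_forall_sdiff_eq_zero measurableSet_Ioi
      (fun t ht => ht.1) hz, ← setIntegral_congr_fun measurableSet_Ioi eG] at h0
    -- The initial term of the weak formulation is the missing integral over negative times.
    have e1 : ∫ t in Iic 0, G' t * deriv (χ r) t = G 0 * χ r 0 := by
      rw [← (hχs r hr).integral_Iic_deriv_eq (hχ1 r hr) 0, ← integral_const_mul]
      refine setIntegral_congr_fun measurableSet_Iic fun t ht => ?_
      simp only [hG', max_eq_left (show t ≤ 0 from ht)]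
    have e2 := intervalIntegral.integral_Iic_add_Ioi (b := (0 : ℝ)) iG.integrableOn iG.integrableOn
    have e3 : ∫ t, G' t * deriv (χ r) t
        = (∫ s, G' s * ω r (s - b)) - ∫ s, G' s * ω r (s - c) := by
      have hi : ∀ z, Integrable (fun s => G' s * ω r (s - z)) := fun z =>
        (hG'c.mul ((hcont r hr).comp (by fun_prop))).integrable_of_hasCompactSupport
          ((hω r hr).hasCompactSupport.comp_homeomorph (Homeomorph.subRight z)).mul_left
      rw [← integral_sub (hi b) (hi c)]
      simp only [hχd r hr, mul_sub]
    linarith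
  have l1 := tendsto_mollified hG'c hω b
  have l2 := tendsto_mollified hG'c hω c
  have l3 : Tendsto (fun r => ∫ t in Ioc 0 (c + 1), H t * χ r t) (𝓝[>] 0)
      (𝓝 (∫ t in Ioc 0 (c + 1), (Ioc b c).indicator H t)) := by
    refine tendsto_integral_filter_of_dominated_convergence (fun t => |H t|) ?_ ?_ (hH _).abs ?_
    · filter_upwards [self_mem_nhdsWithin] with r hr
      exact (hH _).aestronglyMeasurable.mul (hχ1 r hr).continuous.aestronglyMeasurable
    · filter_upwards [self_mem_nhdsWithin] with r hr
      refine Eventually.of_forall fun t => ?_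
      rw [norm_mul, Real.norm_eq_abs, Real.norm_of_nonneg (hχ0 r hr t)]
      exact mul_le_of_le_one_right (abs_nonneg _) (hχle r hr t)
    -- At the endpoints χ_r need not converge to 0 or 1.
    · have hne : ∀ᵐ t : ℝ ∂(volume.restrict (Ioc 0 (c + 1))), t ≠ b ∧ t ≠ c := by
        refine ae_restrict_of_ae ?_
        exact (Measure.ae_ne volume b).and (Measure.ae_ne volume c)
      filter_upwards [hne] with t ht
      refine tendsto_const_nhds.congr' ?_
      by_cases hin : t ∈ Ioc b c
      · have h1 : b < t := hin.1
        have h2 : t < c := lt_of_le_of_ne hin.2 ht.2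
        filter_upwards [Ioo_mem_nhdsGT (sub_pos.2 h1), Ioo_mem_nhdsGT (sub_pos.2 h2)] with r r1 r2
        rw [indicator_of_mem hin, hχin r r1.1 t (by linarith [r1.2]) (by linarith [r2.2]), mul_one]
      · rw [mem_Ioc, not_and_or, not_lt, not_le] at hin
        rw [indicator_of_notMem (by rw [mem_Ioc, not_and_or, not_lt, not_le]; exact hin)]
        rcases hin with h | h
        · have h1 : t < b := lt_of_le_of_ne h ht.1
          filter_upwards [Ioo_mem_nhdsGT (sub_pos.2 h1)] with r r1
          rw [hχout r r1.1 t (fun h => by linarith [h.1, r1.2]), mul_zero]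
        · filter_upwards [Ioo_mem_nhdsGT (sub_pos.2 h)] with r r1
          rw [hχout r r1.1 t (fun h => by linarith [h.2, r1.2]), mul_zero]
  have l4 := (l1.sub l2).add l3
  have h5 := ge_of_tendsto l4 (by
    filter_upwards [Ioo_mem_nhdsGT one_pos] with r hr using hineq r hr)
  rw [setIntegral_indicator measurableSet_Ioc, inter_eq_right.2
    (Ioc_subset_Ioc hb (by linarith)), ← intervalIntegral.integral_of_le hbc] at h5
  simp only [hG', max_eq_right hb, max_eq_right (hb.trans hbc)] at h5
  linarith

/-! ### Entropy solutions satisfy the entropy inequalities between two times -/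

theorem abs_abs_sub_sub_abs_sub_le (κ a b : ℝ) : |(|a - κ|) - (|b - κ|)| ≤ 1 * |a - b| := by
  rw [one_mul]
  exact (abs_abs_sub_abs_le_abs_sub _ _).trans (by rw [sub_sub_sub_cancel_right])

theorem volume_restrict_Ioi_prod_univ :
    (volume : Measure (ℝ × ℝ)).restrict (Ioi (0 : ℝ) ×ˢ univ)
      = (volume.restrict (Ioi 0)).prod volume := by
  rw [Measure.volume_eq_prod, ← Measure.prod_restrict, Measure.restrict_univ]

/-! ### From space-time test functions to time slices -/

section Flux

variable {q v : ℝ → ℝ → ℝ} {F : ℝ}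

theorem IsKruzkovFlux.continuous_right (hq : IsKruzkovFlux q F) (κ : ℝ) : Continuous (q κ) :=
  hq.continuous.comp (by fun_prop : Continuous fun x : ℝ => (κ, x))

theorem IsTimeFamily.integrable_comp_mul (hv : IsTimeFamily v) {θ : ℝ → ℝ} (hθ : Continuous θ)
    {ψ : ℝ × ℝ → ℝ} (hψ : Integrable ψ ((volume.restrict (Ioi 0)).prod volume)) :
    Integrable (fun z : ℝ × ℝ => θ (v z.1 z.2) * ψ z) ((volume.restrict (Ioi 0)).prod volume) := by
  obtain ⟨C, hC⟩ := isCompact_Icc.exists_bound_of_continuousOn (hθ.continuousOn (s := Icc (0 : ℝ) 1))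
  exact hψ.bdd_mul (hθ.comp_aestronglyMeasurable hv.aestronglyMeasurable)
    (Eventually.of_forall fun z => hC _ (hv.mem _ _))

theorem IsTimeFamily.integrableOn_flux (hv : IsTimeFamily v) {θ : ℝ → ℝ}
    (hθ : Continuous θ) {ψ : ℝ → ℝ} (hψ : Integrable ψ) (T : ℝ) :
    IntegrableOn (fun s => ∫ x, θ (v s x) * ψ x) (Ioc 0 T) := by
  obtain ⟨C, hC⟩ := isCompact_Icc.exists_bound_of_continuousOn (hθ.continuousOn (s := Icc (0 : ℝ) 1))
  have h1 : Integrable (fun z : ℝ × ℝ => ψ z.2) ((volume.restrict (Ioc 0 T)).prod volume) := by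
    simpa using (integrable_const (μ := volume.restrict (Ioc 0 T)) (1 : ℝ)).mul_prod hψ
  have h2 := h1.bdd_mul (hθ.comp_aestronglyMeasurable (hv.restrict (b := T) le_rfl))
    (Eventually.of_forall fun z => hC _ (hv.mem _ _))
  exact h2.integral_prod_left

/-- Product test functions χ(t) φ(x) reduce the space-time inequality to the scalar one for G(t) = ∫
|v(t) - κ| φ; continuity in time into L¹_loc makes G continuous. -/
theorem isSliceEntropic_of_entropy (hq : IsKruzkovFlux q F) (hv : IsTimeFamily v)
    (hcont : ∀ t, 0 ≤ t → ∀ R : ℝ,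
      Tendsto (fun s => ∫⁻ x in Icc (-R) R, ‖v s x - v t x‖ₑ) (𝓝[Ici 0] t) (𝓝 0))
    (hent : ∀ κ ∈ Icc (0 : ℝ) 1, ∀ φ : ℝ × ℝ → ℝ,
      ContDiff ℝ 1 φ → HasCompactSupport φ → (∀ z, 0 ≤ φ z) →
      0 ≤ (∫ z, (|v z.1 z.2 - κ| * deriv (fun s => φ (s, z.2)) z.1
            + q κ (v z.1 z.2) * deriv (fun y => φ (z.1, y)) z.2)
            ∂((volume.restrict (Ioi 0)).prod volume))
        + ∫ x, |v 0 x - κ| * φ (0, x)) : IsSliceEntropic q v := by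
  intro κ hκ φ hφ hφs hφ0 b c hb hbc
  have hφi : Integrable φ := hφ.continuous.integrable_of_hasCompactSupport hφs
  have hφ'c := continuous_deriv_of_contDiff hφ
  have hφ'i : Integrable (deriv φ) := integrable_deriv_of_contDiff hφ hφs
  have hE : Continuous (fun x : ℝ => |x - κ|) := by fun_prop
  have hqc := hq.continuous_right κ
  refine le_add_integral_of_test (G := fun t => ∫ x, |v t x - κ| * φ x)
    (H := fun s => ∫ x, q κ (v s x) * deriv φ x) ?_ ?_ ?_ hb hbc
  · exact continuousOn_integral_comp_mul (θ := fun x => |x - κ|) hE (fun a _ b _ => abs_abs_sub_sub_abs_sub_le κ a b)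
      zero_le_one hv hcont hφ.continuous hφs
  · intro T
    exact hv.integrableOn_flux hqc hφ'i T
  · intro χ hχ hχs hχ0
    have hχi : Integrable χ := hχ.continuous.integrable_of_hasCompactSupport hχs
    have hχ'i : Integrable (deriv χ) := integrable_deriv_of_contDiff hχ hχs
    have h1 := hent κ hκ (fun z => χ z.1 * φ z.2)
      ((hχ.comp contDiff_fst).mul (hφ.comp contDiff_snd)) ?_
      (fun z => mul_nonneg (hχ0 _) (hφ0 _))
    · have i1 := hv.integrable_comp_mul hE (hχ'i.restrict (s := Ioi 0) |>.mul_prod hφi)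
      have i2 := hv.integrable_comp_mul hqc (hχi.restrict (s := Ioi 0) |>.mul_prod hφ'i)
      simp only [deriv_mul_const_field, deriv_const_mul_field] at h1
      have i3 : Integrable (fun z : ℝ × ℝ => |v z.1 z.2 - κ| * (deriv χ z.1 * φ z.2)
          + q κ (v z.1 z.2) * (χ z.1 * deriv φ z.2)) ((volume.restrict (Ioi 0)).prod volume) :=
        i1.add i2
      rw [integral_prod _ i3] at h1
      refine h1.trans (le_of_eq ?_)
      congr 1
      · refine setIntegral_congr_fun measurableSet_Ioi fun t ht => ?_
        have s1 := integrable_comp_mul hE (hv.slice t (le_of_lt ht)) (hv.mem t) hφi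
        have s2 := integrable_comp_mul hqc (hv.slice t (le_of_lt ht)) (hv.mem t) hφ'i
        simp only
        rw [← integral_mul_const, ← integral_mul_const, ← integral_add (s1.mul_const _) (s2.mul_const _)]
        refine integral_congr_ae (Eventually.of_forall fun x => ?_)
        simp only
        ring
      · rw [← integral_mul_const]
        refine integral_congr_ae (Eventually.of_forall fun x => ?_)
        simp only
        ring
    · refine HasCompactSupport.intro (hχs.isCompact.prod hφs.isCompact) fun z hz => ?_
      rw [mem_prod, not_and_or] at hz
      rcases hz with hz | hz
      · rw [image_eq_zero_of_notMem_tsupport hz, zero_mul]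
      · rw [image_eq_zero_of_notMem_tsupport hz, mul_zero]

end Flux

/-! ### Entropy solutions with values clamped to [0,1] -/

section Solution

variable {V ρ₀ : ℝ → ℝ} {ρ : ℝ → ℝ → ℝ}

/-- Replaces the values of `ρ` outside `[0,1]`. -/
def clampFamily (ρ : ℝ → ℝ → ℝ) (t x : ℝ) : ℝ := max 0 (min 1 (ρ t x))

theorem IsEntropySolution.isTimeFamily (hρ : IsEntropySolution V ρ₀ ρ) :
    IsTimeFamily (clampFamily ρ) where
  aestronglyMeasurable := by
    have h := hρ.aestronglyMeasurable
    rw [volume_restrict_Ioi_prod_univ] at h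
    exact (by fun_prop : Continuous fun x : ℝ => max 0 (min 1 x)).comp_aestronglyMeasurable h
  slice t ht := (by fun_prop : Continuous fun x : ℝ => max 0 (min 1 x)).comp_aestronglyMeasurable
    (hρ.slice_aestronglyMeasurable t ht)
  mem t x := clamp_mem _

theorem IsEntropySolution.clampFamily_ae (hρ : IsEntropySolution V ρ₀ ρ) {t : ℝ} (ht : 0 ≤ t) :
    clampFamily ρ t =ᵐ[volume] ρ t :=
  (hρ.mem_Icc t ht).mono fun _ hx => clamp_eq hx

/-- The bound is given slice by slice. Passing to an a.e. statement on the product requires a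
measurable set, hence the detour through a measurable representative. -/
theorem IsEntropySolution.ae_mem_Icc (hρ : IsEntropySolution V ρ₀ ρ) :
    ∀ᵐ z ∂((volume.restrict (Ioi (0 : ℝ))).prod (volume : Measure ℝ)),
      ρ z.1 z.2 ∈ Icc (0 : ℝ) 1 := by
  have h := hρ.aestronglyMeasurable
  rw [volume_restrict_Ioi_prod_univ] at h
  obtain ⟨g, hg, hgρ⟩ := h
  have h1 := Measure.ae_ae_of_ae_prod hgρ
  have h2 : ∀ᵐ z ∂((volume.restrict (Ioi (0 : ℝ))).prod (volume : Measure ℝ)),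
      g z ∈ Icc (0 : ℝ) 1 := by
    rw [Measure.ae_prod_iff_ae_ae (hg.measurable measurableSet_Icc)]
    filter_upwards [h1, ae_restrict_mem measurableSet_Ioi] with t ht ht0
    filter_upwards [ht, hρ.mem_Icc t (le_of_lt ht0)] with x hx hx1
    rwa [← hx]
  filter_upwards [h2, hgρ] with z hz hz1
  rwa [hz1]

theorem kruzkovFlux_clampVelocity {κ ξ : ℝ} (hκ : κ ∈ Icc (0 : ℝ) 1) (hξ : ξ ∈ Icc (0 : ℝ) 1) :
    kruzkovFlux (clampVelocity V) κ ξ = kruzkovFlux V κ ξ := by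
  rw [kruzkovFlux, kruzkovFlux, clampVelocity_eq V hκ, clampVelocity_eq V hξ]

theorem IsEntropySolution.isSliceEntropic (hV : IsVelocity V) (hρ : IsEntropySolution V ρ₀ ρ) :
    IsSliceEntropic (kruzkovFlux (clampVelocity V)) (clampFamily ρ) := by
  refine isSliceEntropic_of_entropy hV.isGlobalVelocity.isKruzkovFlux hρ.isTimeFamily ?_ ?_
  · intro t ht R
    refine (hρ.continuous_L1loc t ht R).congr' ?_
    filter_upwards [self_mem_nhdsWithin] with s hs
    refine lintegral_congr_ae (ae_restrict_of_ae ?_)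
    filter_upwards [hρ.clampFamily_ae ht, hρ.clampFamily_ae hs] with x h1 h2
    rw [h1, h2]
  · intro κ hκ φ hφ hφs hφ0
    have h1 := hρ.entropy κ hκ φ hφ hφs hφ0
    rw [volume_restrict_Ioi_prod_univ] at h1
    refine h1.trans (le_of_eq ?_)
    congr 1
    · refine integral_congr_ae (hρ.ae_mem_Icc.mono fun z hz => ?_)
      simp only [clampFamily]
      rw [clamp_eq hz, kruzkovFlux_clampVelocity hκ hz]
    · refine integral_congr_ae ?_
      filter_upwards [hρ.clampFamily_ae le_rfl, hρ.initial] with x h1 h2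
      rw [h1, h2]

end Solution

/-! ### Error estimates, uniqueness and convergence -/

section Bounds

variable {V ρ₀ : ℝ → ℝ} {ρ : ℝ → ℝ → ℝ} {lam c : ℝ} {γ₀ : ℝ → ℝ → ℝ}

theorem supNorm_nonneg (f : ℝ → ℝ) : 0 ≤ supNorm f := ENNReal.toReal_nonneg

theorem IsGeometricFamily.mem_Ioo (hγ : IsGeometricFamily c γ₀) {ε h : ℝ} (hε : 0 < ε)
    (hh : 0 < h) : γ₀ ε h ∈ Ioo (0 : ℝ) 1 :=
  ⟨(hγ ε h hε hh).1, (hγ ε h hε hh).2.1⟩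

theorem IsGeometricFamily.mul_le (hγ : IsGeometricFamily c γ₀) {ε h : ℝ} (hε : 0 < ε)
    (hh : 0 < h) : h * ((1 - γ₀ ε h) / γ₀ ε h) ≤ c * ε := by
  have := mul_le_mul_of_nonneg_left (hγ ε h hε hh).2.2 hh.le
  refine this.trans (le_of_eq ?_)
  field_simp

theorem approxImpact_eq (hV : IsVelocity V) (h0 : IsInitialDatum ρ₀) (hlam : 0 < lam)
    (hcfl : CFL lam V) (hγ : IsGeometricFamily c γ₀) {ε h : ℝ} (hε : 0 < ε) (hh : 0 < h) (t x : ℝ) :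
    approxImpact V ρ₀ lam γ₀ ε h t x
      = impactFun (clampVelocity V) ρ₀ lam h (γ₀ ε h) ⌊t / (lam * h)⌋₊ x := by
  rw [approxImpact, reconstruct, impactFun, numImpact, numImpact,
    density_clampVelocity hV h0 (hγ.mem_Ioo hε hh) hlam hcfl hh, cellIndex]

theorem approxDensity_eq (hV : IsVelocity V) (h0 : IsInitialDatum ρ₀) (hlam : 0 < lam)
    (hcfl : CFL lam V) (hγ : IsGeometricFamily c γ₀) {ε h : ℝ} (hε : 0 < ε) (hh : 0 < h) (t x : ℝ) :
    approxDensity V ρ₀ lam γ₀ ε h t x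
      = density (clampVelocity V) ρ₀ lam h (geomWeight (γ₀ ε h)) ⌊t / (lam * h)⌋₊
        (cellIndex h x) := by
  rw [approxDensity, reconstruct, density_clampVelocity hV h0 (hγ.mem_Ioo hε hh) hlam hcfl hh,
    cellIndex]

theorem lintegral_approxDensity_sub_approxImpact_le (hV : IsVelocity V) (h0 : IsInitialDatum ρ₀)
    (hlam : 0 < lam) (hcfl : CFL lam V) (hγ : IsGeometricFamily c γ₀) {ε h : ℝ} (hε : 0 < ε)
    (hh : 0 < h) (t : ℝ) :
    ∫⁻ x, ‖approxDensity V ρ₀ lam γ₀ ε h t x - approxImpact V ρ₀ lam γ₀ ε h t x‖ₑ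
      ≤ ENNReal.ofReal (c * ε) * essVariation ρ₀ := by
  simp_rw [approxDensity_eq hV h0 hlam hcfl hγ hε hh, approxImpact_eq hV h0 hlam hcfl hγ hε hh]
  refine (lintegral_density_sub_impactFun_le hV.isGlobalVelocity h0 (hγ.mem_Ioo hε hh) hlam hcfl hh
    _).trans ?_
  exact mul_le_mul_left (ENNReal.ofReal_le_ofReal (hγ.mul_le hε hh)) _

/-- The distance of the initial numerical impact and the initial datum. -/
theorem lintegral_impactFun_zero_sub_le {M L g h : ℝ} (hV : IsGlobalVelocity V M L)
    (h0 : IsInitialDatum ρ₀)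
    (hg : g ∈ Ioo (0 : ℝ) 1) (hlam : 0 < lam) (hcfl : lam * (M + L) ≤ 1) (hh : 0 < h) :
    ∫⁻ x, ‖ρ₀ x - impactFun V ρ₀ lam h g 0 x‖ₑ
      ≤ ENNReal.ofReal (2 * h + h * ((1 - g) / g)) * essVariation ρ₀ := by
  have hg0 := hg.1
  have hg1 : 0 ≤ 1 - g := by linarith [hg.2]
  rw [ENNReal.ofReal_add (by positivity) (by positivity), add_mul]
  refine le_trans ?_ (add_le_add (h0.lintegral_cellAverage_sub_le hh)
    (lintegral_density_sub_impactFun_le hV h0 hg hlam hcfl hh 0))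
  have hm : AEMeasurable (fun x => ‖cellAverage h ρ₀ (cellIndex h x) - ρ₀ x‖ₑ) :=
    (((Measurable.of_discrete (f := cellAverage h ρ₀)).comp
      (measurable_cellIndex h)).aestronglyMeasurable.sub h0.aestronglyMeasurable).enorm
  rw [← lintegral_add_left' hm]
  refine lintegral_mono fun x => ?_
  rw [← enorm_neg (cellAverage h ρ₀ (cellIndex h x) - ρ₀ x)]
  refine le_trans (le_of_eq ?_) (enorm_add_le _ _)
  congr 1
  change _ = _ + (cellAverage h ρ₀ (cellIndex h x) - impactFun V ρ₀ lam h g 0 x)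
  ring

/-- The constant in the error estimate, in terms of the mollifier constant `c₀`. -/
def errorConst (c₀ M L c : ℝ) : ℝ :=
  5 + 2 * |c| + c₀ * (2 * |M| + |L|) * (4 + 2 * |c|)

theorem errorConst_pos {c₀ : ℝ} (hc₀ : 0 ≤ c₀) (M L c : ℝ) : 0 < errorConst c₀ M L c := by
  unfold errorConst; positivity

/-- The constant is smaller by c than the final one, which leaves room for the distance c ε TV
between density and impact. -/
theorem lintegral_approxImpact_sub_le {c₀ : ℝ} (hc₀ : 0 ≤ c₀)
    (hmol : ∀ r : ℝ, 0 < r → ∃ ω, IsMollifier ω r (c₀ / r))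
    (hV : IsVelocity V) (h0 : IsInitialDatum ρ₀) (hρ : IsEntropySolution V ρ₀ ρ)
    (hlam : 0 < lam) (hc : 0 < c) (hcfl : CFL lam V) (hγ : IsGeometricFamily c γ₀)
    {ε h t : ℝ} (hε : 0 < ε) (hh : 0 < h) (ht : 0 < t) :
    ∫⁻ x, ‖approxImpact V ρ₀ lam γ₀ ε h t x - ρ t x‖ₑ ≤
      ENNReal.ofReal ((errorConst c₀ (supNorm V) (supNorm (deriv V)) c - c)
        * (ε + h + √(ε * t) + √(h * t))) * essVariation ρ₀ := by
  have hg := hγ.mem_Ioo hε hh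
  have hgl := hγ.mul_le hε hh
  set g := γ₀ ε h
  set M := supNorm V with hMdef
  set L := supNorm (deriv V) with hLdef
  have hM : 0 ≤ M := supNorm_nonneg _
  have hL : 0 ≤ L := supNorm_nonneg _
  have hVg : IsGlobalVelocity (clampVelocity V) M L := hV.isGlobalVelocity
  have hcfl' : lam * (M + L) ≤ 1 := hcfl
  have ap := isApproximation hVg h0 hg hlam hcfl' hh
  have hrpos : 0 < (h + ε) * t := by positivity
  -- Balances the mollification error, proportional to r, with the flux and time errors, of order (h
  -- + ε) t / r.
  set r := √((h + ε) * t) with hrdef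
  have hr : 0 < r := Real.sqrt_pos.2 hrpos
  have hr2 : r ^ 2 = (h + ε) * t := Real.sq_sqrt hrpos.le
  obtain ⟨ω, hω⟩ := hmol r hr
  have hsl := hρ.isSliceEntropic hV
  set TV := (essVariation ρ₀).toReal with hTVdef
  have hTV : 0 ≤ TV := ENNReal.toReal_nonneg
  have hTVe : essVariation ρ₀ = ENNReal.ofReal TV := (ENNReal.ofReal_toReal h0.tv_lt_top.ne).symm
  have hg0 := hg.1
  have hg1 : 0 ≤ 1 - g := by linarith [hg.2]
  have key := lintegral_sub_le hVg.isKruzkovFlux ap (by positivity) hρ.isTimeFamily hω hr.le ht.le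
    (fun x κ hκ b c hb hbc _ => hsl.mollified hω x hκ hb hbc)
  have e1 : ∫⁻ x, ‖approxImpact V ρ₀ lam γ₀ ε h t x - ρ t x‖ₑ
      = ∫⁻ y, ‖clampFamily ρ t y
        - impactFun (clampVelocity V) ρ₀ lam h g ⌊t / (lam * h)⌋₊ y‖ₑ := by
    refine lintegral_congr_ae ?_
    filter_upwards [hρ.clampFamily_ae ht.le] with x hx
    rw [hx, approxImpact_eq hV h0 hlam hcfl hγ hε hh, ← enorm_neg, neg_sub]
  have e2 : ∫⁻ y, ‖clampFamily ρ 0 y - impactFun (clampVelocity V) ρ₀ lam h g 0 y‖ₑ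
      ≤ ENNReal.ofReal ((2 * h + c * ε) * TV) := by
    rw [ENNReal.ofReal_mul (by positivity), ← hTVe]
    refine le_trans (le_of_eq ?_) ((lintegral_impactFun_zero_sub_le hVg h0 hg hlam hcfl' hh).trans ?_)
    · refine lintegral_congr_ae ?_
      filter_upwards [hρ.clampFamily_ae le_rfl, hρ.initial] with x h1 h2
      rw [h1, h2]
    · gcongr
  have hS : 0 ≤ (M + L) * TV := by positivity
  rw [e1]
  refine (key.trans (add_le_add e2 le_rfl)).trans ?_
  rw [hTVe, ← ENNReal.ofReal_mul', ← ENNReal.ofReal_add (by positivity) (by positivity)]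
  swap
  · exact hTV
  refine ENNReal.ofReal_le_ofReal ?_
  have b1 : lam * h * ((M + L) * TV) ≤ h * TV := by
    have := mul_le_mul_of_nonneg_right hcfl' (mul_nonneg hh.le hTV)
    linarith
  -- The only link between g and ε: 1/g = 1 + (1-g)/g.
  have b2 : h * (1 + 2 / g) ≤ 3 * h + 2 * (c * ε) := by
    have : h * (1 + 2 / g) = 3 * h + 2 * (h * ((1 - g) / g)) := by field_simp; ring
    linarith
  have hF : 0 ≤ 2 * M + L := by positivity
  have b3 : c₀ / r * (h * (1 + 2 / g) * ((2 * M + L) * TV))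
      + (2 * M + L) * (c₀ / r * (lam * h * ((M + L) * TV)))
      ≤ c₀ / r * ((2 * M + L) * TV) * ((4 + 2 * c) * (h + ε)) := by
    have i1 : (2 * M + L) * (c₀ / r * (lam * h * ((M + L) * TV)))
        ≤ (2 * M + L) * (c₀ / r * (h * TV)) := by gcongr
    have i2 : c₀ / r * (h * (1 + 2 / g) * ((2 * M + L) * TV))
        ≤ c₀ / r * ((3 * h + 2 * (c * ε)) * ((2 * M + L) * TV)) := by gcongr
    have i3 : 4 * h + 2 * (c * ε) ≤ (4 + 2 * c) * (h + ε) := by nlinarith [mul_pos hc hh]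
    have i4 := mul_le_mul_of_nonneg_left i3
      (by positivity : 0 ≤ c₀ / r * ((2 * M + L) * TV))
    linarith
  have b4 : t * (c₀ / r * (h * (1 + 2 / g) * ((2 * M + L) * TV))
      + (2 * M + L) * (c₀ / r * (lam * h * ((M + L) * TV))))
      ≤ c₀ * (2 * M + L) * (4 + 2 * c) * r * TV := by
    refine (mul_le_mul_of_nonneg_left b3 ht.le).trans (le_of_eq ?_)
    have : t * (h + ε) = r ^ 2 := by rw [hr2]; ring
    calc _ = c₀ / r * ((2 * M + L) * TV) * (4 + 2 * c) * (t * (h + ε)) := by ring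
      _ = _ := by rw [this]; field_simp
  have b5 : r ≤ √(ε * t) + √(h * t) := by
    rw [hrdef, add_mul, add_comm (√(ε * t))]
    rw [Real.sqrt_le_left (by positivity), add_sq, Real.sq_sqrt (by positivity),
      Real.sq_sqrt (by positivity)]
    have := mul_nonneg (Real.sqrt_nonneg (h * t)) (Real.sqrt_nonneg (ε * t))
    linarith
  have b6 : c₀ * (2 * M + L) * (4 + 2 * c) * r + 2 * r
      ≤ (c₀ * (2 * M + L) * (4 + 2 * c) + 2) * (√(ε * t) + √(h * t)) := by
    rw [← add_mul]
    exact mul_le_mul_of_nonneg_left b5 (by positivity)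
  have hs1 : 0 ≤ √(ε * t) + √(h * t) := by positivity
  rw [errorConst, abs_of_nonneg hM, abs_of_nonneg hL, abs_of_pos hc]
  have hK : 0 ≤ c₀ * (2 * M + L) * (4 + 2 * c) := by positivity
  have b7 : (2 * h + c * ε) + h + (c₀ * (2 * M + L) * (4 + 2 * c) + 2) * (√(ε * t) + √(h * t))
      ≤ (5 + 2 * c + c₀ * (2 * M + L) * (4 + 2 * c) - c) * (ε + h + √(ε * t) + √(h * t)) := by
    nlinarith [mul_nonneg hK hε.le, mul_nonneg hK hh.le, mul_nonneg hc.le hs1, mul_pos hc hh,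
      mul_pos hc hε]
  have b8 := mul_le_mul_of_nonneg_right b7 hTV
  have b9 := mul_le_mul_of_nonneg_right b6 hTV
  linarith

theorem errorBound_approxImpact {c₀ : ℝ} (hc₀ : 0 ≤ c₀)
    (hmol : ∀ r : ℝ, 0 < r → ∃ ω, IsMollifier ω r (c₀ / r))
    (hV : IsVelocity V) (h0 : IsInitialDatum ρ₀) (hρ : IsEntropySolution V ρ₀ ρ)
    (hlam : 0 < lam) (hc : 0 < c) (hcfl : CFL lam V) (hγ : IsGeometricFamily c γ₀) :
    ErrorBound (errorConst c₀ (supNorm V) (supNorm (deriv V)) c) ρ₀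
      (approxImpact V ρ₀ lam γ₀) ρ := by
  intro ε h t hε hh ht
  refine (lintegral_approxImpact_sub_le hc₀ hmol hV h0 hρ hlam hc hcfl hγ hε hh ht).trans ?_
  gcongr
  linarith

theorem measurable_approx (τ h : ℝ) (u : ℕ → ℤ → ℝ) :
    Measurable (fun z : ℝ × ℝ => reconstruct τ h u z.1 z.2) := by
  have h1 : Measurable (fun z : ℝ × ℝ => (⌊z.1 / τ⌋₊, ⌊z.2 / h + 1 / 2⌋)) :=
    (Nat.measurable_floor.comp (measurable_fst.div_const τ)).prodMk
      (Int.measurable_floor.comp ((measurable_snd.div_const h).add_const (1 / 2)))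
  exact (Measurable.of_discrete (f := fun p : ℕ × ℤ => u p.1 p.2)).comp h1

theorem errorBound_approxDensity {c₀ : ℝ} (hc₀ : 0 ≤ c₀)
    (hmol : ∀ r : ℝ, 0 < r → ∃ ω, IsMollifier ω r (c₀ / r))
    (hV : IsVelocity V) (h0 : IsInitialDatum ρ₀) (hρ : IsEntropySolution V ρ₀ ρ)
    (hlam : 0 < lam) (hc : 0 < c) (hcfl : CFL lam V) (hγ : IsGeometricFamily c γ₀) :
    ErrorBound (errorConst c₀ (supNorm V) (supNorm (deriv V)) c) ρ₀
      (approxDensity V ρ₀ lam γ₀) ρ := by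
  intro ε h t hε hh ht
  have h1 := lintegral_approxImpact_sub_le hc₀ hmol hV h0 hρ hlam hc hcfl hγ hε hh ht
  have h2 := lintegral_approxDensity_sub_approxImpact_le hV h0 hlam hcfl hγ hε hh t
  have hm : Measurable (fun x =>
      ‖approxDensity V ρ₀ lam γ₀ ε h t x - approxImpact V ρ₀ lam γ₀ ε h t x‖ₑ) :=
    (((measurable_approx _ _ _).comp measurable_prodMk_left).sub
      ((measurable_approx _ _ _).comp measurable_prodMk_left)).enorm
  set K := errorConst c₀ (supNorm V) (supNorm (deriv V)) c with hK
  have hKc : 0 ≤ K - c := by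
    have : 0 ≤ c₀ * (2 * |supNorm V| + |supNorm (deriv V)|) * (4 + 2 * |c|) := by positivity
    rw [hK, errorConst]
    linarith [le_abs_self c]
  set A := ε + h + √(ε * t) + √(h * t) with hA
  have hA0 : ε ≤ A := by rw [hA]; linarith [Real.sqrt_nonneg (ε * t), Real.sqrt_nonneg (h * t)]
  calc _ ≤ ∫⁻ x, (‖approxDensity V ρ₀ lam γ₀ ε h t x - approxImpact V ρ₀ lam γ₀ ε h t x‖ₑ
        + ‖approxImpact V ρ₀ lam γ₀ ε h t x - ρ t x‖ₑ) := by
        refine lintegral_mono fun x => le_trans (le_of_eq ?_) (enorm_add_le _ _)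
        rw [sub_add_sub_cancel]
    _ ≤ ENNReal.ofReal (c * ε) * essVariation ρ₀ + ENNReal.ofReal ((K - c) * A) * essVariation ρ₀ := by
        rw [lintegral_add_left hm]
        exact add_le_add h2 h1
    _ ≤ _ := by
        rw [← add_mul, ← ENNReal.ofReal_add (by positivity) (mul_nonneg hKc (hε.le.trans hA0))]
        gcongr
        nlinarith [mul_le_mul_of_nonneg_left hA0 hc.le]

theorem tendsto_errorRate (K T : ℝ) (ρ₀ : ℝ → ℝ) (h0 : IsInitialDatum ρ₀) :
    Tendsto (fun p : ℝ × ℝ => ENNReal.ofReal (K * (p.1 + p.2 + √(p.1 * T) + √(p.2 * T)))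
      * essVariation ρ₀) (𝓝[>] 0 ×ˢ 𝓝[>] 0) (𝓝 0) := by
  have hc : Continuous (fun p : ℝ × ℝ => K * (p.1 + p.2 + √(p.1 * T) + √(p.2 * T))) := by fun_prop
  have h1 := hc.tendsto (0, 0)
  simp only [zero_mul, Real.sqrt_zero, add_zero, mul_zero] at h1
  have h2 : (𝓝[>] (0 : ℝ) ×ˢ 𝓝[>] (0 : ℝ)) ≤ 𝓝 ((0 : ℝ), (0 : ℝ)) := by
    rw [nhds_prod_eq]
    exact Filter.prod_mono nhdsWithin_le_nhds nhdsWithin_le_nhds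
  have h3 := ENNReal.Tendsto.mul_const (b := essVariation ρ₀)
    (ENNReal.tendsto_ofReal (h1.mono_left h2)) (Or.inr h0.tv_lt_top.ne)
  simpa using h3

/-- The bound increases with t, so on a bounded time interval its final value may be integrated. -/
theorem ErrorBound.convergesL1loc {K : ℝ} (hK : 0 ≤ K) (h0 : IsInitialDatum ρ₀)
    {u : ℝ → ℝ → ℝ → ℝ → ℝ} (hu : ErrorBound K ρ₀ u ρ) : ConvergesL1loc u ρ := by
  intro S hS hS0
  obtain ⟨T, hT, hb⟩ := hS.isBounded.subset_closedBall_lt 0 (0 : ℝ × ℝ)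
  have hsub : S ⊆ Icc 0 T ×ˢ univ := by
    intro z hz
    have h1 := hb hz
    rw [mem_closedBall_zero_iff, Prod.norm_def, max_le_iff, Real.norm_eq_abs] at h1
    exact ⟨⟨(hS0 hz).1, (le_abs_self _).trans h1.1⟩, mem_univ _⟩
  have h1 := ENNReal.Tendsto.mul_const (b := ENNReal.ofReal T) (tendsto_errorRate K T ρ₀ h0)
    (Or.inr ENNReal.ofReal_ne_top)
  rw [zero_mul] at h1
  refine tendsto_of_tendsto_of_tendsto_of_le_of_le' tendsto_const_nhds h1
    (Eventually.of_forall fun _ => zero_le) ?_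
  have hpos : ∀ᶠ p : ℝ × ℝ in 𝓝[>] 0 ×ˢ 𝓝[>] 0, 0 < p.1 ∧ 0 < p.2 :=
    (eventually_mem_nhdsWithin (s := Ioi (0 : ℝ))).prod_mk
      (eventually_mem_nhdsWithin (s := Ioi (0 : ℝ)))
  filter_upwards [hpos] with p hp
  have hr : (volume : Measure (ℝ × ℝ)).restrict (Icc 0 T ×ˢ univ)
      = (volume.restrict (Ioc 0 T)).prod volume := by
    rw [Measure.volume_eq_prod, ← Measure.prod_restrict, Measure.restrict_univ,
      restrict_Ioc_eq_restrict_Icc]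
  calc _ ≤ ∫⁻ z in Icc 0 T ×ˢ univ, ‖u p.1 p.2 z.1 z.2 - ρ z.1 z.2‖ₑ := lintegral_mono_set hsub
    _ ≤ ∫⁻ t in Ioc 0 T, ∫⁻ x, ‖u p.1 p.2 t x - ρ t x‖ₑ := by
        rw [hr]; exact lintegral_prod_le _
    _ ≤ ∫⁻ _t in Ioc 0 T, ENNReal.ofReal (K * (p.1 + p.2 + √(p.1 * T) + √(p.2 * T)))
          * essVariation ρ₀ := by
        refine setLIntegral_mono' measurableSet_Ioc fun t ht => ?_
        refine (hu p.1 p.2 t hp.1 hp.2 ht.1).trans ?_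
        have h3 := ht.2
        have h4 := hp.1.le
        have h5 := hp.2.le
        gcongr
    _ = _ := by rw [setLIntegral_const, Real.volume_Ioc, sub_zero]

/-- Both solutions obey the error bound against the same numerical solutions, which do not know
about either of them. -/
theorem IsEntropySolution.unique (hV : IsVelocity V) (h0 : IsInitialDatum ρ₀)
    (hρ : IsEntropySolution V ρ₀ ρ) {ρ' : ℝ → ℝ → ℝ} (hρ' : IsEntropySolution V ρ₀ ρ') {t : ℝ}
    (ht : 0 ≤ t) : ρ' t =ᵐ[volume] ρ t := by
  rcases ht.eq_or_lt with rfl | ht0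
  · exact hρ'.initial.trans hρ.initial.symm
  obtain ⟨c₀, hc₀, hmol⟩ := exists_mollifier
  set M := supNorm V with hM
  set L := supNorm (deriv V) with hL
  have hM0 : 0 ≤ M := supNorm_nonneg _
  have hL0 : 0 ≤ L := supNorm_nonneg _
  set lam := 1 / (M + L + 1) with hlamdef
  have hlam : 0 < lam := by positivity
  have hcfl : CFL lam V := by
    rw [CFL, ← hM, ← hL, hlamdef, one_div, inv_mul_le_iff₀ (by positivity)]
    linarith
  -- Any admissible family would do; for this one (1-γ₀)/γ₀ = ε/h exactly.
  have hγ : IsGeometricFamily 1 (fun ε h : ℝ => h / (h + ε)) := by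
    intro ε h hε hh
    refine ⟨by positivity, by rw [div_lt_one (by positivity)]; linarith, le_of_eq ?_⟩
    field_simp
    ring
  have E1 := errorBound_approxImpact hc₀ hmol hV h0 hρ hlam one_pos hcfl hγ
  have E2 := errorBound_approxImpact hc₀ hmol hV h0 hρ' hlam one_pos hcfl hγ
  set K := errorConst c₀ (supNorm V) (supNorm (deriv V)) 1
  have l1 := tendsto_errorRate K t ρ₀ h0
  have l2 := l1.add l1
  rw [add_zero] at l2
  have hle : ∫⁻ x, ‖ρ' t x - ρ t x‖ₑ ≤ 0 := by
    refine ge_of_tendsto l2 ?_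
    have hpos : ∀ᶠ p : ℝ × ℝ in 𝓝[>] 0 ×ˢ 𝓝[>] 0, 0 < p.1 ∧ 0 < p.2 :=
      (eventually_mem_nhdsWithin (s := Ioi (0 : ℝ))).prod_mk
        (eventually_mem_nhdsWithin (s := Ioi (0 : ℝ)))
    filter_upwards [hpos] with p hp
    have h1 := E1 p.1 p.2 t hp.1 hp.2 ht0
    have h2 := E2 p.1 p.2 t hp.1 hp.2 ht0
    refine le_trans ?_ (add_le_add h2 h1)
    have hm : AEMeasurable (fun x =>
        ‖approxImpact V ρ₀ lam (fun ε h : ℝ => h / (h + ε)) p.1 p.2 t x - ρ' t x‖ₑ) :=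
      (((measurable_approx _ _ _).comp measurable_prodMk_left).aestronglyMeasurable.sub
        (hρ'.slice_aestronglyMeasurable t ht)).enorm
    rw [← lintegral_add_left' hm]
    refine lintegral_mono fun x => ?_
    rw [← enorm_neg (_ - ρ' t x)]
    refine le_trans (le_of_eq ?_) (enorm_add_le _ _)
    congr 1
    ring
  have hmeas : AEMeasurable (fun x => ‖ρ' t x - ρ t x‖ₑ) :=
    ((hρ'.slice_aestronglyMeasurable t ht).sub (hρ.slice_aestronglyMeasurable t ht)).enorm
  rw [nonpos_iff_eq_zero, lintegral_eq_zero_iff' hmeas] at hle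
  filter_upwards [hle] with x hx
  rw [Pi.zero_apply, enorm_eq_zero, sub_eq_zero] at hx
  exact hx

end Bounds

/-! ### From entropy inequalities between two times to the space-time formulation -/

section SpaceTime

variable {q v : ℝ → ℝ → ℝ} {F : ℝ}

theorem tendsto_integral_comp_mul {θ : ℝ → ℝ} {K : ℝ} (hθ : Continuous θ)
    (hK : ∀ a ∈ Icc (0 : ℝ) 1, ∀ b ∈ Icc (0 : ℝ) 1, |θ a - θ b| ≤ K * |a - b|) (hK0 : 0 ≤ K)
    (hv : IsTimeFamily v)
    (hcont : ∀ t, 0 ≤ t → ∀ R : ℝ,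
      Tendsto (fun s => ∫⁻ x in Icc (-R) R, ‖v s x - v t x‖ₑ) (𝓝[Ici 0] t) (𝓝 0))
    {t : ℝ} (ht : 0 ≤ t) {l : Filter ℝ} (hl : l ≤ 𝓝[Ici 0] t) {ψ : ℝ → ℝ → ℝ} {ψ₀ : ℝ → ℝ}
    (hψ : ∀ s, Integrable (ψ s)) (hψ₀ : Continuous ψ₀) (hψ₀s : HasCompactSupport ψ₀)
    (hlim : Tendsto (fun s => ∫ x, |ψ s x - ψ₀ x|) l (𝓝 0)) :
    Tendsto (fun s => ∫ x, θ (v s x) * ψ s x) l (𝓝 (∫ x, θ (v t x) * ψ₀ x)) := by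
  have hi₀ : Integrable ψ₀ := hψ₀.integrable_of_hasCompactSupport hψ₀s
  obtain ⟨C, hC⟩ := isCompact_Icc.exists_bound_of_continuousOn (hθ.continuousOn (s := Icc (0 : ℝ) 1))
  have h1 : Tendsto (fun s => ∫ x, θ (v s x) * ψ₀ x) l (𝓝 (∫ x, θ (v t x) * ψ₀ x)) :=
    (continuousOn_integral_comp_mul hθ hK hK0 hv hcont hψ₀ hψ₀s t ht).tendsto.mono_left hl
  have h2 : Tendsto (fun s => ∫ x, θ (v s x) * (ψ s x - ψ₀ x)) l (𝓝 0) := by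
    refine squeeze_zero_norm' ?_ (by simpa using hlim.const_mul C)
    filter_upwards [hl self_mem_nhdsWithin] with s hs
    have hd := ((hψ s).sub hi₀).abs
    have := norm_integral_le_of_norm_le (hd.const_mul C)
      (f := fun x => θ (v s x) * (ψ s x - ψ₀ x)) (Eventually.of_forall fun x => by
        rw [norm_mul]
        exact mul_le_mul_of_nonneg_right (hC _ (hv.mem s x)) (norm_nonneg _))
    rwa [integral_const_mul] at this
  have h3 := h2.add h1
  rw [zero_add] at h3
  refine h3.congr' ?_
  filter_upwards [hl self_mem_nhdsWithin] with s hs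
  have i1 := integrable_comp_mul hθ (hv.slice s hs) (hv.mem s) ((hψ s).sub hi₀)
  have i2 := integrable_comp_mul hθ (hv.slice s hs) (hv.mem s) hi₀
  have e := integral_add i1 i2
  simp only [Pi.sub_apply] at e
  rw [← e]
  refine integral_congr_ae (Eventually.of_forall fun x => ?_)
  simp only
  ring

theorem hasCompactSupport_slice {ψ : ℝ × ℝ → ℝ} (hψs : HasCompactSupport ψ) (t : ℝ) :
    HasCompactSupport (fun x => ψ (t, x)) := by
  refine HasCompactSupport.intro (hψs.isCompact.image continuous_snd) fun x hx => ?_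
  refine image_eq_zero_of_notMem_tsupport fun h => hx ⟨(t, x), h, rfl⟩

theorem exists_Icc_support_prod {ψ : ℝ × ℝ → ℝ} (hψs : HasCompactSupport ψ) :
    ∃ R : ℝ, 0 < R ∧ ∀ t x, (R < |t| ∨ R < |x|) → ψ (t, x) = 0 := by
  obtain ⟨R, hR, hb⟩ := hψs.isCompact.isBounded.subset_closedBall_lt 0 (0 : ℝ × ℝ)
  refine ⟨R, hR, fun t x hx => ?_⟩
  by_contra h
  have h1 := hb (subset_tsupport ψ h)
  rw [mem_closedBall_zero_iff, Prod.norm_def, max_le_iff, Real.norm_eq_abs, Real.norm_eq_abs] at h1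
  rcases hx with hx | hx <;> linarith [h1.1, h1.2]

theorem tendsto_integral_abs_sub {l : Filter ℝ} [l.IsCountablyGenerated] {ψ : ℝ → ℝ → ℝ}
    {ψ₀ : ℝ → ℝ} {C R : ℝ}
    (hψ : ∀ᶠ s in l, Continuous (ψ s)) (hψ₀ : Continuous ψ₀) (hC : ∀ᶠ s in l, ∀ x, |ψ s x| ≤ C)
    (hC₀ : ∀ x, |ψ₀ x| ≤ C)
    (hR : ∀ᶠ s in l, ∀ x ∉ Icc (-R) R, ψ s x = 0) (hR₀ : ∀ x ∉ Icc (-R) R, ψ₀ x = 0)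
    (hlim : ∀ x, Tendsto (fun s => ψ s x) l (𝓝 (ψ₀ x))) :
    Tendsto (fun s => ∫ x, |ψ s x - ψ₀ x|) l (𝓝 0) := by
  have h0 : (0 : ℝ) = ∫ _x : ℝ, (0 : ℝ) := by simp
  rw [h0]
  refine tendsto_integral_filter_of_dominated_convergence
    ((Icc (-R) R).indicator fun _ => C + C) ?_ ?_ ?_ ?_
  · filter_upwards [hψ] with s hs
    exact (hs.sub hψ₀).abs.aestronglyMeasurable
  · filter_upwards [hC, hR] with s hs hs'
    refine Eventually.of_forall fun x => ?_
    rw [Real.norm_eq_abs, abs_abs]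
    by_cases hx : x ∈ Icc (-R) R
    · rw [indicator_of_mem hx]
      exact (abs_sub _ _).trans (add_le_add (hs x) (hC₀ x))
    · rw [indicator_of_notMem hx, hs' x hx, hR₀ x hx]; simp
  · rw [integrable_indicator_iff measurableSet_Icc]
    exact integrableOn_const (by simp)
  · refine Eventually.of_forall fun x => ?_
    have := ((hlim x).sub_const (ψ₀ x)).abs
    simpa using this

theorem notMem_Icc_neg {R x : ℝ} (hx : x ∉ Icc (-R) R) : R < |x| := by
  by_contra h
  exact hx (abs_le.1 (not_lt.1 h))

theorem continuousOn_integral_comp_mul_prod {θ : ℝ → ℝ} {K : ℝ} (hθ : Continuous θ)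
    (hK : ∀ a ∈ Icc (0 : ℝ) 1, ∀ b ∈ Icc (0 : ℝ) 1, |θ a - θ b| ≤ K * |a - b|) (hK0 : 0 ≤ K)
    (hv : IsTimeFamily v)
    (hcont : ∀ t, 0 ≤ t → ∀ R : ℝ,
      Tendsto (fun s => ∫⁻ x in Icc (-R) R, ‖v s x - v t x‖ₑ) (𝓝[Ici 0] t) (𝓝 0))
    {ψ : ℝ × ℝ → ℝ} (hψ : Continuous ψ) (hψs : HasCompactSupport ψ) :
    ContinuousOn (fun t => ∫ x, θ (v t x) * ψ (t, x)) (Ici 0) := by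
  obtain ⟨R, -, hR⟩ := exists_Icc_support_prod hψs
  obtain ⟨C, hC⟩ := hψ.bounded_above_of_compact_support hψs
  have hs : ∀ t, Continuous (fun x => ψ (t, x)) := fun t => by fun_prop
  intro t ht
  refine tendsto_integral_comp_mul hθ hK hK0 hv hcont ht le_rfl (ψ := fun s x => ψ (s, x))
    (fun s => (hs s).integrable_of_hasCompactSupport (hasCompactSupport_slice hψs s)) (hs t)
    (hasCompactSupport_slice hψs t) ?_
  refine tendsto_integral_abs_sub (C := C) (R := R) (Eventually.of_forall hs) (hs t)
    (Eventually.of_forall fun s x => hC _) (fun x => hC _)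
    (Eventually.of_forall fun s x hx => hR s x (Or.inr (notMem_Icc_neg hx)))
    (fun x hx => hR t x (Or.inr (notMem_Icc_neg hx))) fun x => ?_
  have : Continuous (fun s => ψ (s, x)) := by fun_prop
  exact (this.tendsto t).mono_left nhdsWithin_le_nhds

theorem hasDerivAt_fst {φ : ℝ × ℝ → ℝ} (hφ : ContDiff ℝ 1 φ) (t x : ℝ) :
    HasDerivAt (fun s => φ (s, x)) (fderiv ℝ φ (t, x) (1, 0)) t := by
  have h1 : HasFDerivAt φ (fderiv ℝ φ (t, x)) (t, x) :=
    (hφ.differentiable one_ne_zero _).hasFDerivAt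
  exact h1.comp_hasDerivAt t ((hasDerivAt_id t).prodMk (hasDerivAt_const t x))

theorem hasDerivAt_snd {φ : ℝ × ℝ → ℝ} (hφ : ContDiff ℝ 1 φ) (t x : ℝ) :
    HasDerivAt (fun y => φ (t, y)) (fderiv ℝ φ (t, x) (0, 1)) x := by
  have h1 : HasFDerivAt φ (fderiv ℝ φ (t, x)) (t, x) :=
    (hφ.differentiable one_ne_zero _).hasFDerivAt
  exact h1.comp_hasDerivAt x ((hasDerivAt_const x t).prodMk (hasDerivAt_id x))

theorem continuous_fderiv_apply_const {φ : ℝ × ℝ → ℝ} (hφ : ContDiff ℝ 1 φ) (w : ℝ × ℝ) :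
    Continuous (fun z => fderiv ℝ φ z w) :=
  (hφ.continuous_fderiv one_ne_zero).clm_apply continuous_const

theorem hasCompactSupport_fderiv_apply_const {φ : ℝ × ℝ → ℝ} (hφs : HasCompactSupport φ)
    (w : ℝ × ℝ) : HasCompactSupport (fun z => fderiv ℝ φ z w) :=
  hφs.fderiv_apply (𝕜 := ℝ) w

theorem tendsto_slope_integral {H : ℝ → ℝ} (hH : ContinuousOn H (Ici 0)) {t : ℝ} (ht : 0 ≤ t) :
    Tendsto (fun z => (z - t)⁻¹ * ∫ s in t..z, H s) (𝓝[>] t) (𝓝 (H t)) := by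
  have hc : Continuous (fun s => H (max 0 s)) :=
    hH.comp_continuous (by fun_prop) fun s => le_max_left (0 : ℝ) s
  have h1 := ((hc.integral_hasStrictDerivAt t t).hasDerivAt).hasDerivWithinAt (s := Ioi t)
  rw [hasDerivWithinAt_iff_tendsto_slope' (by simp)] at h1
  simp only [max_eq_right ht] at h1
  refine h1.congr' ?_
  filter_upwards [self_mem_nhdsWithin] with z hz
  rw [slope_def_field, intervalIntegral.integral_same, sub_zero, div_eq_inv_mul]
  congr 1
  refine intervalIntegral.integral_congr fun s hs => ?_
  rw [uIcc_of_le (le_of_lt hz)] at hs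
  simp only [max_eq_right (ht.trans hs.1)]

/-- For a time-dependent φ set G(t) = ∫ |v(t) - κ| φ(t,·). Freezing φ at time t in the slice
inequality bounds the right Dini derivative of G by k(t). Integrating up to a time beyond the
support of φ, where G vanishes, gives the claim. -/
theorem IsSliceEntropic.entropy (hq : IsKruzkovFlux q F) (hv : IsTimeFamily v)
    (hcont : ∀ t, 0 ≤ t → ∀ R : ℝ,
      Tendsto (fun s => ∫⁻ x in Icc (-R) R, ‖v s x - v t x‖ₑ) (𝓝[Ici 0] t) (𝓝 0))
    (hs : IsSliceEntropic q v) {κ : ℝ} (hκ : κ ∈ Icc (0 : ℝ) 1) {φ : ℝ × ℝ → ℝ}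
    (hφ : ContDiff ℝ 1 φ) (hφs : HasCompactSupport φ) (hφ0 : ∀ z, 0 ≤ φ z) :
      0 ≤ (∫ z, (|v z.1 z.2 - κ| * deriv (fun s => φ (s, z.2)) z.1
            + q κ (v z.1 z.2) * deriv (fun y => φ (z.1, y)) z.2)
            ∂((volume.restrict (Ioi 0)).prod volume))
        + ∫ x, |v 0 x - κ| * φ (0, x) := by
  have hφc := hφ.continuous
  have hE : Continuous (fun x : ℝ => |x - κ|) := by fun_prop
  have hEL : ∀ a ∈ Icc (0 : ℝ) 1, ∀ b ∈ Icc (0 : ℝ) 1, |(|a - κ|) - (|b - κ|)| ≤ 1 * |a - b| :=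
    fun a _ b _ => abs_abs_sub_sub_abs_sub_le κ a b
  have hqc := hq.continuous_right κ
  have hqL := hq.lip κ hκ
  set φt : ℝ × ℝ → ℝ := fun z => fderiv ℝ φ z (1, 0) with hφt
  set φx : ℝ × ℝ → ℝ := fun z => fderiv ℝ φ z (0, 1) with hφx
  have hφtc : Continuous φt := continuous_fderiv_apply_const hφ _
  have hφxc : Continuous φx := continuous_fderiv_apply_const hφ _
  have hφts : HasCompactSupport φt := hasCompactSupport_fderiv_apply_const hφs _
  have hφxs : HasCompactSupport φx := hasCompactSupport_fderiv_apply_const hφs _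
  have dt : ∀ t x, HasDerivAt (fun s => φ (s, x)) (φt (t, x)) t := hasDerivAt_fst hφ
  have dx : ∀ t x, HasDerivAt (fun y => φ (t, y)) (φx (t, x)) x := hasDerivAt_snd hφ
  have hsl : ∀ {ψ : ℝ × ℝ → ℝ}, Continuous ψ → ∀ t, Continuous (fun x => ψ (t, x)) :=
    fun h t => by fun_prop
  have hint : ∀ {ψ : ℝ × ℝ → ℝ}, Continuous ψ → HasCompactSupport ψ → ∀ t,
      Integrable (fun x => ψ (t, x)) := fun h h' t =>
    (hsl h t).integrable_of_hasCompactSupport (hasCompactSupport_slice h' t)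
  set G : ℝ → ℝ := fun t => ∫ x, |v t x - κ| * φ (t, x) with hG
  set k : ℝ → ℝ := fun t => (∫ x, |v t x - κ| * φt (t, x)) + ∫ x, q κ (v t x) * φx (t, x) with hk
  have hGc : ContinuousOn G (Ici 0) :=
    continuousOn_integral_comp_mul_prod (θ := fun x => |x - κ|) hE hEL zero_le_one hv hcont hφc hφs
  have hkc : ContinuousOn k (Ici 0) :=
    (continuousOn_integral_comp_mul_prod (θ := fun x => |x - κ|) hE hEL zero_le_one hv hcont hφtc
      hφts).add (continuousOn_integral_comp_mul_prod hqc hqL hq.nonneg hv hcont hφxc hφxs)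
  have hkc' : Continuous (fun s => k (max 0 s)) :=
    hkc.comp_continuous (by fun_prop) fun s => le_max_left (0 : ℝ) s
  obtain ⟨R, hR0, hR⟩ := exists_Icc_support_prod hφs
  obtain ⟨Rt, -, hRt⟩ := exists_Icc_support_prod hφts
  obtain ⟨Rx, -, hRx⟩ := exists_Icc_support_prod hφxs
  obtain ⟨C, hC⟩ := hφtc.bounded_above_of_compact_support hφts
  -- The slope splits into the difference quotient of φ tested with |v(z) - κ|, and the change of |v
  -- - κ| tested with the frozen φ(t,·), to which the slice inequality applies.
  have hdini : ∀ t, 0 ≤ t → ∀ r, k t < r → ∃ᶠ z in 𝓝[>] t, slope G t z < r := by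
    intro t ht r hr
    have l1 : Tendsto (fun z => ∫ x, |v z x - κ| * ((z - t)⁻¹ * (φ (z, x) - φ (t, x)))) (𝓝[>] t)
        (𝓝 (∫ x, |v t x - κ| * φt (t, x))) := by
      refine tendsto_integral_comp_mul (θ := fun x => |x - κ|) hE hEL zero_le_one hv hcont ht
        (l := 𝓝[>] t) (nhdsWithin_mono _ fun z hz => ht.trans (le_of_lt hz))
        (ψ := fun z x => (z - t)⁻¹ * (φ (z, x) - φ (t, x)))
        (fun z => ((hint hφc hφs z).sub (hint hφc hφs t)).const_mul _) (hsl hφtc t)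
        (hasCompactSupport_slice hφts t) ?_
      refine tendsto_integral_abs_sub (C := C) (R := max R Rt)
        (Eventually.of_forall fun z => by fun_prop) (hsl hφtc t) ?_ (fun x => hC _) ?_ ?_ ?_
      · filter_upwards [self_mem_nhdsWithin] with z hz x
        have hz' : 0 < z - t := sub_pos.2 hz
        have := Convex.norm_image_sub_le_of_norm_hasDerivWithin_le (s := univ)
          (f := fun s => φ (s, x)) (f' := fun s => φt (s, x)) (C := C)
          (fun s _ => (dt s x).hasDerivWithinAt) (fun s _ => hC (s, x)) convex_univ
          (mem_univ t) (mem_univ z)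
        rw [Real.norm_eq_abs, Real.norm_of_nonneg hz'.le] at this
        rw [abs_mul, abs_of_pos (inv_pos.2 hz'), inv_mul_le_iff₀ hz', mul_comm]
        exact this
      · refine Eventually.of_forall fun z x hx => ?_
        have := notMem_Icc_neg hx
        rw [hR z x (Or.inr ((le_max_left _ _).trans_lt this)),
          hR t x (Or.inr ((le_max_left _ _).trans_lt this))]
        simp
      · intro x hx
        exact hRt t x (Or.inr ((le_max_right _ _).trans_lt (notMem_Icc_neg hx)))
      · intro x
        have h1 := (dt t x).hasDerivWithinAt (s := Ioi t)
        rw [hasDerivWithinAt_iff_tendsto_slope' (by simp)] at h1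
        exact h1
    have l2 : Tendsto (fun z => (z - t)⁻¹ * ∫ s in t..z, ∫ x, q κ (v s x) * φx (t, x)) (𝓝[>] t)
        (𝓝 (∫ x, q κ (v t x) * φx (t, x))) :=
      tendsto_slope_integral (continuousOn_integral_comp_mul hqc hqL hq.nonneg hv hcont
        (hsl hφxc t) (hasCompactSupport_slice hφxs t)) ht
    have l3 := (l1.add l2).eventually_lt_const hr
    refine Eventually.frequently ?_
    filter_upwards [l3, self_mem_nhdsWithin] with z hz hzt
    refine lt_of_le_of_lt ?_ hz
    have hz' : 0 < z - t := sub_pos.2 hzt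
    have hz0 : 0 ≤ z := ht.trans (le_of_lt hzt)
    have h1 := hs κ hκ (fun x => φ (t, x)) (hφ.comp (by fun_prop)) (hasCompactSupport_slice hφs t)
      (fun x => hφ0 _) t z ht (le_of_lt hzt)
    have hd : deriv (fun x => φ (t, x)) = fun x => φx (t, x) := funext fun x => (dx t x).deriv
    rw [hd] at h1
    have i1 := integrable_comp_mul hE (hv.slice z hz0) (hv.mem z) (hint hφc hφs z)
    have i2 := integrable_comp_mul hE (hv.slice z hz0) (hv.mem z) (hint hφc hφs t)
    have e1 : ∫ x, |v z x - κ| * ((z - t)⁻¹ * (φ (z, x) - φ (t, x)))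
        = (z - t)⁻¹ * (G z - ∫ x, |v z x - κ| * φ (t, x)) := by
      rw [hG, ← integral_sub i1 i2, ← integral_const_mul]
      refine integral_congr_ae (Eventually.of_forall fun x => ?_)
      simp only
      ring
    rw [slope_def_field, div_eq_inv_mul, e1, ← mul_add]
    refine mul_le_mul_of_nonneg_left ?_ (inv_pos.2 hz').le
    simp only [hG]
    linarith
  set T := max R (max Rt Rx) + 1 with hT
  have hRT : R < T := by rw [hT]; linarith [le_max_left R (max Rt Rx)]
  have hRtT : Rt < T := by
    rw [hT]; linarith [le_max_right R (max Rt Rx), le_max_left Rt Rx]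
  have hRxT : Rx < T := by
    rw [hT]; linarith [le_max_right R (max Rt Rx), le_max_right Rt Rx]
  have hT0 : 0 ≤ T := (hR0.trans hRT).le
  -- G is continuous but need not be differentiable, so a comparison theorem for Dini derivatives
  -- replaces the fundamental theorem of calculus.
  have hfin := image_le_of_liminf_slope_right_le_deriv_boundary (f := G) (a := 0) (b := T)
    (B := fun t => G 0 + ∫ s in (0 : ℝ)..t, k (max 0 s)) (B' := fun t => k (max 0 t))
    (hGc.mono fun t ht => ht.1) (by simp)
    (by
      refine (continuous_const.add ?_).continuousOn
      exact continuous_iff_continuousAt.2 fun t =>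
        (hkc'.integral_hasStrictDerivAt 0 t).hasDerivAt.continuousAt)
    (fun t _ => ((hkc'.integral_hasStrictDerivAt 0 t).hasDerivAt.const_add _).hasDerivWithinAt)
    (fun t ht r hr => hdini t ht.1 r (by rwa [max_eq_right ht.1] at hr))
    (right_mem_Icc.2 hT0)
  have hGT : G T = 0 := by
    simp only [hG]
    refine (integral_congr_ae (Eventually.of_forall fun x => ?_)).trans (integral_zero' _ _)
    simp only [Pi.zero_apply]
    rw [hR T x (Or.inl (hRT.trans_le (le_abs_self T))), mul_zero]
  rw [hGT] at hfin
  have i1 := hv.integrable_comp_mul hE (ψ := φt)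
    ((hφtc.integrable_of_hasCompactSupport (μ := volume) hφts).mono_measure (by
      rw [← volume_restrict_Ioi_prod_univ]; exact Measure.restrict_le_self))
  have i2 := hv.integrable_comp_mul hqc (ψ := φx)
    ((hφxc.integrable_of_hasCompactSupport (μ := volume) hφxs).mono_measure (by
      rw [← volume_restrict_Ioi_prod_univ]; exact Measure.restrict_le_self))
  have i3 : Integrable (fun z : ℝ × ℝ => |v z.1 z.2 - κ| * φt z + q κ (v z.1 z.2) * φx z)
      ((volume.restrict (Ioi 0)).prod volume) := i1.add i2
  have e0 : (fun z : ℝ × ℝ => |v z.1 z.2 - κ| * deriv (fun s => φ (s, z.2)) z.1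
            + q κ (v z.1 z.2) * deriv (fun y => φ (z.1, y)) z.2)
      = fun z => |v z.1 z.2 - κ| * φt z + q κ (v z.1 z.2) * φx z := by
    funext z
    rw [(dt z.1 z.2).deriv, (dx z.1 z.2).deriv]
  have e1 : ∫ t in Ioi 0, (∫ x, (|v t x - κ| * φt (t, x) + q κ (v t x) * φx (t, x)))
      = ∫ s in (0 : ℝ)..T, k (max 0 s) := by
    have e2 : ∀ t ∈ Ioi (0 : ℝ),
        (∫ x, (|v t x - κ| * φt (t, x) + q κ (v t x) * φx (t, x))) = k (max 0 t) := by
      intro t ht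
      have ht' : 0 ≤ t := le_of_lt ht
      rw [max_eq_right ht']
      exact integral_add (integrable_comp_mul (θ := fun x => |x - κ|) hE (hv.slice t ht') (hv.mem t) (hint hφtc hφts t))
        (integrable_comp_mul hqc (hv.slice t ht') (hv.mem t) (hint hφxc hφxs t))
    rw [setIntegral_congr_fun measurableSet_Ioi e2, intervalIntegral.integral_of_le hT0]
    refine setIntegral_eq_of_subset_of_forall_sdiff_eq_zero measurableSet_Ioi
      (fun t ht => ht.1) fun t ht => ?_
    have ht0 : 0 < t := ht.1
    have htT : T < t := by
      by_contra h
      exact ht.2 ⟨ht0, not_lt.1 h⟩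
    have hta : T < |t| := htT.trans_le (le_abs_self t)
    rw [max_eq_right ht0.le]
    simp only [hk]
    simp only [hRt t _ (Or.inl (hRtT.trans hta)), hRx t _ (Or.inl (hRxT.trans hta)), mul_zero,
      integral_zero, add_zero]
  rw [e0, integral_prod _ i3, e1]
  simp only [hG] at hfin
  linarith

end SpaceTime

/-! ### Numerical solutions as functions of time -/

/-- The function equal to `u n` for `n τ ≤ t < (n + 1) τ`. -/
def stepFamily (τ : ℝ) (u : ℕ → ℝ → ℝ) (t x : ℝ) : ℝ := u ⌊t / τ⌋₊ x

section Step

variable {q : ℝ → ℝ → ℝ} {F τ h D B S : ℝ} {u : ℕ → ℝ → ℝ} {Q : ℕ → ℝ → ℝ → ℝ}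
  {m : ℕ → ℝ → ℝ}

theorem IsApproximation.measurable_stepFamily (ap : IsApproximation q τ h D B S u Q m) :
    Measurable (fun z : ℝ × ℝ => stepFamily τ u z.1 z.2) := by
  have h1 : Measurable (fun p : ℕ × ℝ => u p.1 p.2) :=
    measurable_from_prod_countable_right fun n => ap.measurable n
  have h2 : Measurable (fun z : ℝ × ℝ => (⌊z.1 / τ⌋₊, z.2)) :=
    (Nat.measurable_floor.comp (measurable_fst.div_const τ)).prodMk measurable_snd
  exact h1.comp h2

theorem IsApproximation.isTimeFamily (ap : IsApproximation q τ h D B S u Q m) :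
    IsTimeFamily (stepFamily τ u) where
  aestronglyMeasurable := ap.measurable_stepFamily.aestronglyMeasurable
  slice _ _ := (ap.measurable _).aestronglyMeasurable
  mem _ _ := ap.mem _ _

theorem IsApproximation.lintegral_add_sub_le (ap : IsApproximation q τ h D B S u Q m) (n k : ℕ) :
    ∫⁻ x, ‖u (n + k) x - u n x‖ₑ ≤ ENNReal.ofReal (k * τ * S) := by
  have hτ := ap.τ_pos
  have hS := ap.S_nonneg
  induction k with
  | zero => simp
  | succ k ih =>
    have hm : Measurable (fun x => ‖u (n + k + 1) x - u (n + k) x‖ₑ) :=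
      ((ap.measurable _).sub (ap.measurable _)).enorm
    calc _ ≤ ∫⁻ x, (‖u (n + k + 1) x - u (n + k) x‖ₑ + ‖u (n + k) x - u n x‖ₑ) := by
          refine lintegral_mono fun x => le_trans (le_of_eq ?_) (enorm_add_le _ _)
          rw [sub_add_sub_cancel, add_assoc]
      _ ≤ ENNReal.ofReal (τ * S) + ENNReal.ofReal (k * τ * S) := by
          rw [lintegral_add_left hm]
          exact add_le_add (ap.time _) ih
      _ = _ := by
          rw [← ENNReal.ofReal_add (by positivity) (by positivity)]
          congr 1
          push_cast
          ring

theorem floor_div_bounds (hτ : 0 < τ) {t : ℝ} (ht : 0 ≤ t) :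
    (⌊t / τ⌋₊ : ℝ) * τ ≤ t ∧ t < ((⌊t / τ⌋₊ : ℝ) + 1) * τ :=
  ⟨(le_div_iff₀ hτ).1 (Nat.floor_le (by positivity)),
    (div_lt_iff₀ hτ).1 (Nat.lt_floor_add_one _)⟩

theorem IsApproximation.lintegral_stepFamily_sub_le (ap : IsApproximation q τ h D B S u Q m)
    {s t : ℝ} (hs : 0 ≤ s) (hst : s ≤ t) :
    ∫⁻ x, ‖stepFamily τ u t x - stepFamily τ u s x‖ₑ ≤ ENNReal.ofReal ((t - s + τ) * S) := by
  have hτ := ap.τ_pos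
  obtain ⟨k, hk⟩ := Nat.exists_eq_add_of_le
    (Nat.floor_le_floor (div_le_div_of_nonneg_right hst hτ.le))
  have h1 := floor_div_bounds hτ hs
  have h2 := floor_div_bounds hτ (hs.trans hst)
  simp only [stepFamily]
  rw [hk]
  refine (ap.lintegral_add_sub_le _ k).trans (ENNReal.ofReal_le_ofReal ?_)
  refine mul_le_mul_of_nonneg_right ?_ ap.S_nonneg
  have hk' : (⌊t / τ⌋₊ : ℝ) = ⌊s / τ⌋₊ + k := by exact_mod_cast hk
  rw [hk'] at h2
  nlinarith [h1.2, h2.1]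

theorem IsApproximation.entropy_step_le (hq : IsKruzkovFlux q F)
    (ap : IsApproximation q τ h D B S u Q m) {κ : ℝ} (hκ : κ ∈ Icc (0 : ℝ) 1) {φ : ℝ → ℝ}
    (hφ : ContDiff ℝ 1 φ) (hφs : HasCompactSupport φ) (hφ0 : ∀ x, 0 ≤ φ x) {C : ℝ}
    (hC : ∀ x, |deriv φ x| ≤ C) (n : ℕ) :
    ∫ x, |u (n + 1) x - κ| * φ x ≤ (∫ x, |u n x - κ| * φ x)
      + τ * (∫ x, q κ (u n x) * deriv φ x) + τ * (C * D) := by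
  obtain ⟨C', hC'⟩ := ap.flux_bound
  have hφi : Integrable φ := hφ.continuous.integrable_of_hasCompactSupport hφs
  have hE : Continuous (fun x : ℝ => |x - κ|) := by fun_prop
  have hqm : Measurable (fun x => q κ (u n x)) :=
    hq.continuous.measurable.comp (measurable_const.prodMk (ap.measurable n))
  have hQm : Measurable (Q n κ) := (ap.measurable_flux n).comp (measurable_const.prodMk measurable_id)
  have h1 := neg_integral_shift_le ap.h_pos hQm (hC' n κ hκ) hqm
    (fun x => hq.abs_le_const hκ (ap.mem n x)) (ap.integrable_error n) (ap.close n κ hκ) hφ hφs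
  have hm0 : ∀ x, 0 ≤ m n x := fun x =>
    (abs_nonneg _).trans (ap.close n κ hκ x 0 ⟨le_rfl, ap.h_pos.le⟩)
  have hC0 : 0 ≤ C := (abs_nonneg _).trans (hC 0)
  have h2 : ∫ x, m n x * |deriv φ x| ≤ C * D := by
    refine le_trans (integral_mono_of_nonneg (g := fun x => C * m n x)
      (Eventually.of_forall fun x => mul_nonneg (hm0 x) (abs_nonneg _))
      ((ap.integrable_error n).const_mul C) (Eventually.of_forall fun x => ?_)) ?_
    · simp only
      rw [mul_comm C]
      exact mul_le_mul_of_nonneg_left (hC x) (hm0 x)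
    · rw [integral_const_mul]
      exact mul_le_mul_of_nonneg_left (ap.integral_error_le n) hC0
  have i1 := integrable_comp_mul hE (ap.measurable (n + 1)).aestronglyMeasurable (ap.mem (n + 1)) hφi
  have i2 := integrable_comp_mul hE (ap.measurable n).aestronglyMeasurable (ap.mem n) hφi
  have hQm' : Measurable (fun x => Q n κ (x + h) - Q n κ x) :=
    (hQm.comp (measurable_id.add_const h)).sub hQm
  have i3 : Integrable (fun x => (Q n κ (x + h) - Q n κ x) * φ x) :=
    hφi.bdd_mul (c := C' + C') hQm'.aestronglyMeasurable (Eventually.of_forall fun x =>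
      (abs_sub _ _).trans (add_le_add (hC' n κ hκ _) (hC' n κ hκ _)))
  have h3 := integral_mono i1 (i2.sub (i3.const_mul (τ / h))) fun x => by
    have := mul_le_mul_of_nonneg_right (ap.entropy n κ x) (hφ0 x)
    simp only [Pi.sub_apply]
    linarith
  rw [integral_sub' i2 (i3.const_mul (τ / h)), integral_const_mul] at h3
  have h4 := mul_le_mul_of_nonneg_left (h1.trans (add_le_add le_rfl h2)) ap.τ_pos.le
  have h5 : τ * -(1 / h * ∫ x, (Q n κ (x + h) - Q n κ x) * φ x)
      = -(τ / h * ∫ x, (Q n κ (x + h) - Q n κ x) * φ x) := by ring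
  rw [h5] at h4
  linarith

/-- Sum the one-step inequalities between the grid times just below b and c. Moving the ends of the
time integral there changes it by at most τ F ∫ |φ'| at each end. -/
theorem IsApproximation.entropy_stepFamily_le (hq : IsKruzkovFlux q F)
    (ap : IsApproximation q τ h D B S u Q m) (hD : 0 ≤ D) {κ : ℝ} (hκ : κ ∈ Icc (0 : ℝ) 1)
    {φ : ℝ → ℝ} (hφ : ContDiff ℝ 1 φ) (hφs : HasCompactSupport φ) (hφ0 : ∀ x, 0 ≤ φ x) {C : ℝ}
    (hC : ∀ x, |deriv φ x| ≤ C) {b c : ℝ} (hb : 0 ≤ b) (hbc : b ≤ c) :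
    ∫ x, |stepFamily τ u c x - κ| * φ x ≤ (∫ x, |stepFamily τ u b x - κ| * φ x)
      + (∫ s in b..c, ∫ x, q κ (stepFamily τ u s x) * deriv φ x)
      + ((c - b + τ) * (C * D) + 2 * τ * (F * ∫ x, |deriv φ x|)) := by
  have hτ := ap.τ_pos
  have hv := ap.isTimeFamily
  have hC0 : 0 ≤ C := (abs_nonneg _).trans (hC 0)
  have hφ'i : Integrable (deriv φ) := integrable_deriv_of_contDiff hφ hφs
  have hqc := hq.continuous_right κ
  set H : ℝ → ℝ := fun s => ∫ x, q κ (stepFamily τ u s x) * deriv φ x with hH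
  have hHi : ∀ x y, 0 ≤ x → 0 ≤ y → IntervalIntegrable H volume x y := by
    intro x y hx hy
    rw [intervalIntegrable_iff]
    refine (hv.integrableOn_flux hqc hφ'i (max x y)).mono_set fun s hs => ?_
    rw [uIoc, mem_Ioc] at hs
    exact ⟨(le_min hx hy).trans_lt hs.1, hs.2⟩
  have hHb : ∀ s, ‖H s‖ ≤ F * ∫ x, |deriv φ x| := by
    intro s
    have := norm_integral_le_of_norm_le (hφ'i.abs.const_mul F)
      (f := fun x => q κ (stepFamily τ u s x) * deriv φ x) (Eventually.of_forall fun x => by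
        rw [norm_mul]
        exact mul_le_mul_of_nonneg_right (hq.abs_le_const hκ (hv.mem s x)) (norm_nonneg _))
    rwa [integral_const_mul] at this
  have hstep : ∀ n k : ℕ, ∫ x, |u (n + k) x - κ| * φ x ≤ (∫ x, |u n x - κ| * φ x)
      + (∫ s in (n * τ)..((n + k : ℕ) * τ), H s) + k * τ * (C * D) := by
    intro n k
    induction k with
    | zero => simp
    | succ k ih =>
      have h1 := ap.entropy_step_le hq hκ hφ hφs hφ0 hC (n + k)
      have h2 : ∫ s in (((n + k : ℕ) : ℝ) * τ)..((n + (k + 1) : ℕ) * τ), H s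
          = τ * ∫ x, q κ (u (n + k) x) * deriv φ x := by
        have hle : ((n + k : ℕ) : ℝ) * τ ≤ ((n + (k + 1) : ℕ) : ℝ) * τ := by
          push_cast; nlinarith
        have h3 : ∫ s in (((n + k : ℕ) : ℝ) * τ)..((n + (k + 1) : ℕ) * τ), H s
            = ∫ s in (((n + k : ℕ) : ℝ) * τ)..((n + (k + 1) : ℕ) * τ),
              (∫ x, q κ (u (n + k) x) * deriv φ x) := by
          rw [intervalIntegral.integral_of_le hle, intervalIntegral.integral_of_le hle,
            ← integral_Ico_eq_integral_Ioc, ← integral_Ico_eq_integral_Ioc]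
          refine setIntegral_congr_fun measurableSet_Ico fun s hs => ?_
          have hs0 : 0 ≤ s := le_trans (by positivity) hs.1
          have hfl : ⌊s / τ⌋₊ = n + k := by
            rw [Nat.floor_eq_iff (by positivity), le_div_iff₀ hτ, div_lt_iff₀ hτ]
            refine ⟨hs.1, hs.2.trans_le (le_of_eq ?_)⟩
            push_cast
            ring
          simp only [hH, stepFamily, hfl]
        rw [h3, intervalIntegral.integral_const, smul_eq_mul]
        congr 1
        push_cast
        ring
      have h3 := intervalIntegral.integral_add_adjacent_intervals
        (hHi (n * τ) ((n + k : ℕ) * τ) (by positivity) (by positivity))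
        (hHi ((n + k : ℕ) * τ) ((n + (k + 1) : ℕ) * τ) (by positivity) (by positivity))
      rw [← h3, h2]
      push_cast at h1 ih ⊢
      rw [← add_assoc] at *
      linarith
  obtain ⟨k, hk⟩ := Nat.exists_eq_add_of_le
    (Nat.floor_le_floor (div_le_div_of_nonneg_right hbc hτ.le))
  have hc := hb.trans hbc
  have h1 := floor_div_bounds hτ hb
  have h2 := floor_div_bounds hτ hc
  have h3 := hstep ⌊b / τ⌋₊ k
  rw [← hk] at h3
  set n₁ := ⌊b / τ⌋₊
  set n₂ := ⌊c / τ⌋₊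
  have hk' : (n₂ : ℝ) = n₁ + k := by exact_mod_cast hk
  have hkτ : k * τ ≤ c - b + τ := by
    have := h2.1
    rw [hk'] at this
    nlinarith [h1.2]
  have h4 : (k * τ) * (C * D) ≤ (c - b + τ) * (C * D) :=
    mul_le_mul_of_nonneg_right hkτ (mul_nonneg hC0 hD)
  have hn₁ : 0 ≤ (n₁ : ℝ) * τ := by positivity
  have hn₂ : 0 ≤ (n₂ : ℝ) * τ := by positivity
  have h5 := intervalIntegral.integral_add_adjacent_intervals (hHi (n₁ * τ) b hn₁ hb)
    (hHi b c hb hc)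
  have h6 := intervalIntegral.integral_add_adjacent_intervals (hHi (n₁ * τ) (n₂ * τ) hn₁ hn₂)
    (hHi (n₂ * τ) c hn₂ hc)
  have hFφ : 0 ≤ F * ∫ x, |deriv φ x| := (norm_nonneg _).trans (hHb 0)
  have h7 : ∀ x y, |y - x| ≤ τ → |∫ s in x..y, H s| ≤ τ * (F * ∫ x, |deriv φ x|) := by
    intro x y hxy
    have := intervalIntegral.norm_integral_le_of_norm_le_const (a := x) (b := y)
      (fun s _ => hHb s)
    rw [mul_comm] at this
    exact this.trans (mul_le_mul_of_nonneg_right hxy hFφ)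
  have h8 := h7 (n₁ * τ) b (by rw [abs_of_nonneg (by linarith)]; linarith)
  have h9 := h7 (n₂ * τ) c (by rw [abs_of_nonneg (by linarith)]; linarith)
  rw [abs_le] at h8 h9
  change ∫ x, |u n₂ x - κ| * φ x ≤ (∫ x, |u n₁ x - κ| * φ x) + _ + _
  linarith [h8.2, h9.1]

end Step

/-! ### Compactness of the numerical solutions -/

section Cauchy

variable {q : ℝ → ℝ → ℝ} {F B S : ℝ} {τ h D : ℕ → ℝ} {u : ℕ → ℕ → ℝ → ℝ}
  {Q : ℕ → ℕ → ℝ → ℝ → ℝ} {m : ℕ → ℕ → ℝ → ℝ} {ρ₀ : ℝ → ℝ}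

theorem IsApproximation.mollified_entropy_le {τ h D r a : ℝ} {u : ℕ → ℝ → ℝ} {Q : ℕ → ℝ → ℝ → ℝ}
    {m : ℕ → ℝ → ℝ} {ω : ℝ → ℝ} (hq : IsKruzkovFlux q F) (ap : IsApproximation q τ h D B S u Q m)
    (hD : 0 ≤ D) (hω : IsMollifier ω r a) {C : ℝ} (hC : ∀ x, |deriv ω x| ≤ C) {T : ℝ} (x : ℝ)
    {κ : ℝ} (hκ : κ ∈ Icc (0 : ℝ) 1) {b c : ℝ} (hb : 0 ≤ b) (hbc : b ≤ c) (hcT : c ≤ T) :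
    ∫ y, |stepFamily τ u c y - κ| * ω (x - y) ≤ (∫ y, |stepFamily τ u b y - κ| * ω (x - y))
        - (∫ s in b..c, ∫ y, q κ (stepFamily τ u s y) * deriv ω (x - y))
        + ((T + τ) * (C * D) + 2 * τ * (F * a)) := by
  have hc : ContDiff ℝ 1 (fun y => ω (x - y)) := hω.contDiff.comp (by fun_prop)
  have hs : HasCompactSupport (fun y => ω (x - y)) :=
    hω.hasCompactSupport.comp_homeomorph (Homeomorph.subLeft x)
  have hd : ∀ y, deriv (fun y => ω (x - y)) y = -deriv ω (x - y) :=
    fun y => deriv_comp_const_sub ω x y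
  have h1 := ap.entropy_stepFamily_le hq hD hκ hc hs (fun y => hω.nonneg _) (C := C)
    (fun y => by rw [hd, abs_neg]; exact hC _) hb hbc
  simp only [hd, mul_neg, integral_neg, intervalIntegral.integral_neg, abs_neg] at h1
  rw [integral_sub_left_eq_self (fun z => |deriv ω z|)] at h1
  have hC0 : 0 ≤ C := (abs_nonneg _).trans (hC 0)
  have hτ := ap.τ_pos
  have h2 : (c - b + τ) * (C * D) ≤ (T + τ) * (C * D) :=
    mul_le_mul_of_nonneg_right (by linarith) (mul_nonneg hC0 hD)
  have h3 : 2 * τ * (F * ∫ z, |deriv ω z|) ≤ 2 * τ * (F * a) :=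
    mul_le_mul_of_nonneg_left (mul_le_mul_of_nonneg_left hω.integral_deriv_le hq.nonneg)
      (by positivity)
  linarith

/-- A coarse numerical solution k plays the discrete role and a finer one k' the continuous role.
The defect of the finer one is multiplied by about T/τ_k, so k must be fixed before k' tends to
infinity. -/
theorem exists_forall_eventually_close (hq : IsKruzkovFlux q F)
    (ap : ∀ k, IsApproximation q (τ k) (h k) (D k) B S (u k) (Q k) (m k)) (hD : ∀ k, 0 ≤ D k)
    (hτl : Tendsto τ atTop (𝓝 0)) (hDl : Tendsto D atTop (𝓝 0))
    (hρ₀ : AEStronglyMeasurable ρ₀ volume)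
    (hu0 : Tendsto (fun k => ∫⁻ x, ‖ρ₀ x - u k 0 x‖ₑ) atTop (𝓝 0)) {T R η : ℝ} (hT : 0 ≤ T)
    (hη : 0 < η) :
    ∃ k, ∀ᶠ k' in atTop, ∀ t ∈ Icc 0 T,
      ∫⁻ y in Icc (-R) R, ‖stepFamily (τ k') (u k') t y - stepFamily (τ k) (u k) t y‖ₑ
        ≤ ENNReal.ofReal η := by
  obtain ⟨c₀, hc₀, hmol⟩ := exists_mollifier
  have hF := hq.nonneg
  have hB := (ap 0).B_nonneg
  have hS := (ap 0).S_nonneg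
  wlog hR : 0 ≤ R generalizing R
  · refine ⟨0, Eventually.of_forall fun k' t _ => ?_⟩
    rw [Icc_eq_empty (by linarith)]
    simp
  -- Keeps the absorption factor 1 - F δ T at least 1/2.
  set δ : ℝ := 1 / (2 * (F * T + 1)) with hδdef
  have hFT : 0 ≤ F * T := mul_nonneg hF hT
  have hδ : 0 < δ := by positivity
  have hδT : F * δ * T ≤ 1 / 2 := by
    rw [hδdef, mul_one_div, div_mul_eq_mul_div, div_le_div_iff₀ (by positivity) (by positivity)]
    linarith
  set w₀ : ℝ := weight δ (R + 1) * (1 / 2) with hw₀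
  have hw₀pos : 0 < w₀ := mul_pos (weight_pos _ _) (by norm_num)
  -- Five errors share the budget: two initial layers, the mollification, the coarse flux and time
  -- errors, and the defect of the fine solution.
  set ζ : ℝ := w₀ * η / 5 with hζdef
  have hζ : 0 < ζ := by positivity
  set r : ℝ := min 1 (ζ / (2 * B + 1)) with hrdef
  have hr : 0 < r := lt_min one_pos (by positivity)
  have hr1 : r ≤ 1 := min_le_left _ _
  have hrB : 2 * r * B ≤ ζ := by
    have h1 : r ≤ ζ / (2 * B + 1) := min_le_right _ _
    rw [le_div_iff₀ (by positivity)] at h1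
    linarith
  obtain ⟨ω, hω⟩ := hmol r hr
  obtain ⟨C, hC⟩ := (continuous_deriv_of_contDiff hω.contDiff).bounded_above_of_compact_support
    hω.hasCompactSupport.deriv
  set a : ℝ := c₀ / r with ha
  set W : ℝ := ∫ x, weight δ x with hW
  have l1 : Tendsto (fun k => T * ((a + δ) * D k + F * (a * (τ k * S))) + τ k * S) atTop (𝓝 0) := by
    have := (((hDl.const_mul (a + δ)).add (((hτl.mul_const S).const_mul a).const_mul F)).const_mul
      T).add (hτl.mul_const S)
    simpa using this
  have hζ' : (0 : ℝ≥0∞) < ENNReal.ofReal ζ := ENNReal.ofReal_pos.2 hζ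
  have ev0 := hu0.eventually_le_const hζ'
  obtain ⟨k, hk1, hk2⟩ := ((l1.eventually_le_const hζ).and ev0).exists
  refine ⟨k, ?_⟩
  have l2 : Tendsto (fun k' => 2 * (T / τ k + 1) *
      (((T + τ k') * (C * D k') + 2 * τ k' * (F * a)) * W)) atTop (𝓝 0) := by
    have := ((((hτl.const_add T).mul (hDl.const_mul C)).add
      ((hτl.const_mul 2).mul_const (F * a))).mul_const W).const_mul (2 * (T / τ k + 1))
    simpa using this
  filter_upwards [ev0, l2.eventually_le_const hζ] with k' hk3 hk4 t ht
  have hτk := (ap k).τ_pos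
  have hτk' := (ap k').τ_pos
  have hC0 : 0 ≤ C := (norm_nonneg _).trans (hC 0)
  have ha0 : 0 ≤ a := by positivity
  have hDk' := hD k'
  have key := setLIntegral_sub_le (E := (T + τ k') * (C * D k') + 2 * τ k' * (F * a)) hq (ap k)
    (hD k) (ap k').isTimeFamily hω hr.le hδ hT (by positivity) (by linarith)
    (fun x κ hκ b c hb hbc hcT => (ap k').mollified_entropy_le hq (hD k') hω hC x hκ hb hbc hcT)
    ht.1 ht.2 R
  have hinit : ∫⁻ y, ‖stepFamily (τ k') (u k') 0 y - u k 0 y‖ₑ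
      ≤ ENNReal.ofReal ζ + ENNReal.ofReal ζ := by
    refine le_trans ?_ (add_le_add hk3 hk2)
    have hm : AEMeasurable (fun x => ‖ρ₀ x - u k' 0 x‖ₑ) :=
      (hρ₀.sub ((ap k').measurable 0).aestronglyMeasurable).enorm
    rw [← lintegral_add_left' hm]
    refine lintegral_mono fun x => ?_
    rw [← enorm_neg (ρ₀ x - u k' 0 x)]
    refine le_trans (le_of_eq ?_) (enorm_add_le _ _)
    simp only [stepFamily, zero_div, Nat.floor_zero]
    congr 1
    ring
  have hfac : ENNReal.ofReal w₀ ≤ ENNReal.ofReal (weight δ (R + r) * (1 - F * δ * T)) := by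
    refine ENNReal.ofReal_le_ofReal (mul_le_mul ?_ (by linarith) (by norm_num) (weight_pos _ _).le)
    exact weight_anti (by rw [abs_of_nonneg (by linarith)]; linarith)
  have hfin : ENNReal.ofReal w₀ * (∫⁻ y in Icc (-R) R,
      ‖stepFamily (τ k') (u k') t y - stepFamily (τ k) (u k) t y‖ₑ)
      ≤ ENNReal.ofReal w₀ * ENNReal.ofReal η := by
    refine (mul_le_mul_left hfac _).trans (key.trans ((add_le_add hinit le_rfl).trans ?_))
    rw [← ENNReal.ofReal_add hζ.le hζ.le, ← ENNReal.ofReal_mul hw₀pos.le,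
      ← ENNReal.ofReal_add (by positivity)]
    · refine ENNReal.ofReal_le_ofReal ?_
      have : w₀ * η = 5 * ζ := by rw [hζdef]; ring
      rw [this]
      linarith
    · have := hD k
      have hW0 : 0 ≤ W := integral_nonneg fun x => (weight_pos δ x).le
      positivity
  exact (ENNReal.mul_le_mul_iff_right (ENNReal.ofReal_pos.2 hw₀pos).ne' ENNReal.ofReal_ne_top).1 hfin

theorem exists_forall_close (hq : IsKruzkovFlux q F)
    (ap : ∀ k, IsApproximation q (τ k) (h k) (D k) B S (u k) (Q k) (m k)) (hD : ∀ k, 0 ≤ D k)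
    (hτl : Tendsto τ atTop (𝓝 0)) (hDl : Tendsto D atTop (𝓝 0))
    (hρ₀ : AEStronglyMeasurable ρ₀ volume)
    (hu0 : Tendsto (fun k => ∫⁻ x, ‖ρ₀ x - u k 0 x‖ₑ) atTop (𝓝 0)) {T R η : ℝ} (hT : 0 ≤ T)
    (hη : 0 < η) :
    ∃ N, ∀ i, N ≤ i → ∀ j, N ≤ j → ∀ t ∈ Icc 0 T,
      ∫⁻ y in Icc (-R) R, ‖stepFamily (τ i) (u i) t y - stepFamily (τ j) (u j) t y‖ₑ
        ≤ ENNReal.ofReal η := by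
  obtain ⟨k, hk⟩ := exists_forall_eventually_close hq ap hD hτl hDl hρ₀ hu0 (R := R) hT (half_pos hη)
  obtain ⟨N, hN⟩ := eventually_atTop.1 hk
  refine ⟨N, fun i hi j hj t ht => ?_⟩
  have hm : Measurable (fun y => ‖stepFamily (τ i) (u i) t y - stepFamily (τ k) (u k) t y‖ₑ) :=
    (((ap i).measurable _).sub ((ap k).measurable _)).enorm
  calc _ ≤ ∫⁻ y in Icc (-R) R, (‖stepFamily (τ i) (u i) t y - stepFamily (τ k) (u k) t y‖ₑ
        + ‖stepFamily (τ j) (u j) t y - stepFamily (τ k) (u k) t y‖ₑ) := by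
        refine lintegral_mono fun y => ?_
        rw [← enorm_neg (stepFamily (τ j) (u j) t y - _)]
        refine le_trans (le_of_eq ?_) (enorm_add_le _ _)
        congr 1
        ring
    _ ≤ ENNReal.ofReal (η / 2) + ENNReal.ofReal (η / 2) := by
        rw [lintegral_add_left hm]
        exact add_le_add (hN i hi t ht) (hN j hj t ht)
    _ = _ := by
        rw [← ENNReal.ofReal_add (half_pos hη).le (half_pos hη).le, add_halves]

end Cauchy

/-! ### The limit of the numerical solutions -/

/-- The pointwise limit of a sequence of functions with values in `[0,1]`. -/
def limitFamily (w : ℕ → ℝ → ℝ → ℝ) (t x : ℝ) : ℝ :=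
  max 0 (min 1 (limUnder atTop fun j => w j t x))

section Limit

variable {w : ℕ → ℝ → ℝ → ℝ}

theorem measurable_limitFamily (hw : ∀ j, Measurable (fun z : ℝ × ℝ => w j z.1 z.2)) :
    Measurable (fun z : ℝ × ℝ => limitFamily w z.1 z.2) := by
  have h1 : StronglyMeasurable (fun z : ℝ × ℝ => limUnder atTop fun j => w j z.1 z.2) :=
    StronglyMeasurable.limUnder fun j => (hw j).stronglyMeasurable
  exact (by fun_prop : Continuous fun x : ℝ => max 0 (min 1 x)).measurable.comp h1.measurable

theorem isTimeFamily_limitFamily (hw : ∀ j, Measurable (fun z : ℝ × ℝ => w j z.1 z.2)) :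
    IsTimeFamily (limitFamily w) where
  aestronglyMeasurable := (measurable_limitFamily hw).aestronglyMeasurable
  slice t _ := ((measurable_limitFamily hw).comp (measurable_prodMk_left (x := t))).aestronglyMeasurable
  mem _ _ := clamp_mem _

/-- A summable Cauchy rate gives a.e. convergence for every t along one and the same sequence. Thus
the limit is defined pointwise, is jointly measurable and has the right slice at every time. -/
theorem ae_tendsto_limitFamily (hw : ∀ j, Measurable (fun z : ℝ × ℝ => w j z.1 z.2))
    (h01 : ∀ j t x, w j t x ∈ Icc (0 : ℝ) 1)
    (hcau : ∀ N i j : ℕ, N ≤ i → N ≤ j → ∀ t ∈ Icc (0 : ℝ) N,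
      ∫⁻ x in Icc (-(N : ℝ)) N, ‖w i t x - w j t x‖ₑ ≤ ENNReal.ofReal ((1 / 2) ^ N))
    {t : ℝ} (ht : 0 ≤ t) : ∀ᵐ x, Tendsto (fun j => w j t x) atTop (𝓝 (limitFamily w t x)) := by
  have hR : ∀ R : ℕ, ∀ᵐ x, x ∈ Icc (-(R : ℝ)) R → ∃ l, Tendsto (fun j => w j t x) atTop (𝓝 l) := by
    intro R
    rw [← ae_restrict_iff' measurableSet_Icc]
    obtain ⟨J, hJ⟩ := exists_nat_ge (max t R)
    have hJt : t ≤ J := (le_max_left _ _).trans hJ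
    have hJR : (R : ℝ) ≤ J := (le_max_right _ _).trans hJ
    have hm : ∀ j, Measurable (w j t) := fun j => (hw j).comp measurable_prodMk_left
    -- The shift by J makes the windows contain t and [-R,R]; the factor 2 in the rate makes the
    -- required inequality strict.
    have h1 := Lp.ae_tendsto_of_cauchy_eLpNorm (μ := volume.restrict (Icc (-(R : ℝ)) R)) (p := 1)
      (f := fun j => w (j + J) t) (B := fun N => ENNReal.ofReal (2 * (1 / 2) ^ N))
      (fun j => (hm _).aestronglyMeasurable) le_rfl ?_ ?_
    · refine h1.mono fun x hx => ?_
      obtain ⟨l, hl⟩ := hx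
      exact ⟨l, (tendsto_add_atTop_iff_nat J).1 hl⟩
    · rw [← ENNReal.ofReal_tsum_of_nonneg (fun N => by positivity)
        (summable_geometric_two.mul_left 2)]
      exact ENNReal.ofReal_ne_top
    · intro N i j hi hj
      rw [eLpNorm_one_eq_lintegral_enorm]
      have h2 := hcau (N + J) (i + J) (j + J) (by omega) (by omega) t
        ⟨ht, by push_cast; linarith [(Nat.cast_nonneg N : (0 : ℝ) ≤ N)]⟩
      have hN : (0 : ℝ) ≤ N := Nat.cast_nonneg N
      refine ((lintegral_mono_set (Icc_subset_Icc ?_ ?_)).trans h2).trans_lt ?_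
      · push_cast; linarith
      · push_cast; linarith
      · rw [ENNReal.ofReal_lt_ofReal_iff (by positivity), pow_add]
        have h3 : (1 / 2 : ℝ) ^ J ≤ 1 := pow_le_one₀ (by norm_num) (by norm_num)
        have h4 : (0 : ℝ) < (1 / 2) ^ N := by positivity
        nlinarith
  filter_upwards [ae_all_iff.2 hR] with x hx
  obtain ⟨R, hRx⟩ := exists_nat_ge |x|
  obtain ⟨l, hl⟩ := hx R (abs_le.1 hRx)
  have hl01 : l ∈ Icc (0 : ℝ) 1 := isClosed_Icc.mem_of_tendsto hl (Eventually.of_forall fun j => h01 j t x)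
  rw [limitFamily, hl.limUnder_eq, clamp_eq hl01]
  exact hl

theorem tendsto_setLIntegral_limitFamily (hw : ∀ j, Measurable (fun z : ℝ × ℝ => w j z.1 z.2))
    (h01 : ∀ j t x, w j t x ∈ Icc (0 : ℝ) 1) {t : ℝ}
    (hae : ∀ᵐ x, Tendsto (fun j => w j t x) atTop (𝓝 (limitFamily w t x))) (R : ℝ) :
    Tendsto (fun j => ∫⁻ x in Icc (-R) R, ‖w j t x - limitFamily w t x‖ₑ) atTop (𝓝 0) := by
  have hm : ∀ j, Measurable (fun x => ‖w j t x - limitFamily w t x‖ₑ) := fun j =>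
    (((hw j).comp measurable_prodMk_left).sub
      ((measurable_limitFamily hw).comp measurable_prodMk_left)).enorm
  have h1 := tendsto_lintegral_of_dominated_convergence (μ := volume.restrict (Icc (-R) R))
    (F := fun j x => ‖w j t x - limitFamily w t x‖ₑ) (f := fun _ => 0) (fun _ => 1) hm
    (fun j => Eventually.of_forall fun x => ?_) (by simp) ?_
  · simpa using h1
  · simp only
    rw [Real.enorm_eq_ofReal_abs, ← ENNReal.ofReal_one]
    exact ENNReal.ofReal_le_ofReal (abs_sub_le_one (h01 j t x) (clamp_mem _))
  · refine ae_restrict_of_ae (hae.mono fun x hx => ?_)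
    have := (hx.sub_const (limitFamily w t x)).enorm
    simpa using this

end Limit

/-! ### Existence of entropy solutions -/

section Existence

variable {q : ℝ → ℝ → ℝ} {F B S : ℝ} {τ h D : ℕ → ℝ} {u : ℕ → ℕ → ℝ → ℝ}
  {Q : ℕ → ℕ → ℝ → ℝ → ℝ} {m : ℕ → ℕ → ℝ → ℝ} {ρ₀ : ℝ → ℝ}

/-- The rounding of times to the grid costs τ S, which disappears in the limit and leaves a genuine
Lipschitz bound in time. -/
theorem setLIntegral_limit_time_le
    (ap : ∀ k, IsApproximation q (τ k) (h k) (D k) B S (u k) (Q k) (m k))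
    (hτl : Tendsto τ atTop (𝓝 0)) {v : ℝ → ℝ → ℝ} (hv : IsTimeFamily v)
    (hconv : ∀ t, 0 ≤ t → ∀ R : ℝ,
      Tendsto (fun k => ∫⁻ x in Icc (-R) R, ‖stepFamily (τ k) (u k) t x - v t x‖ₑ) atTop (𝓝 0))
    {s t : ℝ} (hs : 0 ≤ s) (hst : s ≤ t) (R : ℝ) :
    ∫⁻ x in Icc (-R) R, ‖v t x - v s x‖ₑ ≤ ENNReal.ofReal ((t - s) * S) := by
  have l1 : Tendsto (fun k => (t - s + τ k) * S) atTop (𝓝 ((t - s + 0) * S)) :=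
    (hτl.const_add (t - s)).mul_const S
  have l2 := ((hconv t (hs.trans hst) R).add (ENNReal.tendsto_ofReal l1)).add (hconv s hs R)
  rw [add_zero, zero_add, add_zero] at l2
  refine ge_of_tendsto' l2 fun k => ?_
  have hmt : AEMeasurable (fun x => ‖stepFamily (τ k) (u k) t x - v t x‖ₑ)
      (volume.restrict (Icc (-R) R)) :=
    (((ap k).measurable _).aestronglyMeasurable.sub (hv.slice t (hs.trans hst))).enorm.restrict
  have hmm : Measurable (fun x => ‖stepFamily (τ k) (u k) t x - stepFamily (τ k) (u k) s x‖ₑ) :=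
    (((ap k).measurable _).sub ((ap k).measurable _)).enorm
  have h1 := (setLIntegral_le_lintegral (Icc (-R) R) _).trans ((ap k).lintegral_stepFamily_sub_le hs hst)
  refine le_trans ?_ (add_le_add (add_le_add le_rfl h1) le_rfl)
  have hma : AEMeasurable (fun x => ‖stepFamily (τ k) (u k) t x - v t x‖ₑ
      + ‖stepFamily (τ k) (u k) t x - stepFamily (τ k) (u k) s x‖ₑ)
      (volume.restrict (Icc (-R) R)) := hmt.add hmm.aemeasurable
  rw [← lintegral_add_right _ hmm, ← lintegral_add_left' hma]
  refine lintegral_mono fun x => ?_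
  rw [← enorm_neg (stepFamily (τ k) (u k) t x - v t x)]
  refine le_trans (le_of_eq ?_) ((enorm_add_le _ _).trans (add_le_add (enorm_add_le _ _) le_rfl))
  congr 1
  ring

theorem continuous_L1loc_limit
    (ap : ∀ k, IsApproximation q (τ k) (h k) (D k) B S (u k) (Q k) (m k))
    (hτl : Tendsto τ atTop (𝓝 0)) {v : ℝ → ℝ → ℝ} (hv : IsTimeFamily v)
    (hconv : ∀ t, 0 ≤ t → ∀ R : ℝ,
      Tendsto (fun k => ∫⁻ x in Icc (-R) R, ‖stepFamily (τ k) (u k) t x - v t x‖ₑ) atTop (𝓝 0))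
    {t : ℝ} (ht : 0 ≤ t) (R : ℝ) :
    Tendsto (fun s => ∫⁻ x in Icc (-R) R, ‖v s x - v t x‖ₑ) (𝓝[Ici 0] t) (𝓝 0) := by
  have hc : Continuous (fun s => |s - t| * S) := by fun_prop
  have h1 := ENNReal.tendsto_ofReal ((hc.tendsto t).mono_left (nhdsWithin_le_nhds (s := Ici 0)))
  rw [sub_self, abs_zero, zero_mul, ENNReal.ofReal_zero] at h1
  refine tendsto_of_tendsto_of_tendsto_of_le_of_le' tendsto_const_nhds h1
    (Eventually.of_forall fun _ => zero_le) ?_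
  filter_upwards [self_mem_nhdsWithin] with s hs
  rcases le_total s t with hst | hst
  · have := setLIntegral_limit_time_le ap hτl hv hconv hs hst R
    rw [abs_of_nonpos (by linarith), neg_sub]
    refine le_trans (le_of_eq ?_) this
    refine lintegral_congr fun x => ?_
    rw [← enorm_neg, neg_sub]
  · have := setLIntegral_limit_time_le ap hτl hv hconv ht hst R
    rwa [abs_of_nonneg (by linarith)]

theorem tendsto_integral_of_L1loc {θ φ : ℝ → ℝ} {K : ℝ} (hθ : Continuous θ)
    (hK : ∀ a ∈ Icc (0 : ℝ) 1, ∀ b ∈ Icc (0 : ℝ) 1, |θ a - θ b| ≤ K * |a - b|) (hK0 : 0 ≤ K)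
    {f : ℕ → ℝ → ℝ} {g : ℝ → ℝ} (hf : ∀ k, AEStronglyMeasurable (f k) volume)
    (hf01 : ∀ k x, f k x ∈ Icc (0 : ℝ) 1)
    (hg : AEStronglyMeasurable g volume) (hg01 : ∀ x, g x ∈ Icc (0 : ℝ) 1)
    (hfg : ∀ R : ℝ, Tendsto (fun k => ∫⁻ x in Icc (-R) R, ‖f k x - g x‖ₑ) atTop (𝓝 0))
    (hφ : Continuous φ) (hφs : HasCompactSupport φ) :
    Tendsto (fun k => ∫ x, θ (f k x) * φ x) atTop (𝓝 (∫ x, θ (g x) * φ x)) := by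
  obtain ⟨R, -, hR⟩ := exists_Icc_support hφs
  obtain ⟨C, hC⟩ := hφ.bounded_above_of_compact_support hφs
  rw [tendsto_iff_norm_sub_tendsto_zero]
  have h1 := (ENNReal.tendsto_toReal ENNReal.zero_ne_top).comp (hfg R)
  have h2 := h1.const_mul (K * C)
  rw [ENNReal.toReal_zero, mul_zero] at h2
  exact squeeze_zero (fun _ => norm_nonneg _) (fun k =>
    abs_integral_comp_mul_sub_le hθ hK hK0 (hf k) (hf01 k) hg hg01
      (hφ.integrable_of_hasCompactSupport hφs) hC hR) h2

theorem isSliceEntropic_limit (hq : IsKruzkovFlux q F)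
    (ap : ∀ k, IsApproximation q (τ k) (h k) (D k) B S (u k) (Q k) (m k)) (hD : ∀ k, 0 ≤ D k)
    (hτl : Tendsto τ atTop (𝓝 0)) (hDl : Tendsto D atTop (𝓝 0)) {v : ℝ → ℝ → ℝ}
    (hv : IsTimeFamily v)
    (hconv : ∀ t, 0 ≤ t → ∀ R : ℝ,
      Tendsto (fun k => ∫⁻ x in Icc (-R) R, ‖stepFamily (τ k) (u k) t x - v t x‖ₑ) atTop (𝓝 0)) :
    IsSliceEntropic q v := by
  intro κ hκ φ hφ hφs hφ0 b c hb hbc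
  have hφ'c := continuous_deriv_of_contDiff hφ
  have hφ'i : Integrable (deriv φ) := integrable_deriv_of_contDiff hφ hφs
  obtain ⟨C, hC⟩ := hφ'c.bounded_above_of_compact_support hφs.deriv
  have hE : Continuous (fun x : ℝ => |x - κ|) := by fun_prop
  have hqc := hq.continuous_right κ
  have lE : ∀ t, 0 ≤ t → Tendsto (fun k => ∫ x, |stepFamily (τ k) (u k) t x - κ| * φ x) atTop
      (𝓝 (∫ x, |v t x - κ| * φ x)) := fun t ht =>
    tendsto_integral_of_L1loc (θ := fun x => |x - κ|) hE
      (fun a _ b _ => abs_abs_sub_sub_abs_sub_le κ a b) zero_le_one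
      (fun k => (ap k).isTimeFamily.slice t ht) (fun k => (ap k).isTimeFamily.mem t)
      (hv.slice t ht) (hv.mem t) (hconv t ht) hφ.continuous hφs
  have lq : ∀ t, 0 ≤ t → Tendsto (fun k => ∫ x, q κ (stepFamily (τ k) (u k) t x) * deriv φ x) atTop
      (𝓝 (∫ x, q κ (v t x) * deriv φ x)) := fun t ht =>
    tendsto_integral_of_L1loc hqc (hq.lip κ hκ) hq.nonneg
      (fun k => (ap k).isTimeFamily.slice t ht) (fun k => (ap k).isTimeFamily.mem t)
      (hv.slice t ht) (hv.mem t) (hconv t ht) hφ'c hφs.deriv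
  have lI : Tendsto (fun k => ∫ s in b..c, ∫ x, q κ (stepFamily (τ k) (u k) s x) * deriv φ x) atTop
      (𝓝 (∫ s in b..c, ∫ x, q κ (v s x) * deriv φ x)) := by
    refine intervalIntegral.tendsto_integral_filter_of_dominated_convergence
      (fun _ => F * ∫ x, |deriv φ x|) ?_ ?_ intervalIntegrable_const ?_
    · refine Eventually.of_forall fun k => ?_
      have := (ap k).isTimeFamily.integrableOn_flux hqc hφ'i c
      refine (this.mono_set ?_).aestronglyMeasurable
      rw [uIoc_of_le hbc]
      exact Ioc_subset_Ioc_left hb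
    · refine Eventually.of_forall fun k => Eventually.of_forall fun s _ => ?_
      have := norm_integral_le_of_norm_le (hφ'i.abs.const_mul F)
        (f := fun x => q κ (stepFamily (τ k) (u k) s x) * deriv φ x) (Eventually.of_forall fun x => by
          rw [norm_mul]
          exact mul_le_mul_of_nonneg_right (hq.abs_le_const hκ ((ap k).mem _ x)) (norm_nonneg _))
      rwa [integral_const_mul] at this
    · refine Eventually.of_forall fun s hs => lq s ?_
      rw [uIoc_of_le hbc] at hs
      exact hb.trans hs.1.le
  have le : Tendsto (fun k => (c - b + τ k) * (C * D k) + 2 * τ k * (F * ∫ x, |deriv φ x|)) atTop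
      (𝓝 0) := by
    have := ((hτl.const_add (c - b)).mul (hDl.const_mul C)).add
      ((hτl.const_mul 2).mul_const (F * ∫ x, |deriv φ x|))
    simpa using this
  have l := ((lE b hb).add lI).add le
  rw [add_zero] at l
  exact le_of_tendsto_of_tendsto' (lE c (hb.trans hbc)) l fun k =>
    (ap k).entropy_stepFamily_le hq (hD k) hκ hφ hφs hφ0 hC hb hbc

theorem initial_limit
    (ap : ∀ k, IsApproximation q (τ k) (h k) (D k) B S (u k) (Q k) (m k))
    (hρ₀ : AEStronglyMeasurable ρ₀ volume)
    (hu0 : Tendsto (fun k => ∫⁻ x, ‖ρ₀ x - u k 0 x‖ₑ) atTop (𝓝 0)) {v : ℝ → ℝ → ℝ}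
    (hv : IsTimeFamily v)
    (hconv : ∀ t, 0 ≤ t → ∀ R : ℝ,
      Tendsto (fun k => ∫⁻ x in Icc (-R) R, ‖stepFamily (τ k) (u k) t x - v t x‖ₑ) atTop (𝓝 0)) :
    v 0 =ᵐ[volume] ρ₀ := by
  have hR : ∀ R : ℕ, ∀ᵐ x, x ∈ Icc (-(R : ℝ)) R → v 0 x = ρ₀ x := by
    intro R
    rw [← ae_restrict_iff' measurableSet_Icc]
    have hmv : AEMeasurable (fun x => ‖ρ₀ x - v 0 x‖ₑ) (volume.restrict (Icc (-(R : ℝ)) R)) :=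
      (hρ₀.sub (hv.slice 0 le_rfl)).enorm.restrict
    have h1 : ∫⁻ x in Icc (-(R : ℝ)) R, ‖ρ₀ x - v 0 x‖ₑ ≤ 0 := by
      have l := hu0.add (hconv 0 le_rfl R)
      rw [add_zero] at l
      refine ge_of_tendsto' l fun k => ?_
      have hm : AEMeasurable (fun x => ‖ρ₀ x - u k 0 x‖ₑ) (volume.restrict (Icc (-(R : ℝ)) R)) :=
        (hρ₀.sub ((ap k).measurable 0).aestronglyMeasurable).enorm.restrict
      refine le_trans ?_ (add_le_add (setLIntegral_le_lintegral (Icc (-(R : ℝ)) R) _) le_rfl)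
      rw [← lintegral_add_left' hm]
      refine lintegral_mono fun x => le_trans (le_of_eq ?_) (enorm_add_le _ _)
      simp only [stepFamily, zero_div, Nat.floor_zero]
      rw [sub_add_sub_cancel]
    rw [nonpos_iff_eq_zero, lintegral_eq_zero_iff' hmv] at h1
    filter_upwards [h1] with x hx
    rw [Pi.zero_apply, enorm_eq_zero, sub_eq_zero] at hx
    exact hx.symm
  filter_upwards [ae_all_iff.2 hR] with x hx
  obtain ⟨R, hRx⟩ := exists_nat_ge |x|
  exact hx R (abs_le.1 hRx)

/-- Being Cauchy in L¹_loc uniformly on bounded time intervals is all that is used to extract the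
limit; the entropy inequalities pass to it because both defects τ and D vanish. -/
theorem exists_entropic_limit (hq : IsKruzkovFlux q F)
    (ap : ∀ k, IsApproximation q (τ k) (h k) (D k) B S (u k) (Q k) (m k)) (hD : ∀ k, 0 ≤ D k)
    (hτl : Tendsto τ atTop (𝓝 0)) (hDl : Tendsto D atTop (𝓝 0))
    (hρ₀ : AEStronglyMeasurable ρ₀ volume)
    (hu0 : Tendsto (fun k => ∫⁻ x, ‖ρ₀ x - u k 0 x‖ₑ) atTop (𝓝 0)) :
    ∃ v, IsTimeFamily v ∧ (∀ t, 0 ≤ t → ∀ R : ℝ,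
      Tendsto (fun s => ∫⁻ x in Icc (-R) R, ‖v s x - v t x‖ₑ) (𝓝[Ici 0] t) (𝓝 0)) ∧
      v 0 =ᵐ[volume] ρ₀ ∧ IsSliceEntropic q v := by
  have hN : ∀ N : ℕ, ∃ n, ∀ i, n ≤ i → ∀ j, n ≤ j → ∀ t ∈ Icc (0 : ℝ) N,
      ∫⁻ y in Icc (-(N : ℝ)) N, ‖stepFamily (τ i) (u i) t y - stepFamily (τ j) (u j) t y‖ₑ
        ≤ ENNReal.ofReal ((1 / 2) ^ N) := fun N =>
    exists_forall_close hq ap hD hτl hDl hρ₀ hu0 (Nat.cast_nonneg N) (by positivity)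
  choose n hn using hN
  -- A diagonal choice: σ(j) exceeds every threshold n(N) with N ≤ j, and the summand j makes it
  -- tend to infinity.
  set σ : ℕ → ℕ := fun j => j + ∑ l ∈ Finset.range (j + 1), n l with hσ
  have hσl : Tendsto σ atTop atTop :=
    tendsto_atTop_mono (fun j => Nat.le_add_right j _) tendsto_id
  have hσn : ∀ N j, N ≤ j → n N ≤ σ j := fun N j hNj =>
    (Finset.single_le_sum (f := n) (fun _ _ => Nat.zero_le _)
      (Finset.mem_range.2 (by omega))).trans (Nat.le_add_left _ _)
  set w : ℕ → ℝ → ℝ → ℝ := fun j => stepFamily (τ (σ j)) (u (σ j)) with hw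
  have hwm : ∀ j, Measurable (fun z : ℝ × ℝ => w j z.1 z.2) :=
    fun j => (ap (σ j)).measurable_stepFamily
  have hw01 : ∀ j t x, w j t x ∈ Icc (0 : ℝ) 1 := fun j t x => (ap (σ j)).mem _ _
  have hv := isTimeFamily_limitFamily hwm
  have hconv : ∀ t, 0 ≤ t → ∀ R : ℝ,
      Tendsto (fun k => ∫⁻ x in Icc (-R) R, ‖w k t x - limitFamily w t x‖ₑ) atTop (𝓝 0) :=
    fun t ht R => tendsto_setLIntegral_limitFamily hwm hw01 (ae_tendsto_limitFamily hwm hw01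
      (fun N i j hi hj t ht => hn N _ (hσn N i hi) _ (hσn N j hj) t ht) ht) R
  have ap' := fun j => ap (σ j)
  have hτ' : Tendsto (fun j => τ (σ j)) atTop (𝓝 0) := hτl.comp hσl
  exact ⟨limitFamily w, hv, fun t ht R => continuous_L1loc_limit ap' hτ' hv hconv ht R,
    initial_limit ap' hρ₀ (hu0.comp hσl) hv hconv,
    isSliceEntropic_limit hq ap' (fun j => hD _) hτ' (hDl.comp hσl) hv hconv⟩

theorem exists_isEntropySolution {V ρ₀ : ℝ → ℝ} (hV : IsVelocity V) (h0 : IsInitialDatum ρ₀) :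
    ∃ ρ, IsEntropySolution V ρ₀ ρ := by
  have hVg := hV.isGlobalVelocity
  set M := supNorm V
  set L := supNorm (deriv V)
  have hM : 0 ≤ M := supNorm_nonneg _
  have hL : 0 ≤ L := supNorm_nonneg _
  set lam := 1 / (M + L + 1) with hlamdef
  have hlam : 0 < lam := by positivity
  have hcfl : lam * (M + L) ≤ 1 := by
    rw [hlamdef, one_div, inv_mul_le_iff₀ (by positivity)]
    linarith
  -- With a fixed g the averaging length shrinks with the mesh, so the flux error tends to zero with
  -- h alone.
  have hg : (1 / 2 : ℝ) ∈ Ioo (0 : ℝ) 1 := by constructor <;> norm_num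
  set h : ℕ → ℝ := fun k => 1 / ((k : ℝ) + 1) with hh
  have hpos : ∀ k, 0 < h k := fun k => by rw [hh]; positivity
  have hl : Tendsto h atTop (𝓝 0) := tendsto_one_div_add_atTop_nhds_zero_nat
  have hTV : 0 ≤ (essVariation ρ₀).toReal := ENNReal.toReal_nonneg
  have ap := fun k => isApproximation hVg h0 hg hlam hcfl (hpos k)
  have hDl : Tendsto (fun k => h k * (1 + 2 / (1 / 2)) * ((2 * M + L) * (essVariation ρ₀).toReal))
      atTop (𝓝 0) := by
    have := (hl.mul_const (1 + 2 / (1 / 2))).mul_const ((2 * M + L) * (essVariation ρ₀).toReal)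
    rwa [zero_mul, zero_mul] at this
  have hu0 : Tendsto (fun k => ∫⁻ x, ‖ρ₀ x - impactFun (clampVelocity V) ρ₀ lam (h k) (1 / 2) 0 x‖ₑ)
      atTop (𝓝 0) := by
    have l1 : Tendsto (fun k => 2 * h k + h k * ((1 - 1 / 2) / (1 / 2))) atTop (𝓝 0) := by
      have := (hl.const_mul 2).add (hl.mul_const ((1 - 1 / 2) / (1 / 2)))
      rwa [mul_zero, zero_mul, add_zero] at this
    have l2 := ENNReal.Tendsto.mul_const (b := essVariation ρ₀) (ENNReal.tendsto_ofReal l1)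
      (Or.inr h0.tv_lt_top.ne)
    rw [ENNReal.ofReal_zero, zero_mul] at l2
    exact tendsto_of_tendsto_of_tendsto_of_le_of_le tendsto_const_nhds l2 (fun _ => zero_le)
      fun k => lintegral_impactFun_zero_sub_le hVg h0 hg hlam hcfl (hpos k)
  obtain ⟨v, hv, hcont, hinit, hent⟩ := exists_entropic_limit hVg.isKruzkovFlux ap
    (fun k => by have := hpos k; positivity) (by simpa using hl.const_mul lam) hDl
    h0.aestronglyMeasurable hu0
  refine ⟨v, ?_, hv.slice, fun t _ => Eventually.of_forall (hv.mem t), hcont, hinit, ?_⟩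
  · rw [volume_restrict_Ioi_prod_univ]
    exact hv.aestronglyMeasurable
  · intro κ hκ φ hφ hφs hφ0
    have h1 := hent.entropy hVg.isKruzkovFlux hv hcont hκ hφ hφs hφ0
    rw [volume_restrict_Ioi_prod_univ]
    refine h1.trans (le_of_eq ?_)
    congr 1
    · simp only [kruzkovFlux_clampVelocity hκ (hv.mem _ _)]
    · exact integral_congr_ae (hinit.mono fun x hx => by simp only [hx])

end Existence

end NonlocalGodunov

end

theorem theorem4p3 :
    ∃ K : ℝ → ℝ → ℝ → ℝ → ℝ, (∀ a b d e, 0 < K a b d e) ∧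
      ∀ V ρ₀ : ℝ → ℝ, NonlocalGodunov.IsVelocity V → NonlocalGodunov.IsInitialDatum ρ₀ →
        ∃ ρ : ℝ → ℝ → ℝ,
          NonlocalGodunov.IsEntropySolution V ρ₀ ρ ∧
          (∀ ρ' : ℝ → ℝ → ℝ, NonlocalGodunov.IsEntropySolution V ρ₀ ρ' →
            ∀ t, 0 ≤ t → ρ' t =ᵐ[volume] ρ t) ∧
          ∀ lam c : ℝ, 0 < lam → 0 < c → NonlocalGodunov.CFL lam V →
            ∀ γ₀ : ℝ → ℝ → ℝ, NonlocalGodunov.IsGeometricFamily c γ₀ →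
              NonlocalGodunov.ConvergesL1loc (NonlocalGodunov.approxImpact V ρ₀ lam γ₀) ρ ∧
              NonlocalGodunov.ConvergesL1loc (NonlocalGodunov.approxDensity V ρ₀ lam γ₀) ρ ∧
              NonlocalGodunov.ErrorBound
                (K lam (NonlocalGodunov.supNorm V) (NonlocalGodunov.supNorm (deriv V)) c)
                ρ₀ (NonlocalGodunov.approxImpact V ρ₀ lam γ₀) ρ ∧
              NonlocalGodunov.ErrorBound
                (K lam (NonlocalGodunov.supNorm V) (NonlocalGodunov.supNorm (deriv V)) c)
                ρ₀ (NonlocalGodunov.approxDensity V ρ₀ lam γ₀) ρ := by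
  obtain ⟨c₀, hc₀, hmol⟩ := NonlocalGodunov.exists_mollifier
  -- The constant does not depend on λ: the CFL condition has already bounded λ (M + L) by 1.
  refine ⟨fun _ M L c => NonlocalGodunov.errorConst c₀ M L c,
    fun _ M L c => NonlocalGodunov.errorConst_pos hc₀ M L c, fun V ρ₀ hV h0 => ?_⟩
  obtain ⟨ρ, hρ⟩ := NonlocalGodunov.exists_isEntropySolution hV h0
  refine ⟨ρ, hρ, fun ρ' hρ' t ht => hρ.unique hV h0 hρ' ht,
    fun lam c hlam hc hcfl γ₀ hγ => ?_⟩
  have h1 := NonlocalGodunov.errorBound_approxImpact hc₀ hmol hV h0 hρ hlam hc hcfl hγ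
  have h2 := NonlocalGodunov.errorBound_approxDensity hc₀ hmol hV h0 hρ hlam hc hcfl hγ
  have hK := (NonlocalGodunov.errorConst_pos hc₀ (NonlocalGodunov.supNorm V)
    (NonlocalGodunov.supNorm (deriv V)) c).le
  exact ⟨h1.convergesL1loc hK h0, h2.convergesL1loc hK h0, h1, h2⟩
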